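/- **Theorem (Average upper bound).** *Outcome model.* Let $K\ge 2$, let $\Theta=[\theta_1,\theta_2]\subset\mathbb R$ with $\theta_1<\theta_2$, let $\mathcal Y\subseteq\mathbb R$ be a (measurable) outcome space, and for $a\in[K]=\{1,\dots,K\}$ let $\sigma_a^2:\Theta\to(0,\infty)$ be continuous. For every $a\in[K]$ let $(P_{a,\mu})_{\mu\in\Theta}$ be a family of probability distributions on $\mathcal Y$ with the following properties, where $Y\sim P_{a,\mu}$. (1) $P_{a,\mu}$ has a probability mass function or a probability density function $f_a(y\mid\mu)$ on $\mathcal Y$, with $f_a(y\mid\mu)>0$ for all $y\in\mathcal Y$, $\mu\in\Theta$. (2) $Y$ has mean $\mu$, variance $\sigma_a^2(\mu)$, and finite third absolute moment. (3) For each $y\in\mathcal Y$, $\ell(\mu)=\log f_a(y\mid\mu)$ is three times differentiable on $\Theta$ (one-sidedly at the endpoints); the Fisher information $I(\mu)=\mathbb E_\mu[\dot\ell(\mu)^2]$ is finite and equals $1/\sigma_a^2(\mu)$; $\mathbb E_\mu[\dot\ell(\mu)]=0$ and $\mathbb E_\mu[\ddot\ell(\mu)]=-I(\mu)$; and for each $\mu\in\Theta$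 there are a neighbourhood $U$ of $\mu$ and a function $u\ge0$ with $\mathbb E_\mu[u(Y)]<\infty$ and $|\ddot\ell(\tau)|\le u(y)$ for all $\tau\in U\cap\Theta$, $y\in\mathcal Y$. For $\boldsymbol\mu\in\Theta^K$ the vectors of potential outcomes $(Y_{a,t})_{a\in[K]}$, $t=1,2,\dots$, are i.i.d. with some joint law whose marginals are $P_{a,\mu_a}$; if arm $A_t$ is allocated in round $t$, the outcome $Y_{A_t,t}$ is observed. *The TS-EBA experiment* with budget $T$ and split ratio $r\in(0,1)$. Let $m=\lfloor rT/K\rfloor$. In the first $Km$ rounds each arm is allocated $m$ times (arm 1 first, then arm 2, and so on). Let $\widehat\mu_a$ and $\widehat\sigma_a^2$ (normalized by $m-1$) be the sample mean and the empirical variance of arm $a$ in these rounds, $v=\sqrt{K\log T/(rT)}\,\max_b\widehat\sigma_b$, and $\widehat{\mathcal S}=\{a:\widehat\mu_a+v\ge\max_b(\widehat\mu_b-v)\}$. If $|\widehat{\mathcal S}|=1$, its element is recommended. Otherwise put $\widehat w_a=\widehat\sigma_a/\sum_{b\in\widehat{\mathcal S}}\widehat\sigma_b$ if $|\widehat{\mathcal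 S}|=2$ and $\widehat w_a=\widehat\sigma_a^2/\sum_{b\in\widehat{\mathcal S}}\widehat\sigma_b^2$ if $|\widehat{\mathcal S}|\ge3$; in each remaining round the arm is drawn, independently given the data of the first stage, from $\widehat{\mathcal S}$ with probabilities proportional to $\max\{\widehat w_a-r/K,0\}$ (uniformly on $\widehat{\mathcal S}$ if all of these vanish), and after round $T$ the arm with the highest sample mean over all $T$ rounds is recommended. (Ties are broken by the smallest index; quotients $0/0$, and sample means and variances that are undefined for small $m$, are set to $0$.) Let $\widehat a_T$ be the recommended arm and $$\mathrm{Regret}_{\boldsymbol\mu}=\mathbb E_{\boldsymbol\mu}\Big[\max_{a}\mu_a-\mu_{\widehat a_T}\Big].$$ *Prior.* Let $H$ be a probability distribution on $\Theta^K$. For $a\in[K]$ write $\boldsymbol\mu_{\backslash\{a\}}$ for the coordinates other than $a$ and $H^{\backslash\{a\}}$ for their law under $H$. Assume that there are (nonnegative, jointly measurable) conditional densities $h_a(\mu_a\mid\boldsymbol\mu_{\backslash\{a\}})$ of $\mu_a$ given the other coordinates and, for $a\ne b$, $h_{ab}(\mu_a,\mu_b\mid\boldsymbol\mu_{\backslash\{a,b\}})$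 of $(\mu_a,\mu_b)$ given the other coordinates, with respect to Lebesgue measure on $\Theta$ and $\Theta^2$, that are uniformly continuous: for every $\epsilon>0$ there is $\delta>0$ such that $|h_a(x\mid\boldsymbol\nu)-h_a(x'\mid\boldsymbol\nu)|\le\epsilon$ for all $a$, all $\boldsymbol\nu\in\Theta^{K-1}$ and all $x,x'\in\Theta$ with $|x-x'|\le\delta$, and $|h_{ab}(x,y\mid\boldsymbol\nu)-h_{ab}(x',y'\mid\boldsymbol\nu)|\le\epsilon$ for all $a\ne b$, all $\boldsymbol\nu\in\Theta^{K-2}$ and all $x,x',y,y'\in\Theta$ with $|x-x'|,|y-y'|\le\delta$. *Condition on $r$.* Assume that $r\in(0,1)$ and that $\dfrac rK\le\dfrac{\sigma_a(\mu_a)}{\sigma_a(\mu_a)+\sigma_b(\mu_b)}$ for all $a\ne b$ and all $\mu_a,\mu_b\in\Theta$. *Conclusion.* For every $T$ the function $\boldsymbol\mu\mapsto\mathrm{Regret}_{\boldsymbol\mu}$ is $H$-integrable, and $$\limsup_{T\to\infty}\,T\int_{\Theta^K}\mathrm{Regret}_{\boldsymbol\mu}\,dH(\boldsymbol\mu)\;\le\;\frac{4}{1-\frac{(K-2)r}{K}}\sum_{a\in[K]}\int_{\Theta^{K-1}}\sigma^2_{b^*_{\backslash\{a\}}}\big(\mu^*_{\backslash\{a\}}\big)\,h_a\big(\mu^*_{\backslash\{a\}}\,\big|\,\boldsymbol\mu_{\backslash\{a\}}\big)\,dH^{\backslash\{a\}}(\boldsymbol\mu_{\backslash\{a\}}),$$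 where $b^*_{\backslash\{a\}}=\arg\max_{b\ne a}\mu_b$ and $\mu^*_{\backslash\{a\}}=\max_{b\ne a}\mu_b$. -/

import Mathlib

open MeasureTheory ProbabilityTheory Filter Topology
open scoped ENNReal

noncomputable section

namespace TSEBA

/-! ### Argmax -/

theorem exists_argmax {ι : Type*} [Fintype ι] [Nonempty ι] (g : ι → ℝ) :
    (Set.toFinite {i : ι | ∀ j, g j ≤ g i}).toFinset.Nonempty := by
  obtain ⟨i, hi⟩ := Finite.exists_max g
  exact ⟨i, by simpa using hi⟩

/-- An index at which `g` is maximal (the smallest such index if there are several). -/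
def argmax {ι : Type*} [Fintype ι] [LinearOrder ι] [Nonempty ι] (g : ι → ℝ) : ι :=
  (Set.toFinite {i : ι | ∀ j, g j ≤ g i}).toFinset.min' (exists_argmax g)

/-! ### Mean-parametrized families of outcome distributions -/

/-- The log-likelihood `μ ↦ log f(y ∣ μ)`. -/
def logLik (f : ℝ → ℝ → ℝ) (y : ℝ) : ℝ → ℝ := fun μ => Real.log (f y μ)

/-- The `k`-th derivative of the log-likelihood in the parameter, on the parameter interval `Θ`
(one-sided at the endpoints). -/
def logLikDeriv (Θ : Set ℝ) (f : ℝ → ℝ → ℝ) (k : ℕ) (y μ : ℝ) : ℝ :=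
  iteratedDerivWithin k (logLik f y) Θ μ

/-- The Fisher information `E_μ[(∂_μ log f(Y ∣ μ))²]`. -/
def fisherInfo (Θ : Set ℝ) (P : ℝ → Measure ℝ) (f : ℝ → ℝ → ℝ) (μ : ℝ) : ℝ :=
  ∫ y, (logLikDeriv Θ f 1 y μ) ^ 2 ∂(P μ)

/-- `P` is a family of distributions on the outcome space `𝒴`, parametrized by its mean `μ ∈ Θ`,
with variance function `σsq` and likelihood `f(y ∣ μ)` (a probability mass function or a
probability density function), having the regularity required of the outcome distributions. -/
structure IsMeanParamFamilyWith (Θ 𝒴 : Set ℝ) (σsq : ℝ → ℝ) (P : ℝ → Measure ℝ)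
    (f : ℝ → ℝ → ℝ) : Prop where
  isProb : ∀ μ ∈ Θ, IsProbabilityMeasure (P μ)
  measurable_lik : ∀ μ ∈ Θ, Measurable (fun y => f y μ)
  /-- `f(· ∣ μ)` is a mass function (for the counting measure) or a density (for Lebesgue). -/
  hasDensity :
    (∀ μ ∈ Θ, P μ = (Measure.count.restrict 𝒴).withDensity (fun y => ENNReal.ofReal (f y μ))) ∨
    (∀ μ ∈ Θ, P μ = (volume.restrict 𝒴).withDensity (fun y => ENNReal.ofReal (f y μ)))
  lik_pos : ∀ y ∈ 𝒴, ∀ μ ∈ Θ, 0 < f y μ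
  third_moment : ∀ μ ∈ Θ, Integrable (fun y => |y| ^ 3) (P μ)
  mean_eq : ∀ μ ∈ Θ, ∫ y, y ∂(P μ) = μ
  variance_eq : ∀ μ ∈ Θ, variance (fun y => y) (P μ) = σsq μ
  /-- The log-likelihood is three times differentiable in the parameter. -/
  differentiable_logLik : ∀ y ∈ 𝒴, ∀ k < 3,
    DifferentiableOn ℝ (fun μ => logLikDeriv Θ f k y μ) Θ
  integrable_score_sq : ∀ μ ∈ Θ, Integrable (fun y => (logLikDeriv Θ f 1 y μ) ^ 2) (P μ)
  fisherInfo_eq : ∀ μ ∈ Θ, fisherInfo Θ P f μ = 1 / σsq μ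
  score_mean : ∀ μ ∈ Θ, ∫ y, logLikDeriv Θ f 1 y μ ∂(P μ) = 0
  integrable_hessian : ∀ μ ∈ Θ, Integrable (fun y => logLikDeriv Θ f 2 y μ) (P μ)
  hessian_mean : ∀ μ ∈ Θ, ∫ y, logLikDeriv Θ f 2 y μ ∂(P μ) = - fisherInfo Θ P f μ
  hessian_dominated : ∀ μ ∈ Θ, ∃ U ∈ 𝓝 μ, ∃ u : ℝ → ℝ, (∀ y, 0 ≤ u y) ∧
    (∀ τ ∈ U ∩ Θ, ∀ y ∈ 𝒴, |logLikDeriv Θ f 2 y τ| ≤ u y) ∧ Integrable u (P μ)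

/-- Mean-parametrized family with variance function `σsq`, for some likelihood. -/
def IsMeanParamFamily (Θ 𝒴 : Set ℝ) (σsq : ℝ → ℝ) (P : ℝ → Measure ℝ) : Prop :=
  ∃ f : ℝ → ℝ → ℝ, IsMeanParamFamilyWith Θ 𝒴 σsq P f

/-! ### The two-stage experiment

There are `K` arms and `T` rounds, numbered `0, …, T - 1`; `Y t a` is the potential outcome of arm
`a` in round `t`. The allocation in the pilot stage is deterministic; the recommendation and the
second-stage allocation probabilities read `Y t a` only for rounds `t` in which arm `a` is
allocated. -/

section Experiment

variable {K : ℕ}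

/-- Number of pilot rounds per arm: `rT/K`, rounded down when it is not an integer. -/
def pilotSize (K : ℕ) (r : ℝ) (T : ℕ) : ℕ := ⌊r * T / K⌋₊

/-- The pilot rounds of arm `a`: the `a`-th block of `pilotSize` consecutive rounds. -/
def pilotRounds (r : ℝ) (T : ℕ) (a : Fin K) : Finset (Fin T) :=
  Finset.univ.filter fun t =>
    (a : ℕ) * pilotSize K r T ≤ t ∧ (t : ℕ) < ((a : ℕ) + 1) * pilotSize K r T

/-- Mean of the outcomes of arm `a` over the rounds in `s`. -/
def sampleMean {T : ℕ} (Y : Fin T → Fin K → ℝ) (s : Finset (Fin T)) (a : Fin K) : ℝ :=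
  (∑ t ∈ s, Y t a) / s.card

/-- Pilot-stage sample mean of arm `a`. -/
def pilotMean (r : ℝ) {T : ℕ} (Y : Fin T → Fin K → ℝ) (a : Fin K) : ℝ :=
  sampleMean Y (pilotRounds r T a) a

/-- Pilot-stage empirical variance of arm `a`. -/
def pilotVar (r : ℝ) {T : ℕ} (Y : Fin T → Fin K → ℝ) (a : Fin K) : ℝ :=
  (∑ t ∈ pilotRounds r T a, (Y t a - pilotMean r Y a) ^ 2) / ((pilotSize K r T : ℝ) - 1)

/-- Pilot-stage empirical standard deviation of arm `a`. -/
def pilotSd (r : ℝ) {T : ℕ} (Y : Fin T → Fin K → ℝ) (a : Fin K) : ℝ :=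
  Real.sqrt (pilotVar r Y a)

/-- Width of the confidence intervals: `√(K log T / (rT)) · max_b σ̂_b`. -/
def width (r : ℝ) {T : ℕ} (Y : Fin T → Fin K → ℝ) : ℝ :=
  Real.sqrt (K * Real.log T / (r * T)) * ⨆ b, pilotSd r Y b

/-- The arms that survive the pilot stage: the upper confidence bound of the arm is at least
every lower confidence bound. -/
def candidates (r : ℝ) {T : ℕ} (Y : Fin T → Fin K → ℝ) : Finset (Fin K) :=
  Finset.univ.filter fun a =>
    ∀ b, pilotMean r Y b - width r Y ≤ pilotMean r Y a + width r Y

/-- The estimated ideal allocation ratio: proportional to standard deviations for two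
candidates, to variances for three or more. -/
def idealRatio (r : ℝ) {T : ℕ} (Y : Fin T → Fin K → ℝ) (a : Fin K) : ℝ :=
  if (candidates r Y).card = 2 then
    pilotSd r Y a / ∑ b ∈ candidates r Y, pilotSd r Y b
  else
    (pilotSd r Y a) ^ 2 / ∑ b ∈ candidates r Y, (pilotSd r Y b) ^ 2

/-- The unnormalized second-stage weight of arm `a`: the ideal ratio reduced by what the pilot
stage already spent on the arm, `max{ŵ_a - r/K, 0}`, for candidates and `0` for the others. -/
def secondStageWeight (r : ℝ) {T : ℕ} (Y : Fin T → Fin K → ℝ) (a : Fin K) : ℝ :=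
  if a ∈ candidates r Y then max (idealRatio r Y a - r / K) 0 else 0

/-- The second-stage allocation probability of arm `a`. (If all weights vanish, which requires
that all empirical variances of candidates vanish, it is uniform on the candidates.) -/
def secondStageProb (r : ℝ) {T : ℕ} (Y : Fin T → Fin K → ℝ) (a : Fin K) : ℝ :=
  if ∑ b, secondStageWeight r Y b = 0 then
    if a ∈ candidates r Y then 1 / ((candidates r Y).card : ℝ) else 0
  else secondStageWeight r Y a / ∑ b, secondStageWeight r Y b

/-- Probability, given the pilot data, that round `t` is allocated to arm `a`. -/
def allocProb (r : ℝ) {T : ℕ} (Y : Fin T → Fin K → ℝ) (t : Fin T) (a : Fin K) : ℝ :=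
  if (t : ℕ) < K * pilotSize K r T then
    if t ∈ pilotRounds r T a then 1 else 0
  else secondStageProb r Y a

/-- The sample mean of arm `a` over all rounds, under the allocation `A`. -/
def finalMean {T : ℕ} (Y : Fin T → Fin K → ℝ) (A : Fin T → Fin K) (a : Fin K) : ℝ :=
  sampleMean Y (Finset.univ.filter fun t => A t = a) a

/-- The recommended arm: the only candidate if there is just one, and otherwise the arm with the
highest sample mean at the end of the experiment. -/
def recommend [Nonempty (Fin K)] (r : ℝ) {T : ℕ} (Y : Fin T → Fin K → ℝ)
    (A : Fin T → Fin K) : Fin K :=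
  if (candidates r Y).card = 1 then argmax (pilotMean r Y) else argmax (finalMean Y A)

/-- The expected simple regret `E[μ_{a*} - μ_{â_T}]` with budget `T` when the outcome vectors of
the rounds are independent with law `Q`. The outer integral averages over the outcomes, the sum
over the allocations `A`, whose entries are independent given the pilot data. -/
def regret [Nonempty (Fin K)] (r : ℝ) (T : ℕ) (Q : Measure (Fin K → ℝ)) (μ : Fin K → ℝ) : ℝ :=
  ∫ Y : Fin T → Fin K → ℝ,
    ∑ A : Fin T → Fin K,
      (∏ t, allocProb r Y t (A t)) * (μ (argmax μ) - μ (recommend r Y A))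
    ∂(Measure.pi fun _ : Fin T => Q)

end Experiment

/-! ### Priors -/

/-- The coordinates `μ_{\{a}}` of `μ` other than `a`. -/
def drop {K : ℕ} (a : Fin K) (μ : Fin K → ℝ) : {b : Fin K // b ≠ a} → ℝ := fun b => μ b

/-- The coordinates `μ_{\{a,b}}` of `μ` other than `a` and `b`. -/
def drop₂ {K : ℕ} (a b : Fin K) (μ : Fin K → ℝ) : {c : Fin K // c ≠ a ∧ c ≠ b} → ℝ :=
  fun c => μ c

/-- The marginal `H^{\{a}}` of `H` on the coordinates other than `a`. -/
def marginal {K : ℕ} (H : Measure (Fin K → ℝ)) (a : Fin K) :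
    Measure ({b : Fin K // b ≠ a} → ℝ) := H.map (drop a)

/-- The marginal of `H` on the coordinates other than `a` and `b`. -/
def marginal₂ {K : ℕ} (H : Measure (Fin K → ℝ)) (a b : Fin K) :
    Measure ({c : Fin K // c ≠ a ∧ c ≠ b} → ℝ) := H.map (drop₂ a b)

/-- `h a x ν` is a conditional density on `Θ` of coordinate `a` at `x` given that the others are
`ν`, and is uniformly continuous in `x`, uniformly in `ν`. -/
structure HasUnifContCondDensity {K : ℕ} (Θ : Set ℝ) (H : Measure (Fin K → ℝ))
    (h : (a : Fin K) → ℝ → ({b : Fin K // b ≠ a} → ℝ) → ℝ) : Prop where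
  measurable : ∀ a, Measurable fun p : ({b : Fin K // b ≠ a} → ℝ) × ℝ => h a p.2 p.1
  nonneg : ∀ a, ∀ x ∈ Θ, ∀ ν, (∀ c, ν c ∈ Θ) → 0 ≤ h a x ν
  density : ∀ a, H.map (fun μ => (drop a μ, μ a)) =
    ((marginal H a).prod (volume.restrict Θ)).withDensity fun p => ENNReal.ofReal (h a p.2 p.1)
  unifCont : ∀ ε > 0, ∃ δ > 0, ∀ a, ∀ x ∈ Θ, ∀ x' ∈ Θ, |x - x'| ≤ δ →
    ∀ ν, (∀ c, ν c ∈ Θ) → |h a x ν - h a x' ν| ≤ ε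

/-- `h₂ a b x y ν` is a conditional density on `Θ²` of the coordinates `a ≠ b` at `(x, y)` given
that the others are `ν`, and is uniformly continuous in `(x, y)`, uniformly in `ν`. -/
structure HasUnifContCondDensity₂ {K : ℕ} (Θ : Set ℝ) (H : Measure (Fin K → ℝ))
    (h₂ : (a b : Fin K) → ℝ → ℝ → ({c : Fin K // c ≠ a ∧ c ≠ b} → ℝ) → ℝ) : Prop where
  measurable : ∀ a b, a ≠ b → Measurable
    fun p : ({c : Fin K // c ≠ a ∧ c ≠ b} → ℝ) × (ℝ × ℝ) => h₂ a b p.2.1 p.2.2 p.1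
  nonneg : ∀ a b, a ≠ b → ∀ x ∈ Θ, ∀ y ∈ Θ, ∀ ν, (∀ c, ν c ∈ Θ) → 0 ≤ h₂ a b x y ν
  density : ∀ a b, a ≠ b → H.map (fun μ => (drop₂ a b μ, (μ a, μ b))) =
    ((marginal₂ H a b).prod ((volume.restrict Θ).prod (volume.restrict Θ))).withDensity
      fun p => ENNReal.ofReal (h₂ a b p.2.1 p.2.2 p.1)
  unifCont : ∀ ε > 0, ∃ δ > 0, ∀ a b, a ≠ b → ∀ x ∈ Θ, ∀ x' ∈ Θ, ∀ y ∈ Θ, ∀ y' ∈ Θ,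
    |x - x'| ≤ δ → |y - y'| ≤ δ →
    ∀ ν, (∀ c, ν c ∈ Θ) → |h₂ a b x y ν - h₂ a b x' y' ν| ≤ ε

theorem nonempty_others {K : ℕ} (hK : 2 ≤ K) (a : Fin K) : Nonempty {b : Fin K // b ≠ a} := by
  have : Nontrivial (Fin K) := Fin.nontrivial_iff_two_le.2 hK
  obtain ⟨b, hb⟩ := exists_ne a
  exact ⟨⟨b, hb⟩⟩

/-- The functional `∑_a ∫ σ²_{b*}(μ*) h_a(μ* ∣ μ_{\{a}}) dH^{\{a}}(μ_{\{a}})`, where `b*` is the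
best arm other than `a` and `μ* = μ_{b*}`. -/
def bayesFunctional {K : ℕ} (hK : 2 ≤ K) (σsq : Fin K → ℝ → ℝ) (H : Measure (Fin K → ℝ))
    (h : (a : Fin K) → ℝ → ({b : Fin K // b ≠ a} → ℝ) → ℝ) : ℝ :=
  ∑ a : Fin K,
    haveI := nonempty_others hK a
    ∫ ν, σsq (argmax ν).1 (ν (argmax ν)) * h a (ν (argmax ν)) ν ∂(marginal H a)

end TSEBA

end

/-!
The regret of the experiment is of order `1 / T` on average because only parameters for which the
two best arms are within `O(T ^ (-1 / 2))` of each other contribute. The proof bounds the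
probability of a wrong recommendation near such a tie by a Gaussian tail and integrates it against
the density of ties under the prior.

*Outcomes.* The hypothesis that the Fisher information equals the inverse variance says that the
Cramér–Rao inequality is an equality at every parameter. Hence the score is affine in the
observation and each family of outcome distributions is an exponential family
(`loglik_eq_integral_of_information_eq`, `eq_withDensity_exp`), whose moment generating functions
are Gaussian up to a factor close to one in the variance (`IsMeanParamFamilyWith.hasGaussianMGF`).
The rest of the proof uses this bound only.

*Near ties.* Let `a` be slightly worse than the best arm `b`, and let all other arms be clearly
worse. In a typical run (`IsTypical`) in which `a` is recommended, exactly these two arms survive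
the pilot stage, and the fractions `F a` and `F b` of the budget that they receive are close to
deterministic ones, which lie between those of the uniform and those of the ideal allocation.
Therefore `σ² a / F a + σ² b / F b ≤ 2 (σ² a + σ² b) / (1 - (K - 2) r / K)`
(`variance_div_fraction_le`). The numbers of observations are random, but the exponential of a
linear combination of the observed centred outcomes, normalized round by round, has expectation at
most one whatever the allocation rule (`experimentLaw_exp_le`). This gives a Gaussian tail whose
variance proxy is the right-hand side (`experimentLaw_typical_le`), while atypical runs are rare
(`experimentLaw_not_typical_le`); the two are combined in `eventually_recommend_le`.

*Averaging.* The error terms live on the scale `x = T ^ (1 / 64)`. Larger gaps, ties of three arms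
and parameters close to the endpoints are negligible because the conditional densities are bounded
(`tendsto_errorTerm`). In the main term, the integral over the gap of the gap times the Gaussian
tail is the variance proxy divided by `T`, and uniform continuity replaces the conditional density
by its value at the tie (`eventually_lintegral_recommend_le`).

*Symmetrization.* This leaves an integral over ties of `2 (σ² a + σ² b) / (1 - (K - 2) r / K)`,
where `b` is the best arm other than `a`. After summation over `a` the term with `σ² a` is at most
the one with `σ² b` (`sum_lintegral_le`): both compare with the probability of a near tie of the
two best arms, weighted with the variance of the best one, approached from above and from below.
This gives the constant `4`.
-/

namespace TSEBA

/-! ### Families attaining the information bound -/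

/-- Let `exp (L · s)`, for `s` in a compact interval, be probability densities with respect to
`p`, with mean `s` and variance `v s`. If the Fisher information is `1 / v s`, then the
Cramér–Rao inequality is an equality and the score is the affine function `(y - s) / v s`.
The covariance of `Y` and the score is at most `1` at every `s` (a variance is nonnegative), while
its integral over the interval is the length of the interval (the mean is `s`). -/
theorem loglik_eq_integral_of_information_eq {θ₁ θ₂ : ℝ} (hθ : θ₁ < θ₂) {𝒴 : Set ℝ}
    {p : Measure ℝ} [IsProbabilityMeasure p] (hp𝒴 : ∀ᵐ y ∂p, y ∈ 𝒴) {v : ℝ → ℝ}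
    (hv_cont : ContinuousOn v (Set.Icc θ₁ θ₂)) (hv_pos : ∀ s ∈ Set.Icc θ₁ θ₂, 0 < v s)
    {L L' : ℝ → ℝ → ℝ} (hLm : Measurable (Function.uncurry L))
    (hL'm : Measurable (Function.uncurry L'))
    (hL : ∀ y ∈ 𝒴, ∀ s ∈ Set.Ico θ₁ θ₂, HasDerivWithinAt (L y) (L' y s) (Set.Ioi s) s)
    (hLc : ∀ y ∈ 𝒴, ContinuousOn (L y) (Set.Icc θ₁ θ₂))
    (hL'i : ∀ y ∈ 𝒴, IntegrableOn (L' y) (Set.Icc θ₁ θ₂))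
    (hL1 : ∀ y ∈ 𝒴, L y θ₁ = 0)
    (h0i : ∀ s ∈ Set.Icc θ₁ θ₂, Integrable (fun y => Real.exp (L y s)) p)
    (h2i : ∀ s ∈ Set.Icc θ₁ θ₂, Integrable (fun y => y ^ 2 * Real.exp (L y s)) p)
    (hSi : ∀ s ∈ Set.Ico θ₁ θ₂, Integrable (fun y => L' y s ^ 2 * Real.exp (L y s)) p)
    (h0 : ∀ s ∈ Set.Icc θ₁ θ₂, ∫ y, Real.exp (L y s) ∂p = 1)
    (h1 : ∀ s ∈ Set.Icc θ₁ θ₂, ∫ y, y * Real.exp (L y s) ∂p = s)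
    (h2 : ∀ s ∈ Set.Icc θ₁ θ₂, ∫ y, (y - s) ^ 2 * Real.exp (L y s) ∂p = v s)
    (hS : ∀ s ∈ Set.Ico θ₁ θ₂, ∫ y, L' y s * Real.exp (L y s) ∂p = 0)
    (hF : ∀ s ∈ Set.Ico θ₁ θ₂, ∫ y, L' y s ^ 2 * Real.exp (L y s) ∂p = 1 / v s) :
    ∀ᵐ y ∂p, ∀ τ ∈ Set.Icc θ₁ θ₂, L y τ = ∫ s in θ₁..τ, (y - s) / v s := by
  have hIco : Set.Ico θ₁ θ₂ ⊆ Set.Icc θ₁ θ₂ := Set.Ico_subset_Icc_self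
  have mL : ∀ s, Measurable fun y => L y s := fun s =>
    hLm.comp (measurable_id.prodMk measurable_const)
  have mL' : ∀ s, Measurable fun y => L' y s := fun s =>
    hL'm.comp (measurable_id.prodMk measurable_const)
  -- integrability of the mixed products
  have hyS : ∀ s ∈ Set.Ico θ₁ θ₂, Integrable (fun y => y * L' y s * Real.exp (L y s)) p := by
    intro s hs
    refine ((h2i s (hIco hs)).add (hSi s hs)).mono' ?_ (ae_of_all _ fun y => ?_)
    · exact ((measurable_id.mul (mL' s)).mul (mL s).exp).aestronglyMeasurable
    · simp only [Real.norm_eq_abs, abs_mul, Real.abs_exp, Pi.add_apply]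
      rw [← add_mul]
      refine mul_le_mul_of_nonneg_right ?_ (Real.exp_pos _).le
      nlinarith [sq_nonneg (|y| - |L' y s|), sq_abs y, sq_abs (L' y s), sq_nonneg y,
        sq_nonneg (L' y s)]
  have hSi1 : ∀ s ∈ Set.Ico θ₁ θ₂, Integrable (fun y => L' y s * Real.exp (L y s)) p := by
    intro s hs
    refine ((h0i s (hIco hs)).add (hSi s hs)).mono' ?_ (ae_of_all _ fun y => ?_)
    · exact ((mL' s).mul (mL s).exp).aestronglyMeasurable
    · simp only [Real.norm_eq_abs, abs_mul, Real.abs_exp, Pi.add_apply]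
      rw [← one_add_mul]
      refine mul_le_mul_of_nonneg_right ?_ (Real.exp_pos _).le
      nlinarith [sq_nonneg (1 - |L' y s|), sq_abs (L' y s), sq_nonneg (L' y s)]
  have hyi : ∀ s ∈ Set.Icc θ₁ θ₂, Integrable (fun y => y * Real.exp (L y s)) p := by
    intro s hs
    refine ((h0i s hs).add (h2i s hs)).mono' ?_ (ae_of_all _ fun y => ?_)
    · exact (measurable_id.mul (mL s).exp).aestronglyMeasurable
    · simp only [Real.norm_eq_abs, abs_mul, Real.abs_exp, Pi.add_apply]
      rw [← one_add_mul]
      refine mul_le_mul_of_nonneg_right ?_ (Real.exp_pos _).le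
      nlinarith [sq_nonneg (1 - |y|), sq_abs y, sq_nonneg y]
  have hvi : ∀ s ∈ Set.Icc θ₁ θ₂, Integrable (fun y => (y - s) ^ 2 * Real.exp (L y s)) p := by
    intro s hs
    have := ((h2i s hs).sub ((hyi s hs).const_mul (2 * s))).add ((h0i s hs).const_mul (s ^ 2))
    refine this.congr (ae_of_all _ fun y => ?_)
    simp only [Pi.add_apply, Pi.sub_apply]; ring
  have hy2 : ∀ s ∈ Set.Icc θ₁ θ₂, ∫ y, y ^ 2 * Real.exp (L y s) ∂p = v s + s ^ 2 := by
    intro s hs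
    have e : ∀ y, y ^ 2 * Real.exp (L y s) = (y - s) ^ 2 * Real.exp (L y s)
        + (2 * s * (y * Real.exp (L y s)) - s ^ 2 * Real.exp (L y s)) := fun y => by ring
    simp_rw [e]
    have i1 : Integrable (fun y => 2 * s * (y * Real.exp (L y s)) - s ^ 2 * Real.exp (L y s)) p :=
      ((hyi s hs).const_mul _).sub ((h0i s hs).const_mul _)
    rw [integral_add (hvi s hs) i1,
      integral_sub ((hyi s hs).const_mul _) ((h0i s hs).const_mul _), integral_const_mul,
      integral_const_mul, h0 s hs, h1 s hs, h2 s hs]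
    ring
  -- the covariance of the observation and the score
  set c : ℝ → ℝ := fun s => ∫ y, y * L' y s * Real.exp (L y s) ∂p with hc
  have hDi : ∀ s ∈ Set.Ico θ₁ θ₂,
      Integrable (fun y => (L' y s - (y - s) / v s) ^ 2 * Real.exp (L y s)) p ∧
      ∫ y, (L' y s - (y - s) / v s) ^ 2 * Real.exp (L y s) ∂p = 2 * (1 - c s) / v s := by
    intro s hs
    have hvs := (hv_pos s (hIco hs)).ne'
    have e : ∀ y, (L' y s - (y - s) / v s) ^ 2 * Real.exp (L y s) =
        (L' y s ^ 2 * Real.exp (L y s) - 2 / v s * (y * L' y s * Real.exp (L y s)))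
        + (2 * s / v s * (L' y s * Real.exp (L y s))
          + 1 / v s ^ 2 * ((y - s) ^ 2 * Real.exp (L y s))) := fun y => by
      field_simp; ring
    simp_rw [e]
    have i1 : Integrable (fun y => L' y s ^ 2 * Real.exp (L y s)
        - 2 / v s * (y * L' y s * Real.exp (L y s))) p :=
      (hSi s hs).sub ((hyS s hs).const_mul (2 / v s))
    have i2 : Integrable (fun y => 2 * s / v s * (L' y s * Real.exp (L y s))
        + 1 / v s ^ 2 * ((y - s) ^ 2 * Real.exp (L y s))) p :=
      ((hSi1 s hs).const_mul (2 * s / v s)).add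
      ((hvi s (hIco hs)).const_mul (1 / v s ^ 2))
    refine ⟨i1.add i2, ?_⟩
    rw [integral_add i1 i2, integral_sub (hSi s hs) ((hyS s hs).const_mul _),
      integral_add ((hSi1 s hs).const_mul _) ((hvi s (hIco hs)).const_mul _)]
    simp only [integral_const_mul]
    rw [hF s hs, hS s hs, h2 s (hIco hs)]
    field_simp
    ring
  have hc1 : ∀ s ∈ Set.Ico θ₁ θ₂, 0 ≤ 1 - c s := by
    intro s hs
    have h := (hDi s hs).2
    have hn : 0 ≤ ∫ y, (L' y s - (y - s) / v s) ^ 2 * Real.exp (L y s) ∂p :=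
      integral_nonneg fun y => by positivity
    rw [h] at hn
    have := (div_nonneg_iff.1 hn)
    have hvs := hv_pos s (hIco hs)
    rcases this with h | h
    · linarith [h.1]
    · linarith [h.2]
  -- a bound for the absolute moments, uniform on the interval
  obtain ⟨S, hSb⟩ := isCompact_Icc.exists_bound_of_continuousOn
    (f := fun s => v s + s ^ 2 + 1 / v s) (s := Set.Icc θ₁ θ₂)
    ((hv_cont.add (by fun_prop)).add (continuousOn_const.div hv_cont fun s hs => (hv_pos s hs).ne'))
  have hae : ∀ᵐ s ∂(volume.restrict (Set.Icc θ₁ θ₂)), s ∈ Set.Ico θ₁ θ₂ := by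
    rw [← restrict_Ico_eq_restrict_Icc]
    exact ae_restrict_mem measurableSet_Ico
  have hmF : Measurable fun q : ℝ × ℝ => q.1 * L' q.1 q.2 * Real.exp (L q.1 q.2) :=
    (measurable_fst.mul hL'm).mul hLm.exp
  have hprod : Integrable (fun q : ℝ × ℝ => q.1 * L' q.1 q.2 * Real.exp (L q.1 q.2))
      (p.prod (volume.restrict (Set.Icc θ₁ θ₂))) := by
    rw [integrable_prod_iff' hmF.aestronglyMeasurable]
    refine ⟨hae.mono fun s hs => hyS s hs, ?_⟩
    refine Integrable.mono' (g := fun _ => S) (integrable_const _) ?_ ?_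
    · exact hmF.stronglyMeasurable.norm.integral_prod_left'.aestronglyMeasurable
    · filter_upwards [hae] with s hs
      rw [Real.norm_of_nonneg (integral_nonneg fun y => norm_nonneg _)]
      calc ∫ y, ‖y * L' y s * Real.exp (L y s)‖ ∂p
          ≤ ∫ y, (y ^ 2 * Real.exp (L y s) + L' y s ^ 2 * Real.exp (L y s)) ∂p := by
            refine integral_mono (hyS s hs).norm ((h2i s (hIco hs)).add (hSi s hs)) fun y => ?_
            simp only [Real.norm_eq_abs, abs_mul, Real.abs_exp]
            rw [← add_mul]
            refine mul_le_mul_of_nonneg_right ?_ (Real.exp_pos _).le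
            nlinarith [sq_nonneg (|y| - |L' y s|), sq_abs y, sq_abs (L' y s), sq_nonneg y,
              sq_nonneg (L' y s)]
        _ = v s + s ^ 2 + 1 / v s := by
            rw [integral_add (h2i s (hIco hs)) (hSi s hs), hy2 s (hIco hs), hF s hs]
        _ ≤ S := (le_abs_self _).trans (hSb s (hIco hs))
  -- the integral of the covariance, by Fubini and the fundamental theorem of calculus
  have hint : ∫ s in Set.Icc θ₁ θ₂, c s = θ₂ - θ₁ := by
    have hsw := integral_integral_swap (f := fun y s => y * L' y s * Real.exp (L y s)) hprod
    rw [← hsw]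
    have hin : ∀ᵐ y ∂p, ∫ s in Set.Icc θ₁ θ₂, y * L' y s * Real.exp (L y s)
        = y * Real.exp (L y θ₂) - y * Real.exp (L y θ₁) := by
      filter_upwards [hp𝒴] with y hy
      have hcE : ContinuousOn (fun s => Real.exp (L y s)) (Set.Icc θ₁ θ₂) := (hLc y hy).rexp
      have hii : IntegrableOn (fun s => L' y s * Real.exp (L y s)) (Set.Icc θ₁ θ₂) :=
        (hL'i y hy).mul_continuousOn hcE isCompact_Icc
      have hft := intervalIntegral.integral_eq_sub_of_hasDeriv_right_of_le hθ.le hcE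
        (f' := fun s => L' y s * Real.exp (L y s)) (fun s hs => by
          have := (hL y hy s ⟨hs.1.le, hs.2⟩).exp
          rwa [mul_comm] at this)
        ((intervalIntegrable_iff_integrableOn_Icc_of_le hθ.le).2 hii)
      simp_rw [mul_assoc]
      rw [integral_const_mul, ← mul_sub, ← hft, intervalIntegral.integral_of_le hθ.le,
        integral_Icc_eq_integral_Ioc]
    have h1' := Set.left_mem_Icc.2 hθ.le
    have h2' := Set.right_mem_Icc.2 hθ.le
    rw [integral_congr_ae hin, integral_sub (hyi _ h2') (hyi _ h1'), h1 _ h1', h1 _ h2']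
  have hci : Integrable c (volume.restrict (Set.Icc θ₁ θ₂)) := hprod.integral_prod_right
  have hcone : ∀ᵐ s ∂(volume.restrict (Set.Icc θ₁ θ₂)), 1 - c s = 0 := by
    refine (integral_eq_zero_iff_of_nonneg_ae (hae.mono fun s hs => hc1 s hs)
      ((integrable_const _).sub hci)).1 ?_
    rw [integral_sub (integrable_const _) hci, hint]
    simp [hθ.le]
  -- hence the score is affine in the observation, almost everywhere
  have hmv : Measurable fun s => if s ∈ Set.Icc θ₁ θ₂ then v s else 0 := by
    have hm := (hv_cont.measurable_piecewise (g := fun _ => (0 : ℝ)) (s := Set.Icc θ₁ θ₂)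
      continuousOn_const measurableSet_Icc)
    exact hm
  have hscore : ∀ᵐ s ∂(volume.restrict (Set.Icc θ₁ θ₂)), ∀ᵐ y ∂p,
      L' y s = (y - s) / (if s ∈ Set.Icc θ₁ θ₂ then v s else 0) := by
    filter_upwards [hcone, hae] with s hs1 hs
    rw [if_pos (hIco hs)]
    obtain ⟨hi, he⟩ := hDi s hs
    rw [hs1] at he
    have hz := (integral_eq_zero_iff_of_nonneg (fun y => by positivity) hi).1 (by rw [he]; simp)
    filter_upwards [hz] with y hy
    have hy' : (L' y s - (y - s) / v s) ^ 2 = 0 := by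
      rcases mul_eq_zero.1 hy with h | h
      · exact h
      · exact absurd h (Real.exp_ne_zero _)
    linarith [pow_eq_zero_iff (two_ne_zero) |>.1 hy']
  rw [← Measure.ae_ae_comm] at hscore
  swap
  · exact measurableSet_eq_fun hL'm
      ((measurable_fst.sub measurable_snd).div (hmv.comp measurable_snd))
  filter_upwards [hscore, hp𝒴] with y hy hy𝒴 τ hτ
  have hsub : Set.Icc θ₁ τ ⊆ Set.Icc θ₁ θ₂ := Set.Icc_subset_Icc_right hτ.2
  have hft := intervalIntegral.integral_eq_sub_of_hasDeriv_right_of_le hτ.1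
    ((hLc y hy𝒴).mono hsub) (f' := L' y)
    (fun s hs => hL y hy𝒴 s ⟨hs.1.le, hs.2.trans_le hτ.2⟩)
    ((intervalIntegrable_iff_integrableOn_Icc_of_le hτ.1).2 ((hL'i y hy𝒴).mono_set hsub))
  rw [hL1 y hy𝒴, sub_zero] at hft
  rw [← hft, intervalIntegral.integral_of_le hτ.1, intervalIntegral.integral_of_le hτ.1]
  refine setIntegral_congr_ae measurableSet_Ioc ?_
  rw [ae_restrict_iff' measurableSet_Icc] at hy
  filter_upwards [hy] with s hs hs'
  have hsΘ : s ∈ Set.Icc θ₁ θ₂ := ⟨hs'.1.le, hs'.2.trans hτ.2⟩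
  rw [hs hsΘ, if_pos hsΘ]

namespace IsMeanParamFamilyWith

variable {θ₁ θ₂ : ℝ} {𝒴 : Set ℝ} {v : ℝ → ℝ} {P : ℝ → Measure ℝ} {f : ℝ → ℝ → ℝ}

theorem ae_mem (hf : IsMeanParamFamilyWith (Set.Icc θ₁ θ₂) 𝒴 v P f) (h𝒴 : MeasurableSet 𝒴)
    {s : ℝ} (hs : s ∈ Set.Icc θ₁ θ₂) : ∀ᵐ y ∂(P s), y ∈ 𝒴 := by
  rcases hf.hasDensity with h | h <;>
  · rw [h s hs]
    exact (withDensity_absolutelyContinuous _ _).ae_le (ae_restrict_mem h𝒴)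

/-- Members of the family are mutually absolutely continuous because the likelihood is positive on
`𝒴`; this holds for both kinds of reference measure. -/
theorem eq_withDensity_likelihoodRatio
    (hf : IsMeanParamFamilyWith (Set.Icc θ₁ θ₂) 𝒴 v P f) (h𝒴 : MeasurableSet 𝒴)
    {s τ : ℝ} (hs : s ∈ Set.Icc θ₁ θ₂) (hτ : τ ∈ Set.Icc θ₁ θ₂) :
    P τ = (P s).withDensity fun y => ENNReal.ofReal (f y τ / f y s) := by
  have m1 := (hf.measurable_lik s hs)
  have m2 := (hf.measurable_lik τ hτ)
  rcases hf.hasDensity with h | h <;>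
  · rw [h s hs, h τ hτ, ← withDensity_mul (g := fun y => ENNReal.ofReal (f y τ / f y s)) _
      m1.ennreal_ofReal (m2.div m1).ennreal_ofReal]
    refine withDensity_congr_ae ?_
    filter_upwards [ae_restrict_mem h𝒴] with y hy
    have hpos := hf.lik_pos y hy s hs
    rw [Pi.mul_apply, ← ENNReal.ofReal_mul hpos.le, mul_div_cancel₀ _ hpos.ne']

/-- A mean-parametrized family whose Fisher information is the inverse variance is an exponential
family. -/
theorem eq_withDensity_exp (hf : IsMeanParamFamilyWith (Set.Icc θ₁ θ₂) 𝒴 v P f)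
    (h𝒴 : MeasurableSet 𝒴) (hθ : θ₁ < θ₂)
    (hv_cont : ContinuousOn v (Set.Icc θ₁ θ₂)) (hv_pos : ∀ s ∈ Set.Icc θ₁ θ₂, 0 < v s)
    {τ : ℝ} (hτ : τ ∈ Set.Icc θ₁ θ₂) :
    P τ = (P θ₁).withDensity fun y =>
      ENNReal.ofReal (Real.exp (∫ s in θ₁..τ, (y - s) / v s)) := by
  classical
  have h1Θ : θ₁ ∈ Set.Icc θ₁ θ₂ := Set.left_mem_Icc.2 hθ.le
  have hIco : Set.Ico θ₁ θ₂ ⊆ Set.Icc θ₁ θ₂ := Set.Ico_subset_Icc_self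
  have := hf.isProb θ₁ h1Θ
  set cl : ℝ → ℝ := fun s => max θ₁ (min θ₂ s) with hcl
  have hclc : Continuous cl := by fun_prop
  have hclm : ∀ s, cl s ∈ Set.Icc θ₁ θ₂ := fun s =>
    ⟨le_max_left _ _, max_le hθ.le (min_le_left _ _)⟩
  have hcls : ∀ s ∈ Set.Icc θ₁ θ₂, cl s = s := fun s hs => by
    simp [hcl, hs.1, hs.2]
  set L : ℝ → ℝ → ℝ := fun y s =>
    if y ∈ 𝒴 then Real.log (f y (cl s)) - Real.log (f y θ₁) else 0 with hLdef
  set L' : ℝ → ℝ → ℝ := fun y s =>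
    if y ∈ 𝒴 ∧ s ∈ Set.Ico θ₁ θ₂ then logLikDeriv (Set.Icc θ₁ θ₂) f 1 y s else 0 with hL'def
  have hd0 : ∀ y ∈ 𝒴, DifferentiableOn ℝ (logLik f y) (Set.Icc θ₁ θ₂) := fun y hy => by
    have := hf.differentiable_logLik y hy 0 (by norm_num)
    simpa [logLikDeriv] using this
  have hd1 : ∀ y ∈ 𝒴, ContinuousOn (fun s => logLikDeriv (Set.Icc θ₁ θ₂) f 1 y s)
      (Set.Icc θ₁ θ₂) := fun y hy =>
    (hf.differentiable_logLik y hy 1 (by norm_num)).continuousOn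
  have hderiv : ∀ y ∈ 𝒴, ∀ s ∈ Set.Icc θ₁ θ₂, HasDerivWithinAt (logLik f y)
      (logLikDeriv (Set.Icc θ₁ θ₂) f 1 y s) (Set.Icc θ₁ θ₂) s := fun y hy s hs => by
    have := (hd0 y hy s hs).hasDerivWithinAt
    rwa [logLikDeriv, iteratedDerivWithin_one]
  have hLcont : ∀ y, Continuous (L y) := fun y => by
    by_cases hy : y ∈ 𝒴
    · have : Continuous fun s => logLik f y (cl s) :=
        (hd0 y hy).continuousOn.comp_continuous hclc hclm
      simp only [hLdef, if_pos hy]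
      exact this.sub continuous_const
    · simp only [hLdef, if_neg hy]; exact continuous_const
  have hLy : ∀ s, Measurable fun y => L y s := fun s =>
    Measurable.ite h𝒴 ((hf.measurable_lik _ (hclm s)).log.sub (hf.measurable_lik _ h1Θ).log)
      measurable_const
  have hLm : Measurable (Function.uncurry L) :=
    (measurable_uncurry_of_continuous_of_measurable (u := fun s y => L y s)
      (fun y => hLcont y) hLy).comp measurable_swap
  have hLeq : ∀ y ∈ 𝒴, ∀ s ∈ Set.Icc θ₁ θ₂, L y s = logLik f y s - logLik f y θ₁ :=
    fun y hy s hs => by simp only [hLdef, if_pos hy, hcls s hs, logLik]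
  have hL : ∀ y ∈ 𝒴, ∀ s ∈ Set.Ico θ₁ θ₂, HasDerivWithinAt (L y) (L' y s) (Set.Ioi s) s := by
    intro y hy s hs
    have h := (hderiv y hy s (hIco hs)).sub_const (logLik f y θ₁)
    have h' : HasDerivWithinAt (L y) (logLikDeriv (Set.Icc θ₁ θ₂) f 1 y s)
        (Set.Icc θ₁ θ₂) s :=
      h.congr (fun t ht => hLeq y hy t ht) (hLeq y hy s (hIco hs))
    simp only [hL'def, if_pos (And.intro hy hs)]
    refine (h'.mono_of_mem_nhdsWithin ?_)
    refine mem_of_superset (Ioo_mem_nhdsGT hs.2) fun t ht => ⟨hs.1.trans ht.1.le, ht.2.le⟩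
  -- the score is a limit of difference quotients, hence jointly measurable
  have hL'm : Measurable (Function.uncurry L') := by
    set u : ℕ → ℝ := fun n => 1 / ((n : ℝ) + 1) with hu
    have hu0 : ∀ n, 0 < u n := fun n => by positivity
    have hut : Tendsto u atTop (𝓝[>] 0) :=
      tendsto_nhdsWithin_iff.2 ⟨tendsto_one_div_add_atTop_nhds_zero_nat,
        Eventually.of_forall fun n => hu0 n⟩
    refine measurable_of_tendsto_metrizable (f := fun n (q : ℝ × ℝ) =>
      if q.2 ∈ Set.Ico θ₁ θ₂ then (u n)⁻¹ * (L q.1 (q.2 + u n) - L q.1 q.2) else 0) ?_ ?_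
    · intro n
      refine Measurable.ite (measurable_snd measurableSet_Ico) ?_ measurable_const
      exact measurable_const.mul ((hLm.comp
        (measurable_fst.prodMk (measurable_snd.add_const _))).sub
        (hLm.comp (measurable_fst.prodMk measurable_snd)))
    · rw [tendsto_pi_nhds]
      rintro ⟨y, s⟩
      by_cases hs : s ∈ Set.Ico θ₁ θ₂
      · by_cases hy : y ∈ 𝒴
        · have := (hL y hy s hs)
          rw [hasDerivWithinAt_iff_tendsto_slope' (by simp)] at this
          have h2 : Tendsto (fun n => s + u n) atTop (𝓝[>] s) := by
            refine tendsto_nhdsWithin_iff.2 ⟨?_, Eventually.of_forall fun n => by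
              have := hu0 n; simp only [Set.mem_Ioi]; linarith⟩
            simpa using tendsto_const_nhds.add (tendsto_nhdsWithin_iff.1 hut).1
          have h3 := this.comp h2
          refine h3.congr fun n => ?_
          simp [slope_def_field, hs.1, hs.2, div_eq_inv_mul]
        · simp only [hs, hLdef, hL'def, Function.uncurry, hy]
          simp
      · simp only [hs, hL'def, Function.uncurry]
        simp
  have hratio : ∀ y ∈ 𝒴, ∀ s ∈ Set.Icc θ₁ θ₂, f y s / f y θ₁ = Real.exp (L y s) := by
    intro y hy s hs
    rw [hLeq y hy s hs, Real.exp_sub, logLik, logLik, Real.exp_log (hf.lik_pos y hy s hs),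
      Real.exp_log (hf.lik_pos y hy θ₁ h1Θ)]
  have hPL : ∀ s ∈ Set.Icc θ₁ θ₂,
      P s = (P θ₁).withDensity fun y => ENNReal.ofReal (Real.exp (L y s)) := by
    intro s hs
    rw [hf.eq_withDensity_likelihoodRatio h𝒴 h1Θ hs]
    refine withDensity_congr_ae ?_
    filter_upwards [hf.ae_mem h𝒴 h1Θ] with y hy
    rw [hratio y hy s hs]
  have tI : ∀ s ∈ Set.Icc θ₁ θ₂, ∀ g : ℝ → ℝ, Integrable g (P s) →
      Integrable (fun y => g y * Real.exp (L y s)) (P θ₁) := by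
    intro s hs g hg
    rw [hPL s hs, integrable_withDensity_iff (hLy s).exp.ennreal_ofReal (by simp)] at hg
    simpa [ENNReal.toReal_ofReal (Real.exp_pos _).le] using hg
  have tE : ∀ s ∈ Set.Icc θ₁ θ₂, ∀ g : ℝ → ℝ,
      ∫ y, g y * Real.exp (L y s) ∂(P θ₁) = ∫ y, g y ∂(P s) := by
    intro s hs g
    rw [hPL s hs, integral_withDensity_eq_integral_toReal_smul (hLy s).exp.ennreal_ofReal
      (by simp)]
    simp [ENNReal.toReal_ofReal (Real.exp_pos _).le, mul_comm]
  have hsc : ∀ s ∈ Set.Ico θ₁ θ₂,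
      (fun y => L' y s) =ᵐ[P s] fun y => logLikDeriv (Set.Icc θ₁ θ₂) f 1 y s := by
    intro s hs
    filter_upwards [hf.ae_mem h𝒴 (hIco hs)] with y hy
    simp only [hL'def, if_pos (And.intro hy hs)]
  have hsq : ∀ s ∈ Set.Icc θ₁ θ₂, Integrable (fun y : ℝ => y ^ 2) (P s) := by
    intro s hs
    have := hf.isProb s hs
    refine ((integrable_const 1).add (hf.third_moment s hs)).mono' (by fun_prop)
      (ae_of_all _ fun y => ?_)
    rw [Real.norm_eq_abs, abs_pow, Pi.add_apply]
    rcases le_total |y| 1 with h | h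
    · linarith [pow_le_one₀ (n := 2) (abs_nonneg y) h, pow_nonneg (abs_nonneg y) 3]
    · linarith [pow_le_pow_right₀ h (show 2 ≤ 3 by norm_num)]
  have key := loglik_eq_integral_of_information_eq (p := P θ₁) hθ (hf.ae_mem h𝒴 h1Θ) hv_cont
    hv_pos hLm hL'm hL (fun y _ => (hLcont y).continuousOn)
    (by
      intro y hy
      have : IntegrableOn (fun s => logLikDeriv (Set.Icc θ₁ θ₂) f 1 y s) (Set.Ico θ₁ θ₂) :=
        ((hd1 y hy).integrableOn_Icc).mono_set hIco
      rw [integrableOn_Icc_iff_integrableOn_Ico]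
      refine this.congr_fun (fun s hs => ?_) measurableSet_Ico
      simp only [hL'def, if_pos (And.intro hy hs)])
    (fun y hy => by rw [hLeq y hy θ₁ h1Θ, sub_self])
    (fun s hs => by
      have := hf.isProb s hs
      simpa using tI s hs (fun _ => 1) (integrable_const 1))
    (fun s hs => tI s hs _ (hsq s hs))
    (fun s hs => tI s (hIco hs) _ ((hf.integrable_score_sq s (hIco hs)).congr
      ((hsc s hs).mono fun y hy => by simp only [hy])))
    (fun s hs => by
      have := hf.isProb s hs
      simpa using tE s hs (fun _ => 1))
    (fun s hs => by rw [tE s hs (fun y => y), hf.mean_eq s hs])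
    (fun s hs => by
      rw [tE s hs (fun y => (y - s) ^ 2), ← hf.variance_eq s hs,
        variance_eq_integral measurable_id'.aemeasurable, hf.mean_eq s hs])
    (fun s hs => by
      rw [tE s (hIco hs) (fun y => L' y s), integral_congr_ae (hsc s hs)]
      exact hf.score_mean s (hIco hs))
    (fun s hs => by
      rw [tE s (hIco hs) (fun y => L' y s ^ 2), ← hf.fisherInfo_eq s (hIco hs), fisherInfo]
      refine integral_congr_ae ((hsc s hs).mono fun y hy => ?_)
      simp only [hy])
  rw [hPL τ hτ]
  refine withDensity_congr_ae ?_
  filter_upwards [key] with y hy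
  rw [hy τ hτ]

end IsMeanParamFamilyWith

/-- With `A τ = ∫ s in x..τ, 1 / w s`, this bounds the cumulant generating function (the left-hand
side) at the natural parameter `A τ` by a quadratic. -/
theorem integral_sub_div_le {w : ℝ → ℝ} (hw : Continuous w) (hpos : ∀ s, 0 < w s) {x τ M : ℝ}
    (hM : ∀ s ∈ Set.uIcc x τ, w s ≤ M) :
    ∫ s in x..τ, (s - x) / w s ≤ (∫ s in x..τ, 1 / w s) ^ 2 * M / 2 := by
  have c1 : Continuous fun s => 1 / w s := continuous_const.div hw fun s => (hpos s).ne'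
  have c2 : Continuous fun s => (s - x) / w s :=
    (continuous_id.sub continuous_const).div hw fun s => (hpos s).ne'
  set A : ℝ → ℝ := fun t => ∫ s in x..t, 1 / w s with hA
  have hAd : ∀ t, HasDerivAt A (1 / w t) t := fun t =>
    intervalIntegral.integral_hasDerivAt_right (c1.intervalIntegrable _ _)
      (c1.stronglyMeasurableAtFilter _ _) c1.continuousAt
  have hAx : A x = 0 := intervalIntegral.integral_same
  have hAc : Continuous A := continuous_iff_continuousAt.2 fun t => (hAd t).continuousAt
  have hAA : ∫ s in x..τ, M * A s * (1 / w s) = A τ ^ 2 * M / 2 := by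
    have := intervalIntegral.integral_eq_sub_of_hasDerivAt (a := x) (b := τ)
      (f := fun t => A t ^ 2 * M / 2) (f' := fun s => M * A s * (1 / w s))
      (fun t _ => by
        have h := (((hAd t).pow 2).mul_const M).div_const 2
        refine h.congr_deriv ?_
        push_cast; ring)
      (((continuous_const.mul hAc).mul c1).intervalIntegrable _ _)
    rw [this, hAx]; ring
  change _ ≤ A τ ^ 2 * M / 2
  rw [← hAA]
  have hMpos : 0 < M := (hpos x).trans_le (hM x Set.left_mem_uIcc)
  have c3 : Continuous fun s => M * A s * (1 / w s) := (continuous_const.mul hAc).mul c1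
  rcases le_total x τ with h | h
  · refine intervalIntegral.integral_mono_on h (c2.intervalIntegrable _ _)
      (c3.intervalIntegrable _ _) fun s hs => ?_
    rw [Set.uIcc_of_le h] at hM
    have hle : (s - x) * (1 / M) ≤ A s := by
      have : ∫ _ in x..s, 1 / M ≤ A s :=
        intervalIntegral.integral_mono_on hs.1 (by simp) (c1.intervalIntegrable _ _)
          fun u hu => one_div_le_one_div_of_le (hpos u) (hM u ⟨hu.1, hu.2.trans hs.2⟩)
      simpa using this
    rw [div_eq_mul_one_div]
    refine mul_le_mul_of_nonneg_right ?_ (one_div_pos.2 (hpos s)).le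
    rw [mul_one_div, div_le_iff₀ hMpos] at hle
    linarith
  · rw [intervalIntegral.integral_symm, intervalIntegral.integral_symm (a := τ) (b := x),
      neg_le_neg_iff]
    refine intervalIntegral.integral_mono_on h (c3.intervalIntegrable _ _)
      (c2.intervalIntegrable _ _) fun s hs => ?_
    rw [Set.uIcc_of_ge h] at hM
    have hle : (x - s) * (1 / M) ≤ - A s := by
      have h1 : ∫ _ in s..x, 1 / M ≤ ∫ u in s..x, 1 / w u :=
        intervalIntegral.integral_mono_on hs.2 (by simp) (c1.intervalIntegrable _ _)
          fun u hu => one_div_le_one_div_of_le (hpos u) (hM u ⟨hs.1.trans hu.1, hu.2⟩)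
      have h2 : ∫ u in s..x, 1 / w u = -A s := intervalIntegral.integral_symm x s
      rw [h2, intervalIntegral.integral_const, smul_eq_mul] at h1
      exact h1
    rw [div_eq_mul_one_div (s - x)]
    refine mul_le_mul_of_nonneg_right ?_ (one_div_pos.2 (hpos s)).le
    rw [mul_one_div, div_le_iff₀ hMpos] at hle
    linarith

theorem pow_four_le_exp (t : ℝ) : t ^ 4 ≤ 24 * (Real.exp t + Real.exp (-t)) := by
  have h : ∀ u : ℝ, 0 ≤ u → u ^ 4 ≤ 24 * Real.exp u := fun u hu => by
    have := Real.pow_div_factorial_le_exp u hu 4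
    norm_num [Nat.factorial] at this
    linarith
  rcases le_total 0 t with ht | ht
  · linarith [h t ht, Real.exp_pos (-t)]
  · have := h (-t) (by linarith)
    have e : (-t) ^ 4 = t ^ 4 := by ring
    linarith [Real.exp_pos t]

/-- What the analysis of the experiment uses about the outcome distributions of an arm: mean `x`,
variance `v x`, Gaussian exponential moments at arguments small compared to the distance of `x`
from the endpoints, and measurability in `x` (stated for the parameter clamped to `[θ₁, θ₂]`,
because nothing is assumed about `P x` outside). -/
structure HasGaussianMGF (θ₁ θ₂ S : ℝ) (v : ℝ → ℝ) (P : ℝ → Measure ℝ) : Prop where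
  isProb : ∀ x ∈ Set.Icc θ₁ θ₂, IsProbabilityMeasure (P x)
  integrable_sq : ∀ x ∈ Set.Icc θ₁ θ₂, Integrable (fun y => y ^ 2) (P x)
  mean_eq : ∀ x ∈ Set.Icc θ₁ θ₂, ∫ y, y ∂(P x) = x
  var_eq : ∀ x ∈ Set.Icc θ₁ θ₂, ∫ y, (y - x) ^ 2 ∂(P x) = v x
  lintegral_exp_le : ∀ x l M, θ₁ ≤ x - S * |l| → x + S * |l| ≤ θ₂ →
    (∀ s ∈ Set.Icc (x - S * |l|) (x + S * |l|), v s ≤ M) →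
    ∫⁻ y, ENNReal.ofReal (Real.exp (l * (y - x))) ∂(P x) ≤
      ENNReal.ofReal (Real.exp (l ^ 2 * M / 2))
  measurable : Measurable fun x => P (max θ₁ (min θ₂ x))

/-- In an exponential family the moment generating function is the normalizing constant of another
member of the family, as long as the natural parameter stays in the range; the variance is the
second derivative of its logarithm, so a bound `M` for the variances gives a Gaussian bound. -/
theorem IsMeanParamFamilyWith.hasGaussianMGF {θ₁ θ₂ S : ℝ} {𝒴 : Set ℝ} {v : ℝ → ℝ}
    {P : ℝ → Measure ℝ} {f : ℝ → ℝ → ℝ}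
    (hf : IsMeanParamFamilyWith (Set.Icc θ₁ θ₂) 𝒴 v P f) (h𝒴 : MeasurableSet 𝒴) (hθ : θ₁ < θ₂)
    (hv_cont : ContinuousOn v (Set.Icc θ₁ θ₂)) (hv_pos : ∀ s ∈ Set.Icc θ₁ θ₂, 0 < v s)
    (hS : ∀ s ∈ Set.Icc θ₁ θ₂, v s ≤ S) : HasGaussianMGF θ₁ θ₂ S v P := by
  have h1Θ : θ₁ ∈ Set.Icc θ₁ θ₂ := Set.left_mem_Icc.2 hθ.le
  have := hf.isProb θ₁ h1Θ
  have hSpos : 0 < S := (hv_pos θ₁ h1Θ).trans_le (hS θ₁ h1Θ)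
  set cl : ℝ → ℝ := fun s => max θ₁ (min θ₂ s) with hcl
  have hclc : Continuous cl := by fun_prop
  have hclm : ∀ s, cl s ∈ Set.Icc θ₁ θ₂ := fun s =>
    ⟨le_max_left _ _, max_le hθ.le (min_le_left _ _)⟩
  have hcls : ∀ s ∈ Set.Icc θ₁ θ₂, cl s = s := fun s hs => by
    simp [hcl, hs.1, hs.2]
  set w : ℝ → ℝ := fun s => v (cl s) with hwdef
  have hw : Continuous w := hv_cont.comp_continuous hclc hclm
  have hwpos : ∀ s, 0 < w s := fun s => hv_pos _ (hclm s)
  have c1 : Continuous fun s => 1 / w s := continuous_const.div hw fun s => (hwpos s).ne'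
  have c2 : ∀ x : ℝ, Continuous fun s => (s - x) / w s := fun x =>
    (continuous_id.sub continuous_const).div hw fun s => (hwpos s).ne'
  -- splitting of the exponent
  have hsplit : ∀ y x t : ℝ, ∫ s in x..t, (y - s) / w s =
      (y - x) * (∫ s in x..t, 1 / w s) - ∫ s in x..t, (s - x) / w s := by
    intro y x t
    have c3 : Continuous fun s => (y - x) * (1 / w s) := continuous_const.mul c1
    rw [← intervalIntegral.integral_const_mul, ← intervalIntegral.integral_sub
      (c3.intervalIntegrable _ _) ((c2 x).intervalIntegrable _ _)]
    refine intervalIntegral.integral_congr fun s _ => ?_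
    have := (hwpos s).ne'
    field_simp
    ring
  have hPw : ∀ τ ∈ Set.Icc θ₁ θ₂, P τ = (P θ₁).withDensity fun y =>
      ENNReal.ofReal (Real.exp (∫ s in θ₁..τ, (y - s) / w s)) := by
    intro τ hτ
    rw [hf.eq_withDensity_exp h𝒴 hθ hv_cont hv_pos hτ]
    congr 1; funext y; congr 2
    refine intervalIntegral.integral_congr fun s hs => ?_
    rw [Set.uIcc_of_le hτ.1] at hs
    simp only [hwdef, hcls s ⟨hs.1, hs.2.trans hτ.2⟩]
  have hmeas : ∀ x t : ℝ, Measurable fun y =>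
      ENNReal.ofReal (Real.exp (∫ s in x..t, (y - s) / w s)) := by
    intro x t; simp_rw [hsplit]; fun_prop
  have htilt : ∀ x ∈ Set.Icc θ₁ θ₂, ∀ τ ∈ Set.Icc θ₁ θ₂,
      ∫⁻ y, ENNReal.ofReal (Real.exp (∫ s in x..τ, (y - s) / w s)) ∂(P x) = 1 := by
    intro x hx τ hτ
    have := hf.isProb τ hτ
    rw [hPw x hx, lintegral_withDensity_eq_lintegral_mul _ (hmeas _ _) (hmeas _ _),
      ← measure_univ (μ := P τ), hPw τ hτ, withDensity_apply _ MeasurableSet.univ,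
      setLIntegral_univ]
    refine lintegral_congr fun y => ?_
    rw [Pi.mul_apply, ← ENNReal.ofReal_mul (Real.exp_pos _).le, ← Real.exp_add]
    congr 2
    have c3 : Continuous fun s => (y - s) / w s :=
      (continuous_const.sub continuous_id).div hw fun s => (hwpos s).ne'
    exact intervalIntegral.integral_add_adjacent_intervals (c3.intervalIntegrable _ _)
      (c3.intervalIntegrable _ _)
  have hsq : ∀ x ∈ Set.Icc θ₁ θ₂, Integrable (fun y : ℝ => y ^ 2) (P x) := by
    intro s hs
    have := hf.isProb s hs
    refine ((integrable_const 1).add (hf.third_moment s hs)).mono' (by fun_prop)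
      (ae_of_all _ fun y => ?_)
    rw [Real.norm_eq_abs, abs_pow, Pi.add_apply]
    rcases le_total |y| 1 with h | h
    · linarith [pow_le_one₀ (n := 2) (abs_nonneg y) h, pow_nonneg (abs_nonneg y) 3]
    · linarith [pow_le_pow_right₀ h (show 2 ≤ 3 by norm_num)]
  refine ⟨hf.isProb, hsq, hf.mean_eq, ?_, ?_, ?_⟩
  · intro x hx
    rw [← hf.variance_eq x hx, variance_eq_integral measurable_id'.aemeasurable, hf.mean_eq x hx]
  · intro x l M hx1 hx2 hM
    have hSl : 0 ≤ S * |l| := mul_nonneg hSpos.le (abs_nonneg _)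
    have hx : x ∈ Set.Icc θ₁ θ₂ := ⟨by linarith, by linarith⟩
    have hI : Set.Icc (x - S * |l|) (x + S * |l|) ⊆ Set.Icc θ₁ θ₂ :=
      Set.Icc_subset_Icc hx1 hx2
    -- the natural parameter `l` is attained, by the intermediate value theorem
    set A : ℝ → ℝ := fun t => ∫ s in x..t, 1 / w s with hA
    have hAc : Continuous A :=
      intervalIntegral.continuous_primitive (fun a b => c1.intervalIntegrable a b) x
    have hwS : ∀ s, 1 / S ≤ 1 / w s := fun s =>
      one_div_le_one_div_of_le (hwpos s) (hS _ (hclm s))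
    have hup : |l| ≤ A (x + S * |l|) := by
      have : ∫ _ in x..(x + S * |l|), 1 / S ≤ A (x + S * |l|) :=
        intervalIntegral.integral_mono_on (by linarith) (by simp) (c1.intervalIntegrable _ _)
          fun u _ => hwS u
      simp only [intervalIntegral.integral_const, add_sub_cancel_left, smul_eq_mul] at this
      rwa [show S * |l| * (1 / S) = |l| by field_simp] at this
    have hlo : A (x - S * |l|) ≤ -|l| := by
      have : ∫ _ in (x - S * |l|)..x, 1 / S ≤ ∫ s in (x - S * |l|)..x, 1 / w s :=
        intervalIntegral.integral_mono_on (by linarith) (by simp) (c1.intervalIntegrable _ _)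
          fun u _ => hwS u
      have h2 : ∫ u in (x - S * |l|)..x, 1 / w u = -A (x - S * |l|) :=
        intervalIntegral.integral_symm x _
      rw [h2, intervalIntegral.integral_const, sub_sub_cancel, smul_eq_mul] at this
      rw [show S * |l| * (1 / S) = |l| by field_simp] at this
      exact le_neg.1 this
    obtain ⟨τ, hτ, hτl⟩ : ∃ τ ∈ Set.Icc (x - S * |l|) (x + S * |l|), A τ = l :=
      intermediate_value_Icc (by linarith) hAc.continuousOn
        ⟨hlo.trans (neg_abs_le l), (le_abs_self l).trans hup⟩
    have hB := integral_sub_div_le hw hwpos (x := x) (τ := τ) (M := M) fun s hs => by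
      have hs' : s ∈ Set.Icc (x - S * |l|) (x + S * |l|) :=
        Set.uIcc_subset_Icc ⟨by linarith, by linarith⟩ hτ hs
      simp only [hwdef, hcls s (hI hs')]
      exact hM s hs'
    have h1 := htilt x hx τ (hI hτ)
    simp_rw [hsplit] at h1
    change ∫ s in x..τ, (s - x) / w s ≤ A τ ^ 2 * M / 2 at hB
    rw [hτl] at hB
    calc ∫⁻ y, ENNReal.ofReal (Real.exp (l * (y - x))) ∂(P x)
        ≤ ∫⁻ y, ENNReal.ofReal (Real.exp (l ^ 2 * M / 2)) * ENNReal.ofReal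
            (Real.exp ((y - x) * A τ - ∫ s in x..τ, (s - x) / w s)) ∂(P x) := by
          refine lintegral_mono fun y => ?_
          rw [← ENNReal.ofReal_mul (Real.exp_pos _).le, ← Real.exp_add, hτl]
          refine ENNReal.ofReal_le_ofReal (Real.exp_le_exp.2 ?_)
          linarith
      _ = ENNReal.ofReal (Real.exp (l ^ 2 * M / 2)) := by
          rw [lintegral_const_mul _ (by fun_prop), h1, mul_one]
  · refine Measure.measurable_of_measurable_coe _ fun B hB => ?_
    have hcA : Continuous fun t => ∫ s in θ₁..t, 1 / w s :=
      intervalIntegral.continuous_primitive (fun a b => c1.intervalIntegrable a b) θ₁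
    have hcB : Continuous fun t => ∫ s in θ₁..t, (s - θ₁) / w s :=
      intervalIntegral.continuous_primitive (fun a b => (c2 θ₁).intervalIntegrable a b) θ₁
    have e : ∀ x, P (cl x) B = ∫⁻ y in B, ENNReal.ofReal (Real.exp ((y - θ₁) *
        (∫ s in θ₁..cl x, 1 / w s) - ∫ s in θ₁..cl x, (s - θ₁) / w s)) ∂(P θ₁) := by
      intro x
      rw [hPw _ (hclm x), withDensity_apply _ hB]
      simp_rw [hsplit]
    change Measurable fun x => P (cl x) B
    simp_rw [e]
    refine Measurable.lintegral_prod_right' (f := fun q : ℝ × ℝ => ENNReal.ofReal (Real.exp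
      ((q.2 - θ₁) * (∫ s in θ₁..cl q.1, 1 / w s) - ∫ s in θ₁..cl q.1, (s - θ₁) / w s))) ?_
    have m1 : Measurable fun q : ℝ × ℝ => ∫ s in θ₁..cl q.1, 1 / w s :=
      ((hcA.comp hclc).measurable).comp measurable_fst
    have m2 : Measurable fun q : ℝ × ℝ => ∫ s in θ₁..cl q.1, (s - θ₁) / w s :=
      ((hcB.comp hclc).measurable).comp measurable_fst
    exact ((((measurable_snd.sub_const θ₁).mul m1).sub m2).exp).ennreal_ofReal

/-- The fourth central moment, at distance at least `ε` from the endpoints. -/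
theorem HasGaussianMGF.lintegral_pow_four_le {θ₁ θ₂ S : ℝ} {v : ℝ → ℝ} {P : ℝ → Measure ℝ}
    (hP : HasGaussianMGF θ₁ θ₂ S v P) (hS : ∀ s ∈ Set.Icc θ₁ θ₂, v s ≤ S) (hSpos : 0 < S)
    {x ε : ℝ} (hε : 0 < ε) (hε1 : ε ≤ 1) (hx1 : θ₁ + ε ≤ x) (hx2 : x + ε ≤ θ₂) :
    ∫⁻ y, ENNReal.ofReal ((y - x) ^ 4) ∂(P x) ≤
      ENNReal.ofReal (48 * S ^ 4 * Real.exp (1 / S) / ε ^ 4) := by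
  set l : ℝ := ε / S with hl
  have hlpos : 0 < l := div_pos hε hSpos
  have hSl : S * l = ε := by rw [hl]; field_simp
  have hb : ∀ l' : ℝ, |l'| = l →
      ∫⁻ y, ENNReal.ofReal (Real.exp (l' * (y - x))) ∂(P x) ≤
        ENNReal.ofReal (Real.exp (1 / S)) := by
    intro l' hl'
    refine (hP.lintegral_exp_le x l' S (by rw [hl', hSl]; linarith) (by rw [hl', hSl]; linarith)
      fun s hs => hS s ?_).trans ?_
    · rw [hl', hSl] at hs; exact ⟨by linarith [hs.1], by linarith [hs.2]⟩
    · refine ENNReal.ofReal_le_ofReal (Real.exp_le_exp.2 ?_)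
      rw [← sq_abs, hl', hl, div_pow, div_mul_eq_mul_div, div_div, div_le_div_iff₀ (by positivity)
        hSpos]
      nlinarith [mul_pos hSpos hSpos, pow_le_one₀ (n := 2) hε.le hε1]
  have h4 : ∀ y : ℝ, (y - x) ^ 4 ≤
      24 / l ^ 4 * Real.exp (l * (y - x)) + 24 / l ^ 4 * Real.exp (-l * (y - x)) := by
    intro y
    have := pow_four_le_exp (l * (y - x))
    rw [mul_pow, neg_mul_eq_neg_mul] at this
    rw [← mul_add, div_mul_eq_mul_div, le_div_iff₀ (by positivity)]
    linarith
  calc ∫⁻ y, ENNReal.ofReal ((y - x) ^ 4) ∂(P x)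
      ≤ ∫⁻ y, (ENNReal.ofReal (24 / l ^ 4) * ENNReal.ofReal (Real.exp (l * (y - x)))
          + ENNReal.ofReal (24 / l ^ 4) * ENNReal.ofReal (Real.exp (-l * (y - x)))) ∂(P x) := by
        refine lintegral_mono fun y => ?_
        rw [← ENNReal.ofReal_mul (by positivity), ← ENNReal.ofReal_mul (by positivity),
          ← ENNReal.ofReal_add (by positivity) (by positivity)]
        exact ENNReal.ofReal_le_ofReal (h4 y)
    _ ≤ ENNReal.ofReal (24 / l ^ 4) * ENNReal.ofReal (Real.exp (1 / S))
          + ENNReal.ofReal (24 / l ^ 4) * ENNReal.ofReal (Real.exp (1 / S)) := by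
        rw [lintegral_add_left (by fun_prop), lintegral_const_mul _ (by fun_prop),
          lintegral_const_mul _ (by fun_prop)]
        gcongr
        · exact hb l (abs_of_pos hlpos)
        · exact hb (-l) (by rw [abs_neg, abs_of_pos hlpos])
    _ = ENNReal.ofReal (48 * S ^ 4 * Real.exp (1 / S) / ε ^ 4) := by
        rw [← ENNReal.ofReal_mul (by positivity),
          ← ENNReal.ofReal_add (by positivity) (by positivity)]
        congr 1
        rw [hl]; field_simp; ring

/-! ### Structure of the experiment -/

section Structure

variable {K : ℕ} {T : ℕ}

theorem argmax_spec {ι : Type*} [Fintype ι] [LinearOrder ι] [Nonempty ι] (g : ι → ℝ) (j : ι) :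
    g j ≤ g (argmax g) := by
  have := Finset.min'_mem _ (exists_argmax g)
  simp only [Set.Finite.mem_toFinset, Set.mem_ofPred_eq] at this
  exact this j

theorem argmax_eq_iff {ι : Type*} [Fintype ι] [LinearOrder ι] [Nonempty ι] (g : ι → ℝ) (i : ι) :
    argmax g = i ↔ (∀ j, g j ≤ g i) ∧ ∀ k, k < i → ¬ ∀ j, g j ≤ g k := by
  unfold argmax
  rw [Finset.min'_eq_iff]
  simp only [Set.Finite.mem_toFinset, Set.mem_ofPred_eq]
  refine and_congr_right fun _ => ⟨fun h k hk hk' => (h k hk').not_gt hk, fun h k hk => ?_⟩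
  by_contra hlt
  exact h k (not_le.1 hlt) hk

theorem measurable_argmax {ι : Type*} [Fintype ι] [LinearOrder ι] [Nonempty ι]
    [MeasurableSpace ι] : Measurable (argmax : (ι → ℝ) → ι) := by
  refine measurable_to_countable' fun i => ?_
  have e : (argmax : (ι → ℝ) → ι) ⁻¹' {i} =
      {g | (∀ j, g j ≤ g i) ∧ ∀ k, k < i → ¬ ∀ j, g j ≤ g k} := by
    ext g; exact argmax_eq_iff g i
  rw [e]
  have h : ∀ k : ι, MeasurableSet {g : ι → ℝ | ∀ j, g j ≤ g k} := fun k => by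
    rw [Set.ofPred_forall]
    exact MeasurableSet.iInter fun j =>
      measurableSet_le (measurable_pi_apply j) (measurable_pi_apply k)
  refine (h i).inter ?_
  change MeasurableSet {g : ι → ℝ | ∀ k, k < i → ¬ ∀ j, g j ≤ g k}
  rw [Set.ofPred_forall]
  refine MeasurableSet.iInter fun k => ?_
  by_cases hk : k < i
  · simp only [hk, forall_const]
    exact (h k).compl
  · simp [hk]

/-- The rounds of the pilot stage. -/
noncomputable def pilotStage (K : ℕ) (r : ℝ) (T : ℕ) : Finset (Fin T) :=
  Finset.univ.filter fun t => (t : ℕ) < K * pilotSize K r T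

theorem mem_pilotStage {r : ℝ} {t : Fin T} :
    t ∈ pilotStage K r T ↔ (t : ℕ) < K * pilotSize K r T := by
  simp [pilotStage]

theorem mem_pilotRounds {r : ℝ} {a : Fin K} {t : Fin T} :
    t ∈ pilotRounds r T a ↔
      (a : ℕ) * pilotSize K r T ≤ t ∧ (t : ℕ) < ((a : ℕ) + 1) * pilotSize K r T := by
  simp [pilotRounds]

theorem pilotRounds_subset (r : ℝ) (a : Fin K) : pilotRounds r T a ⊆ pilotStage K r T := by
  intro t ht
  rw [mem_pilotRounds] at ht
  rw [mem_pilotStage]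
  exact ht.2.trans_le (Nat.mul_le_mul_right _ a.2)

theorem pilotRounds_unique {r : ℝ} {a b : Fin K} {t : Fin T} (ha : t ∈ pilotRounds r T a)
    (hb : t ∈ pilotRounds r T b) : a = b := by
  rw [mem_pilotRounds] at ha hb
  have h1 := lt_of_mul_lt_mul_right (ha.1.trans_lt hb.2) (Nat.zero_le _)
  have h2 := lt_of_mul_lt_mul_right (hb.1.trans_lt ha.2) (Nat.zero_le _)
  exact Fin.ext (by omega)

theorem exists_mem_pilotRounds {r : ℝ} {t : Fin T} (ht : t ∈ pilotStage K r T) :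
    ∃ a : Fin K, t ∈ pilotRounds r T a := by
  rw [mem_pilotStage] at ht
  have hm : 0 < pilotSize K r T := by
    rcases Nat.eq_zero_or_pos (pilotSize K r T) with h | h
    · simp [h] at ht
    · exact h
  refine ⟨⟨(t : ℕ) / pilotSize K r T, ?_⟩, ?_⟩
  · exact Nat.div_lt_of_lt_mul (by rwa [mul_comm] at ht)
  · rw [mem_pilotRounds]
    exact ⟨Nat.div_mul_le_self _ _, by
      simpa [mul_comm] using Nat.lt_mul_div_succ (t : ℕ) hm⟩

theorem mul_pilotSize_le {r : ℝ} (hr0 : 0 ≤ r) (hr1 : r ≤ 1) (T : ℕ) :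
    K * pilotSize K r T ≤ T := by
  rcases Nat.eq_zero_or_pos K with h | h
  · simp [h]
  have hK : (0 : ℝ) < K := by exact_mod_cast h
  have h1 : (pilotSize K r T : ℝ) ≤ r * T / K := Nat.floor_le (by positivity)
  have h2 : (K : ℝ) * pilotSize K r T ≤ T := by
    calc (K : ℝ) * pilotSize K r T ≤ K * (r * T / K) := by gcongr
      _ = r * T := by field_simp
      _ ≤ 1 * T := by gcongr
      _ = T := one_mul _
  exact_mod_cast h2

theorem card_pilotRounds {r : ℝ} (hr0 : 0 ≤ r) (hr1 : r ≤ 1) (a : Fin K) :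
    (pilotRounds r T a).card = pilotSize K r T := by
  set m := pilotSize K r T with hm
  have hle : ((a : ℕ) + 1) * m ≤ T :=
    (Nat.mul_le_mul_right _ a.2).trans (mul_pilotSize_le hr0 hr1 T)
  have : (pilotRounds r T a).map Fin.valEmbedding =
      Finset.Ico ((a : ℕ) * m) (((a : ℕ) + 1) * m) := by
    ext i
    simp only [Finset.mem_map, mem_pilotRounds, Fin.valEmbedding_apply, Finset.mem_Ico]
    constructor
    · rintro ⟨t, ht, rfl⟩; exact ht
    · intro hi; exact ⟨⟨i, hi.2.trans_le hle⟩, hi, rfl⟩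
  rw [← Finset.card_map Fin.valEmbedding, this, Nat.card_Ico, add_mul, one_mul,
    Nat.add_sub_cancel_left]

theorem card_pilotStage {r : ℝ} (hr0 : 0 ≤ r) (hr1 : r ≤ 1) :
    (pilotStage K r T).card = K * pilotSize K r T := by
  have hle := mul_pilotSize_le (K := K) hr0 hr1 T
  have : (pilotStage K r T).map Fin.valEmbedding = Finset.range (K * pilotSize K r T) := by
    ext i
    simp only [Finset.mem_map, mem_pilotStage, Fin.valEmbedding_apply, Finset.mem_range]
    constructor
    · rintro ⟨t, ht, rfl⟩; exact ht
    · intro hi; exact ⟨⟨i, hi.trans_le hle⟩, hi, rfl⟩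
  rw [← Finset.card_map Fin.valEmbedding, this, Finset.card_range]

/-! ### The statistics of the pilot stage -/

variable {r : ℝ}

theorem pilotMean_congr {Y Y' : Fin T → Fin K → ℝ}
    (h : ∀ a, ∀ t ∈ pilotRounds r T a, Y t a = Y' t a) : pilotMean r Y = pilotMean r Y' := by
  funext a
  simp only [pilotMean, sampleMean]
  rw [Finset.sum_congr rfl (h a)]

theorem pilotSd_congr {Y Y' : Fin T → Fin K → ℝ}
    (h : ∀ a, ∀ t ∈ pilotRounds r T a, Y t a = Y' t a) : pilotSd r Y = pilotSd r Y' := by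
  funext a
  simp only [pilotSd, pilotVar, pilotMean_congr h]
  rw [Finset.sum_congr rfl fun t ht => by rw [h a t ht]]

theorem mem_candidates {Y : Fin T → Fin K → ℝ} {a : Fin K} : a ∈ candidates r Y ↔
    ∀ b, pilotMean r Y b - width r Y ≤ pilotMean r Y a + width r Y := by
  simp [candidates]

theorem candidates_congr {Y Y' : Fin T → Fin K → ℝ}
    (h : ∀ a, ∀ t ∈ pilotRounds r T a, Y t a = Y' t a) : candidates r Y = candidates r Y' := by
  ext a
  rw [mem_candidates, mem_candidates]
  simp only [width, pilotMean_congr h, pilotSd_congr h]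

theorem idealRatio_congr {Y Y' : Fin T → Fin K → ℝ}
    (h : ∀ a, ∀ t ∈ pilotRounds r T a, Y t a = Y' t a) : idealRatio r Y = idealRatio r Y' := by
  funext a
  unfold idealRatio
  rw [candidates_congr h, pilotSd_congr h]

theorem secondStageWeight_congr {Y Y' : Fin T → Fin K → ℝ}
    (h : ∀ a, ∀ t ∈ pilotRounds r T a, Y t a = Y' t a) :
    secondStageWeight r Y = secondStageWeight r Y' := by
  funext a
  unfold secondStageWeight
  rw [candidates_congr h, idealRatio_congr h]

theorem secondStageProb_congr {Y Y' : Fin T → Fin K → ℝ}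
    (h : ∀ a, ∀ t ∈ pilotRounds r T a, Y t a = Y' t a) :
    secondStageProb r Y = secondStageProb r Y' := by
  funext a
  unfold secondStageProb
  rw [secondStageWeight_congr h, candidates_congr h]

theorem allocProb_congr {Y Y' : Fin T → Fin K → ℝ}
    (h : ∀ a, ∀ t ∈ pilotRounds r T a, Y t a = Y' t a) : allocProb r Y = allocProb r Y' := by
  funext t a
  simp only [allocProb, secondStageProb_congr h]

theorem measurable_apply_apply (t : Fin T) (a : Fin K) :
    Measurable fun Y : Fin T → Fin K → ℝ => Y t a :=
  (measurable_pi_apply a).comp (measurable_pi_apply t)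

theorem measurable_sampleMean (s : Finset (Fin T)) (a : Fin K) :
    Measurable fun Y : Fin T → Fin K → ℝ => sampleMean Y s a :=
  (Finset.measurable_fun_sum _ fun t _ => measurable_apply_apply t a).div_const _

theorem measurable_pilotMean (a : Fin K) :
    Measurable fun Y : Fin T → Fin K → ℝ => pilotMean r Y a := measurable_sampleMean _ a

theorem measurable_pilotSd (a : Fin K) :
    Measurable fun Y : Fin T → Fin K → ℝ => pilotSd r Y a := by
  refine Measurable.sqrt ?_
  exact (Finset.measurable_fun_sum _ fun t _ =>
    ((measurable_apply_apply t a).sub (measurable_pilotMean a)).pow_const 2).div_const _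

theorem measurable_width : Measurable fun Y : Fin T → Fin K → ℝ => width r Y :=
  (Measurable.iSup fun b => measurable_pilotSd b).const_mul _

theorem measurableSet_mem_candidates (a : Fin K) :
    MeasurableSet {Y : Fin T → Fin K → ℝ | a ∈ candidates r Y} := by
  simp only [mem_candidates]
  rw [Set.ofPred_forall]
  exact MeasurableSet.iInter fun b => measurableSet_le
    ((measurable_pilotMean b).sub measurable_width) ((measurable_pilotMean a).add measurable_width)

theorem measurableSet_card_candidates (n : ℕ) :
    MeasurableSet {Y : Fin T → Fin K → ℝ | (candidates r Y).card = n} := by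
  have e : ∀ Y : Fin T → Fin K → ℝ, (candidates r Y).card =
      ∑ a, if a ∈ candidates r Y then 1 else 0 := fun Y => by simp
  simp_rw [e]
  have : Measurable fun Y : Fin T → Fin K → ℝ => ∑ a, if a ∈ candidates r Y then 1 else 0 :=
    Finset.measurable_fun_sum _ fun a _ =>
      Measurable.ite (measurableSet_mem_candidates a) measurable_const measurable_const
  exact this (measurableSet_singleton n)

theorem measurable_sum_candidates {g : (Fin T → Fin K → ℝ) → Fin K → ℝ}
    (hg : ∀ a, Measurable fun Y => g Y a) :
    Measurable fun Y : Fin T → Fin K → ℝ => ∑ b ∈ candidates r Y, g Y b := by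
  have e : ∀ Y : Fin T → Fin K → ℝ, ∑ b ∈ candidates r Y, g Y b =
      ∑ b, if b ∈ candidates r Y then g Y b else 0 := fun Y => by
    rw [Finset.sum_ite_mem, Finset.univ_inter]
  simp_rw [e]
  exact Finset.measurable_fun_sum _ fun a _ =>
    Measurable.ite (measurableSet_mem_candidates a) (hg a) measurable_const

theorem measurable_secondStageProb (a : Fin K) :
    Measurable fun Y : Fin T → Fin K → ℝ => secondStageProb r Y a := by
  have h1 : ∀ a, Measurable fun Y : Fin T → Fin K → ℝ => idealRatio r Y a := fun a =>
    Measurable.ite (measurableSet_card_candidates 2)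
      ((measurable_pilotSd a).div (measurable_sum_candidates fun b => measurable_pilotSd b))
      (((measurable_pilotSd a).pow_const 2).div
        (measurable_sum_candidates fun b => (measurable_pilotSd b).pow_const 2))
  have h2 : ∀ a, Measurable fun Y : Fin T → Fin K → ℝ => secondStageWeight r Y a := fun a =>
    Measurable.ite (measurableSet_mem_candidates a)
      (((h1 a).sub_const _).max measurable_const) measurable_const
  have h3 : Measurable fun Y : Fin T → Fin K → ℝ => ∑ b, secondStageWeight r Y b :=
    Finset.measurable_fun_sum _ fun b _ => h2 b
  have h4 : Measurable fun Y : Fin T → Fin K → ℝ => (1 : ℝ) / ((candidates r Y).card : ℝ) := by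
    have e : ∀ Y : Fin T → Fin K → ℝ, ((candidates r Y).card : ℝ) =
        ∑ b ∈ candidates r Y, (1 : ℝ) := fun Y => by simp
    simp_rw [e]
    exact measurable_const.div (measurable_sum_candidates fun b => measurable_const)
  exact Measurable.ite (h3 (measurableSet_singleton 0))
    (Measurable.ite (measurableSet_mem_candidates a) h4 measurable_const) ((h2 a).div h3)

theorem measurable_allocProb (t : Fin T) (a : Fin K) :
    Measurable fun Y : Fin T → Fin K → ℝ => allocProb r Y t a := by
  unfold allocProb
  split_ifs
  · exact measurable_const
  · exact measurable_const
  · exact measurable_secondStageProb a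

theorem measurable_recommend [Nonempty (Fin K)] (A : Fin T → Fin K) :
    Measurable fun Y : Fin T → Fin K → ℝ => recommend r Y A :=
  Measurable.ite (measurableSet_card_candidates 1)
    (measurable_argmax.comp (measurable_pi_lambda _ fun a => measurable_pilotMean a))
    (measurable_argmax.comp (measurable_pi_lambda _ fun a => measurable_sampleMean _ a))

/-! ### Allocation probabilities -/

theorem pilotSd_nonneg (Y : Fin T → Fin K → ℝ) (a : Fin K) : 0 ≤ pilotSd r Y a :=
  Real.sqrt_nonneg _

theorem pilotSd_le_iSup (Y : Fin T → Fin K → ℝ) (a : Fin K) :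
    pilotSd r Y a ≤ ⨆ b, pilotSd r Y b := le_ciSup (Set.finite_range _).bddAbove a

theorem width_nonneg (Y : Fin T → Fin K → ℝ) : 0 ≤ width r Y :=
  mul_nonneg (Real.sqrt_nonneg _) (Real.iSup_nonneg fun b => pilotSd_nonneg Y b)

theorem argmax_pilotMean_mem_candidates [Nonempty (Fin K)] (Y : Fin T → Fin K → ℝ) :
    argmax (pilotMean r Y) ∈ candidates r Y := by
  simp only [mem_candidates]
  intro b
  linarith [argmax_spec (pilotMean r Y) b, width_nonneg (r := r) Y]

theorem secondStageWeight_nonneg (Y : Fin T → Fin K → ℝ) (a : Fin K) :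
    0 ≤ secondStageWeight r Y a := by
  unfold secondStageWeight
  split_ifs
  · exact le_max_right _ _
  · exact le_rfl

theorem secondStageProb_nonneg (Y : Fin T → Fin K → ℝ) (a : Fin K) :
    0 ≤ secondStageProb r Y a := by
  unfold secondStageProb
  split_ifs
  · positivity
  · exact le_rfl
  · exact div_nonneg (secondStageWeight_nonneg Y a)
      (Finset.sum_nonneg fun b _ => secondStageWeight_nonneg Y b)

theorem sum_secondStageProb [Nonempty (Fin K)] (Y : Fin T → Fin K → ℝ) :
    ∑ a, secondStageProb r Y a = 1 := by
  unfold secondStageProb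
  split_ifs with h
  · have hc : ((candidates r Y).card : ℝ) ≠ 0 := by
      have : 0 < (candidates r Y).card :=
        Finset.card_pos.2 ⟨_, argmax_pilotMean_mem_candidates Y⟩
      exact_mod_cast this.ne'
    rw [Finset.sum_ite_mem, Finset.univ_inter, Finset.sum_const, nsmul_eq_mul]
    field_simp
  · rw [← Finset.sum_div, div_self h]

theorem allocProb_nonneg (Y : Fin T → Fin K → ℝ) (t : Fin T) (a : Fin K) :
    0 ≤ allocProb r Y t a := by
  unfold allocProb
  split_ifs
  · exact zero_le_one
  · exact le_rfl
  · exact secondStageProb_nonneg Y a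

theorem sum_allocProb [Nonempty (Fin K)] (Y : Fin T → Fin K → ℝ) (t : Fin T) :
    ∑ a, allocProb r Y t a = 1 := by
  unfold allocProb
  by_cases ht : (t : ℕ) < K * pilotSize K r T
  · simp only [if_pos ht]
    obtain ⟨a, ha⟩ := exists_mem_pilotRounds (mem_pilotStage.2 ht)
    rw [Finset.sum_eq_single a (fun b _ hb => if_neg fun h => hb (pilotRounds_unique h ha))
      (by simp), if_pos ha]
  · simp only [if_neg ht]
    exact sum_secondStageProb Y

theorem sum_prod_allocProb [Nonempty (Fin K)] (Y : Fin T → Fin K → ℝ) :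
    ∑ A : Fin T → Fin K, ∏ t, allocProb r Y t (A t) = 1 := by
  have := Finset.prod_univ_sum (fun _ : Fin T => (Finset.univ : Finset (Fin K)))
    (fun t a => allocProb r Y t a)
  rw [Fintype.piFinset_univ] at this
  rw [← this]
  simp [sum_allocProb]

theorem eq_of_prod_allocProb_ne_zero {Y : Fin T → Fin K → ℝ} {A : Fin T → Fin K}
    (h : ∏ t, allocProb r Y t (A t) ≠ 0) {a : Fin K} {t : Fin T} (ht : t ∈ pilotRounds r T a) :
    A t = a := by
  have h1 := Finset.prod_ne_zero_iff.1 h t (Finset.mem_univ _)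
  have h2 := mem_pilotStage.1 (pilotRounds_subset r a ht)
  unfold allocProb at h1
  rw [if_pos h2] at h1
  exact pilotRounds_unique (by by_contra hn; exact h1 (if_neg hn)) ht

end Structure

/-! ### The joint law of outcomes and allocations -/

section Law

variable {K T : ℕ} {r : ℝ}

/-- The joint law of the potential outcomes `Y` and the allocation `A`: the outcome vectors of the
rounds are independent with law `Q`, and given `Y` the allocation has probability
`∏ t, allocProb r Y t (A t)`. -/
noncomputable def experimentLaw (r : ℝ) (T : ℕ) (Q : Measure (Fin K → ℝ)) :
    Measure ((Fin T → Fin K → ℝ) × (Fin T → Fin K)) :=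
  ∑ A : Fin T → Fin K, ((Measure.pi fun _ : Fin T => Q).withDensity
    fun Y => ENNReal.ofReal (∏ t, allocProb r Y t (A t))).map fun Y => (Y, A)

theorem measurable_of_slices {β : Type*} [MeasurableSpace β]
    {F : (Fin T → Fin K → ℝ) × (Fin T → Fin K) → β} (h : ∀ A, Measurable fun Y => F (Y, A)) :
    Measurable F := measurable_from_prod_countable_left h

theorem measurable_allocWeight (A : Fin T → Fin K) :
    Measurable fun Y : Fin T → Fin K → ℝ => ENNReal.ofReal (∏ t, allocProb r Y t (A t)) :=
  (Finset.measurable_fun_prod _ fun t _ => measurable_allocProb t (A t)).ennreal_ofReal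

theorem sum_allocWeight [Nonempty (Fin K)] (Y : Fin T → Fin K → ℝ) :
    ∑ A : Fin T → Fin K, ENNReal.ofReal (∏ t, allocProb r Y t (A t)) = 1 := by
  rw [← ENNReal.ofReal_sum_of_nonneg fun A _ => Finset.prod_nonneg fun t _ =>
    allocProb_nonneg Y t (A t), sum_prod_allocProb, ENNReal.ofReal_one]

variable (Q : Measure (Fin K → ℝ))

theorem lintegral_experimentLaw {F : (Fin T → Fin K → ℝ) × (Fin T → Fin K) → ℝ≥0∞}
    (hF : Measurable F) : ∫⁻ z, F z ∂(experimentLaw r T Q) =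
      ∑ A : Fin T → Fin K, ∫⁻ Y, ENNReal.ofReal (∏ t, allocProb r Y t (A t)) * F (Y, A)
        ∂(Measure.pi fun _ : Fin T => Q) := by
  rw [experimentLaw, lintegral_finsetSum_measure]
  refine Finset.sum_congr rfl fun A _ => ?_
  have hA : Measurable fun Y : Fin T → Fin K → ℝ => (Y, A) := by fun_prop
  have hFA : Measurable fun Y : Fin T → Fin K → ℝ => F (Y, A) := hF.comp hA
  rw [lintegral_map hF hA, lintegral_withDensity_eq_lintegral_mul _ (measurable_allocWeight A) hFA]
  rfl

theorem lintegral_experimentLaw' {F : (Fin T → Fin K → ℝ) × (Fin T → Fin K) → ℝ≥0∞}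
    (hF : Measurable F) : ∫⁻ z, F z ∂(experimentLaw r T Q) =
      ∫⁻ Y, ∑ A : Fin T → Fin K, ENNReal.ofReal (∏ t, allocProb r Y t (A t)) * F (Y, A)
        ∂(Measure.pi fun _ : Fin T => Q) := by
  rw [lintegral_experimentLaw Q hF, lintegral_finsetSum]
  exact fun A _ => (measurable_allocWeight A).mul (hF.comp (by fun_prop))

theorem experimentLaw_map_fst [Nonempty (Fin K)] :
    (experimentLaw r T Q).map Prod.fst = Measure.pi fun _ : Fin T => Q := by
  ext B hB
  have hm : Measurable fun z : (Fin T → Fin K → ℝ) × (Fin T → Fin K) =>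
      B.indicator (1 : (Fin T → Fin K → ℝ) → ℝ≥0∞) z.1 :=
    (measurable_one.indicator hB).comp measurable_fst
  rw [← lintegral_indicator_one hB, lintegral_map (measurable_one.indicator hB) measurable_fst,
    lintegral_experimentLaw' Q hm, ← lintegral_indicator_one hB]
  refine lintegral_congr fun Y => ?_
  simp only
  rw [← Finset.sum_mul, sum_allocWeight, one_mul]

instance [Nonempty (Fin K)] [IsProbabilityMeasure Q] :
    IsProbabilityMeasure (experimentLaw r T Q) := by
  refine ⟨?_⟩
  have h := congrArg (fun m => m Set.univ) (experimentLaw_map_fst (r := r) (T := T) Q)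
  simpa [Measure.map_apply measurable_fst MeasurableSet.univ] using h

theorem experimentLaw_fst_mem [Nonempty (Fin K)] {B : Set (Fin T → Fin K → ℝ)}
    (hB : MeasurableSet B) :
    experimentLaw r T Q {z | z.1 ∈ B} = (Measure.pi fun _ : Fin T => Q) B := by
  rw [← experimentLaw_map_fst (r := r) Q, Measure.map_apply measurable_fst hB]
  rfl

theorem ae_experimentLaw {p : (Fin T → Fin K → ℝ) × (Fin T → Fin K) → Prop}
    (hpm : MeasurableSet {z | p z})
    (hp : ∀ Y A, (∏ t, allocProb r Y t (A t)) ≠ 0 → p (Y, A)) :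
    ∀ᵐ z ∂(experimentLaw r T Q), p z := by
  rw [experimentLaw, ← Measure.sum_fintype, Measure.ae_sum_iff]
  intro A
  have hA : Measurable fun Y : Fin T → Fin K → ℝ => (Y, A) := by fun_prop
  rw [ae_map_iff hA.aemeasurable hpm, ae_withDensity_iff (measurable_allocWeight A)]
  refine ae_of_all _ fun Y hY => hp Y A fun h => hY ?_
  rw [h, ENNReal.ofReal_zero]

theorem measurableSet_snd_mem (s : Set (Fin T → Fin K)) :
    MeasurableSet {z : (Fin T → Fin K → ℝ) × (Fin T → Fin K) | z.2 ∈ s} :=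
  measurable_snd (Set.to_countable s).measurableSet

/-- In the pilot stage the allocation is deterministic. -/
theorem ae_alloc_pilot :
    ∀ᵐ z ∂(experimentLaw r T Q), ∀ a, ∀ t ∈ pilotRounds r T a, z.2 t = a :=
  ae_experimentLaw Q (measurableSet_snd_mem {A | ∀ a, ∀ t ∈ pilotRounds r T a, A t = a})
    fun _ _ h _ _ ht => eq_of_prod_allocProb_ne_zero h ht

/-! ### Independence of the stages -/

variable [IsProbabilityMeasure Q]

/-- Functions of disjoint sets of rounds are independent under the product measure. -/
theorem lintegral_mul_of_dependsOn (S : Finset (Fin T)) {f g : (Fin T → Fin K → ℝ) → ℝ≥0∞}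
    (hf : Measurable f) (hg : Measurable g) (hfS : DependsOn f (S : Set (Fin T)))
    (hgS : DependsOn g ((S : Set (Fin T))ᶜ)) :
    ∫⁻ Y, f Y * g Y ∂(Measure.pi fun _ : Fin T => Q) =
      (∫⁻ Y, f Y ∂(Measure.pi fun _ : Fin T => Q)) *
        ∫⁻ Y, g Y ∂(Measure.pi fun _ : Fin T => Q) := by
  classical
  have hI := iIndepFun_pi (μ := fun _ : Fin T => Q) (X := fun _ : Fin T => id)
    fun _ => measurable_id.aemeasurable
  have hind := hI.indepFun_finset S Sᶜ disjoint_compl_right fun i => measurable_pi_apply i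
  have key : ∀ (U : Finset (Fin T)) (f : (Fin T → Fin K → ℝ) → ℝ≥0∞), Measurable f →
      DependsOn f (U : Set (Fin T)) → ∃ f' : (U → Fin K → ℝ) → ℝ≥0∞, Measurable f' ∧
        f = f' ∘ fun Y (i : U) => Y i := by
    intro U f hf hU
    refine ⟨fun u => f fun t => if h : t ∈ U then u ⟨t, h⟩ else 0, hf.comp ?_, ?_⟩
    · refine measurable_pi_lambda _ fun t => ?_
      by_cases h : t ∈ U
      · simp only [h, dif_pos]; exact measurable_pi_apply _
      · simp only [h, dif_neg, not_false_eq_true]; exact measurable_const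
    · funext Y
      refine hU fun t ht => ?_
      rw [Finset.mem_coe] at ht
      simp [ht]
  obtain ⟨f', hf', rfl⟩ := key S f hf hfS
  obtain ⟨g', hg', rfl⟩ := key Sᶜ g hg (by rwa [Finset.coe_compl])
  exact lintegral_mul_eq_lintegral_mul_lintegral_of_indepFun'' hf.aemeasurable hg.aemeasurable
    (hind.comp hf' hg')

/-- Integration in two stages: a function of the pilot data times a function which, for each
allocation, depends on the outcomes of the second stage only. -/
theorem lintegral_experimentLaw_mul_le [Nonempty (Fin K)] {φ : (Fin T → Fin K → ℝ) → ℝ≥0∞}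
    {ψ : (Fin T → Fin K) → (Fin T → Fin K → ℝ) → ℝ≥0∞} {C : ℝ≥0∞} (hφ : Measurable φ)
    (hψ : ∀ A, Measurable (ψ A)) (hφS : DependsOn φ (pilotStage K r T : Set (Fin T)))
    (hψS : ∀ A, DependsOn (ψ A) ((pilotStage K r T : Set (Fin T))ᶜ))
    (hC : ∀ A, ∫⁻ Y, ψ A Y ∂(Measure.pi fun _ : Fin T => Q) ≤ C) :
    ∫⁻ z, φ z.1 * ψ z.2 z.1 ∂(experimentLaw r T Q) ≤
      (∫⁻ Y, φ Y ∂(Measure.pi fun _ : Fin T => Q)) * C := by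
  have hm : ∀ A : Fin T → Fin K, Measurable fun Y : Fin T → Fin K → ℝ =>
      ENNReal.ofReal (∏ t, allocProb r Y t (A t)) * φ Y := fun A =>
    (measurable_allocWeight A).mul hφ
  have hw : ∀ A : Fin T → Fin K, DependsOn
      (fun Y : Fin T → Fin K → ℝ => ENNReal.ofReal (∏ t, allocProb r Y t (A t)) * φ Y)
      (pilotStage K r T : Set (Fin T)) := by
    intro A Y Y' h
    simp only
    rw [hφS h, allocProb_congr (Y := Y) (Y' := Y') fun a t ht => by
      rw [h t (Finset.mem_coe.2 (pilotRounds_subset r a ht))]]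
  rw [lintegral_experimentLaw Q (measurable_of_slices fun A => hφ.mul (hψ A))]
  calc ∑ A : Fin T → Fin K, ∫⁻ Y, ENNReal.ofReal (∏ t, allocProb r Y t (A t)) * (φ Y * ψ A Y)
        ∂(Measure.pi fun _ : Fin T => Q)
      ≤ ∑ A : Fin T → Fin K, (∫⁻ Y, ENNReal.ofReal (∏ t, allocProb r Y t (A t)) * φ Y
        ∂(Measure.pi fun _ : Fin T => Q)) * C := by
        refine Finset.sum_le_sum fun A _ => ?_
        simp_rw [← mul_assoc]
        rw [lintegral_mul_of_dependsOn Q (pilotStage K r T) (hm A) (hψ A)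
          (hw A) (hψS A)]
        gcongr
        exact hC A
    _ = (∫⁻ Y, φ Y ∂(Measure.pi fun _ : Fin T => Q)) * C := by
        rw [← Finset.sum_mul, ← lintegral_finsetSum _ fun A _ => hm A]
        simp_rw [← Finset.sum_mul, sum_allocWeight, one_mul]

/-- An event which, for each allocation, depends on the second-stage outcomes only. -/
theorem experimentLaw_secondStage_le [Nonempty (Fin K)]
    {E : (Fin T → Fin K) → Set (Fin T → Fin K → ℝ)} {C : ℝ≥0∞} (hE : ∀ A, MeasurableSet (E A))
    (hES : ∀ A Y Y', (∀ t ∉ pilotStage K r T, Y t = Y' t) → (Y ∈ E A ↔ Y' ∈ E A))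
    (hC : ∀ A, (Measure.pi fun _ : Fin T => Q) (E A) ≤ C) :
    experimentLaw r T Q {z | z.1 ∈ E z.2} ≤ C := by
  classical
  have h := lintegral_experimentLaw_mul_le (r := r) (T := T) Q (φ := fun _ => 1)
    (ψ := fun A => (E A).indicator 1) (C := C) measurable_const
    (fun A => measurable_one.indicator (hE A)) (fun _ _ _ => rfl)
    (fun A Y Y' hYY' => by
      have := hES A Y Y' fun t ht => hYY' t (by simpa using ht)
      simp only [Set.indicator_apply, this, Pi.one_apply])
    (fun A => by rw [lintegral_indicator_one (hE A)]; exact hC A)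
  have hm : MeasurableSet {z : (Fin T → Fin K → ℝ) × (Fin T → Fin K) | z.1 ∈ E z.2} := by
    refine measurableSet_setOfPred.2
      (measurable_of_slices fun A => measurableSet_setOfPred.1 (hE A))
  rw [← lintegral_indicator_one hm]
  simp only [lintegral_const, measure_univ, one_mul] at h
  exact h

theorem lintegral_prod_rounds (s : Finset (Fin T)) {g : Fin T → (Fin K → ℝ) → ℝ≥0∞}
    (hg : ∀ t, Measurable (g t)) :
    ∫⁻ Y, ∏ t ∈ s, g t (Y t) ∂(Measure.pi fun _ : Fin T => Q) = ∏ t ∈ s, ∫⁻ y, g t y ∂Q := by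
  have hI := iIndepFun_pi (μ := fun _ : Fin T => Q) (X := g) fun t => (hg t).aemeasurable
  have h := lintegral_prod_eq_prod_lintegral_of_indepFun s
    (fun t (Y : Fin T → Fin K → ℝ) => g t (Y t)) hI fun t => (hg t).comp (measurable_pi_apply t)
  refine h.trans ?_
  refine Finset.prod_congr rfl fun t _ => ?_
  exact (measurePreserving_eval (fun _ : Fin T => Q) t).lintegral_comp (hg t)

/-- The product over the rounds of factors with integral at most one, evaluated at the observed
outcomes, has expectation at most one. -/
theorem lintegral_prod_observed_le_one [Nonempty (Fin K)] {g : Fin K → ℝ → ℝ≥0∞}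
    (hg : ∀ a, Measurable (g a)) (hle : ∀ a, ∫⁻ y, g a (y a) ∂Q ≤ 1) :
    ∫⁻ z, ∏ t, g (z.2 t) (z.1 t (z.2 t)) ∂(experimentLaw r T Q) ≤ 1 := by
  classical
  have hga : ∀ a, Measurable fun y : Fin K → ℝ => g a (y a) := fun a =>
    (hg a).comp (measurable_pi_apply a)
  set h : Fin T → (Fin K → ℝ) → ℝ≥0∞ := fun t y =>
    ∑ a, if t ∈ pilotRounds r T a then g a (y a) else 0 with hh
  have hhm : ∀ t, Measurable (h t) := fun t => Finset.measurable_fun_sum _ fun a _ => by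
    split_ifs
    · exact hga a
    · exact measurable_const
  have hh_eq : ∀ t a, t ∈ pilotRounds r T a → ∀ y, h t y = g a (y a) := fun t a ht y => by
    simp only [hh]
    rw [Finset.sum_eq_single a (fun b _ hb => if_neg fun hb' => hb (pilotRounds_unique hb' ht))
      (by simp), if_pos ht]
  have hφ1 : ∫⁻ Y, ∏ t ∈ pilotStage K r T, h t (Y t) ∂(Measure.pi fun _ : Fin T => Q) ≤ 1 := by
    rw [lintegral_prod_rounds Q _ hhm]
    refine Finset.prod_le_one' fun t ht => ?_
    obtain ⟨a, ha⟩ := exists_mem_pilotRounds ht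
    simp_rw [hh_eq t a ha]
    exact hle a
  have key := lintegral_experimentLaw_mul_le (r := r) (T := T) Q
    (φ := fun Y => ∏ t ∈ pilotStage K r T, h t (Y t))
    (ψ := fun A Y => ∏ t ∈ (pilotStage K r T)ᶜ, g (A t) (Y t (A t))) (C := 1)
    (Finset.measurable_fun_prod _ fun t _ => (hhm t).comp (measurable_pi_apply t))
    (fun A => Finset.measurable_fun_prod _ fun t _ => (hga _).comp (measurable_pi_apply t))
    (fun Y Y' hYY' => Finset.prod_congr rfl fun t ht => by rw [hYY' t ht])
    (fun A Y Y' hYY' => Finset.prod_congr rfl fun t ht => by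
      rw [hYY' t (by simpa using ht)])
    (fun A => by
      rw [lintegral_prod_rounds Q _ fun t => hga (A t)]
      exact Finset.prod_le_one' fun t _ => hle (A t))
  rw [mul_one] at key
  refine le_trans (le_of_eq (lintegral_congr_ae ?_)) (key.trans hφ1)
  filter_upwards [ae_alloc_pilot (r := r) (T := T) Q] with z hz
  rw [← Finset.prod_mul_prod_compl (pilotStage K r T)]
  congr 1
  refine Finset.prod_congr rfl fun t ht => ?_
  obtain ⟨a, ha⟩ := exists_mem_pilotRounds ht
  rw [hh_eq t a ha, hz a t ha]

end Law

/-! ### Deviation inequalities -/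

section Deviation

variable {K T : ℕ} {r : ℝ} (Q : Measure (Fin K → ℝ)) [IsProbabilityMeasure Q]

/-- Chebyshev's inequality for a sum of i.i.d. centred functions of the outcomes of arm `c`. -/
theorem pi_chebyshev (s : Finset (Fin T)) (c : Fin K) {g : ℝ → ℝ} (hg : Measurable g) {V u : ℝ}
    (hi : Integrable (fun y => g y ^ 2) (Q.map fun y => y c))
    (h0 : ∫ y, g y ∂(Q.map fun y => y c) = 0)
    (hV : ∫ y, g y ^ 2 ∂(Q.map fun y => y c) ≤ V) (hu : 0 < u) :
    (Measure.pi fun _ : Fin T => Q) {Y | u ≤ |∑ t ∈ s, g (Y t c)|} ≤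
      ENNReal.ofReal (s.card * V / u ^ 2) := by
  have hc : Measurable fun y : Fin K → ℝ => y c := measurable_pi_apply c
  have hgc : Measurable fun y : Fin K → ℝ => g (y c) := hg.comp hc
  have hmp : ∀ t : Fin T, MeasurePreserving (Function.eval t) (Measure.pi fun _ : Fin T => Q) Q :=
    fun t => measurePreserving_eval (fun _ : Fin T => Q) t
  have hL : MemLp (fun y : Fin K → ℝ => g (y c)) 2 Q := by
    rw [memLp_two_iff_integrable_sq hgc.aestronglyMeasurable]
    exact hi.comp_measurable hc
  have h0' : ∫ y, g (y c) ∂Q = 0 := by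
    rw [← h0, integral_map hc.aemeasurable hg.aestronglyMeasurable]
  have hV' : Var[fun y : Fin K → ℝ => g (y c); Q] ≤ V := by
    rw [variance_of_integral_eq_zero hgc.aemeasurable h0']
    rw [integral_map hc.aemeasurable (hg.pow_const 2).aestronglyMeasurable] at hV
    exact hV
  have hX : ∀ t : Fin T, MemLp (fun Y : Fin T → Fin K → ℝ => g (Y t c)) 2
      (Measure.pi fun _ : Fin T => Q) := fun t => hL.comp_measurePreserving (hmp t)
  have hI := iIndepFun_pi (μ := fun _ : Fin T => Q) (X := fun _ y => g (y c))
    fun t => hgc.aemeasurable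
  have hvar : Var[∑ t ∈ s, fun Y : Fin T → Fin K → ℝ => g (Y t c);
      Measure.pi fun _ : Fin T => Q] ≤ s.card * V := by
    rw [IndepFun.variance_sum (fun t _ => hX t) fun i _ j _ hij => hI.indepFun hij]
    calc ∑ t ∈ s, Var[fun Y : Fin T → Fin K → ℝ => g (Y t c); Measure.pi fun _ : Fin T => Q]
        ≤ ∑ t ∈ s, V := Finset.sum_le_sum fun t _ => by
          have := (hmp t).variance_fun_comp (f := fun y : Fin K → ℝ => g (y c)) hgc.aemeasurable
          exact this.le.trans hV'
      _ = s.card * V := by simp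
  have hmean : ∫ Y, (∑ t ∈ s, fun Y : Fin T → Fin K → ℝ => g (Y t c)) Y
      ∂(Measure.pi fun _ : Fin T => Q) = 0 := by
    simp only [Finset.sum_apply]
    rw [integral_finsetSum _ fun t _ => (hX t).integrable one_le_two]
    refine Finset.sum_eq_zero fun t _ => ?_
    have h := integral_map (μ := Measure.pi fun _ : Fin T => Q) (hmp t).measurable.aemeasurable
      (f := fun y : Fin K → ℝ => g (y c)) (by rw [(hmp t).map_eq]; exact hgc.aestronglyMeasurable)
    rw [(hmp t).map_eq, h0'] at h
    exact h.symm
  have key := meas_ge_le_variance_div_sq (memLp_finsetSum' s fun t _ => hX t) hu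
  rw [hmean] at key
  simp only [Finset.sum_apply, sub_zero] at key
  refine key.trans (ENNReal.ofReal_le_ofReal ?_)
  gcongr

/-- Chernoff's inequality for a sum of i.i.d. functions of the outcomes of arm `c`, with the Laplace
parameter absorbed into `g`. -/
theorem pi_chernoff (s : Finset (Fin T)) (c : Fin K) {g : ℝ → ℝ} (hg : Measurable g) {b u : ℝ}
    (hb : ∫⁻ y, ENNReal.ofReal (Real.exp (g y)) ∂(Q.map fun y => y c) ≤
      ENNReal.ofReal (Real.exp b)) :
    (Measure.pi fun _ : Fin T => Q) {Y | u ≤ ∑ t ∈ s, g (Y t c)} ≤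
      ENNReal.ofReal (Real.exp (s.card * b - u)) := by
  have hge : Measurable fun y : Fin K → ℝ => ENNReal.ofReal (Real.exp (g (y c))) :=
    (hg.comp (measurable_pi_apply c)).exp.ennreal_ofReal
  rw [lintegral_map hg.exp.ennreal_ofReal (measurable_pi_apply c)] at hb
  have hm : Measurable fun Y : Fin T → Fin K → ℝ =>
      ∏ t ∈ s, ENNReal.ofReal (Real.exp (g (Y t c))) :=
    Finset.measurable_fun_prod _ fun t _ => hge.comp (measurable_pi_apply t)
  have hmk := mul_meas_ge_le_lintegral (μ := Measure.pi fun _ : Fin T => Q) hm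
    (ENNReal.ofReal (Real.exp u))
  rw [lintegral_prod_rounds Q s (g := fun _ y => ENNReal.ofReal (Real.exp (g (y c))))
    fun _ => hge] at hmk
  have hset : {Y : Fin T → Fin K → ℝ | u ≤ ∑ t ∈ s, g (Y t c)} =
      {Y | ENNReal.ofReal (Real.exp u) ≤ ∏ t ∈ s, ENNReal.ofReal (Real.exp (g (Y t c)))} := by
    ext Y
    simp only [Set.mem_ofPred_eq]
    rw [← ENNReal.ofReal_prod_of_nonneg fun t _ => (Real.exp_pos _).le, ← Real.exp_sum,
      ENNReal.ofReal_le_ofReal_iff (Real.exp_pos _).le, Real.exp_le_exp]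
  rw [hset]
  have hpos : ENNReal.ofReal (Real.exp u) ≠ 0 := (ENNReal.ofReal_pos.2 (Real.exp_pos _)).ne'
  rw [← ENNReal.mul_le_mul_iff_right hpos ENNReal.ofReal_ne_top]
  refine hmk.trans ?_
  rw [Finset.prod_const, ← ENNReal.ofReal_mul (Real.exp_pos _).le, ← Real.exp_add,
    add_sub_cancel, Real.exp_nat_mul, ENNReal.ofReal_pow (Real.exp_pos _).le]
  gcongr

theorem pi_chernoff_abs (s : Finset (Fin T)) (c : Fin K) {x l M u : ℝ} {n : ℕ} (hn : s.card ≤ n)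
    (hM : 0 ≤ M)
    (h1 : ∫⁻ y, ENNReal.ofReal (Real.exp (l * (y - x))) ∂(Q.map fun y => y c) ≤
      ENNReal.ofReal (Real.exp (l ^ 2 * M / 2)))
    (h2 : ∫⁻ y, ENNReal.ofReal (Real.exp (-l * (y - x))) ∂(Q.map fun y => y c) ≤
      ENNReal.ofReal (Real.exp (l ^ 2 * M / 2))) (hl : 0 ≤ l) :
    (Measure.pi fun _ : Fin T => Q) {Y | u ≤ |∑ t ∈ s, (Y t c - x)|} ≤
      ENNReal.ofReal (2 * Real.exp (n * (l ^ 2 * M / 2) - l * u)) := by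
  have hsub : {Y : Fin T → Fin K → ℝ | u ≤ |∑ t ∈ s, (Y t c - x)|} ⊆
      {Y | l * u ≤ ∑ t ∈ s, l * (Y t c - x)} ∪ {Y | l * u ≤ ∑ t ∈ s, -l * (Y t c - x)} := by
    intro Y hY
    simp only [Set.mem_ofPred_eq, Set.mem_union, ← Finset.mul_sum] at hY ⊢
    rcases le_abs.1 hY with h | h
    · exact Or.inl (mul_le_mul_of_nonneg_left h hl)
    · exact Or.inr (by rw [neg_mul, ← mul_neg]; exact mul_le_mul_of_nonneg_left h hl)
  have hb : ENNReal.ofReal (Real.exp (s.card * (l ^ 2 * M / 2) - l * u)) ≤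
      ENNReal.ofReal (Real.exp (n * (l ^ 2 * M / 2) - l * u)) := by
    refine ENNReal.ofReal_le_ofReal (Real.exp_le_exp.2 ?_)
    have : (s.card : ℝ) ≤ n := by exact_mod_cast hn
    gcongr
  refine (measure_mono hsub).trans ((measure_union_le _ _).trans ?_)
  rw [two_mul, ENNReal.ofReal_add (Real.exp_pos _).le (Real.exp_pos _).le]
  exact add_le_add
    ((pi_chernoff Q s c (g := fun y => l * (y - x)) (by fun_prop) h1).trans hb)
    ((pi_chernoff Q s c (g := fun y => -l * (y - x)) (by fun_prop) h2).trans hb)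

/-- Number of rounds of the second stage. -/
noncomputable def secondStageSize (K : ℕ) (r : ℝ) (T : ℕ) : ℕ :=
  ((pilotStage K r T)ᶜ : Finset (Fin T)).card

/-- The rounds of the second stage which are allocated to arm `c`. -/
noncomputable def secondRounds (r : ℝ) (A : Fin T → Fin K) (c : Fin K) : Finset (Fin T) :=
  (pilotStage K r T)ᶜ.filter fun t => A t = c

/-- The centred Bernoulli variable is sub-Gaussian; the constant is not optimal. -/
theorem exp_bernoulli_le {q l : ℝ} (hq0 : 0 ≤ q) (hq1 : q ≤ 1) (hl : |l| ≤ 1) :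
    q * Real.exp (l * (1 - q)) + (1 - q) * Real.exp (-(l * q)) ≤ Real.exp (l ^ 2) := by
  have h : ∀ x : ℝ, |x| ≤ 1 → Real.exp x ≤ 1 + x + x ^ 2 := fun x hx => by
    have := (abs_le.1 (Real.abs_exp_sub_one_sub_id_le hx)).2
    linarith
  have h1 := h (l * (1 - q)) (by
    rw [abs_mul, abs_of_nonneg (by linarith : 0 ≤ 1 - q)]
    exact mul_le_one₀ hl (by linarith) (by linarith))
  have h2 := h (-(l * q)) (by
    rw [abs_neg, abs_mul, abs_of_nonneg hq0]; exact mul_le_one₀ hl hq0 hq1)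
  have h3 : q * Real.exp (l * (1 - q)) ≤ q * (1 + l * (1 - q) + (l * (1 - q)) ^ 2) :=
    mul_le_mul_of_nonneg_left h1 hq0
  have h4 : (1 - q) * Real.exp (-(l * q)) ≤ (1 - q) * (1 + -(l * q) + (-(l * q)) ^ 2) :=
    mul_le_mul_of_nonneg_left h2 (by linarith)
  have h5 : l ^ 2 + 1 ≤ Real.exp (l ^ 2) := Real.add_one_le_exp _
  have h6 : 0 ≤ q * (1 - q) := mul_nonneg hq0 (by linarith)
  have h7 : q * (1 - q) ≤ 1 := by nlinarith
  have h8 : q * (1 - q) * l ^ 2 ≤ l ^ 2 := mul_le_of_le_one_left (sq_nonneg l) h7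
  nlinarith

/-- Chernoff bound for the number of second-stage rounds of an arm, one tail. -/
theorem experimentLaw_count_chernoff [Nonempty (Fin K)] (c : Fin K) {l u : ℝ} (hl : |l| ≤ 1) :
    experimentLaw r T Q {z | u ≤ l * (((secondRounds r z.2 c).card : ℝ)
      - secondStageSize K r T * secondStageProb r z.1 c)} ≤
      ENNReal.ofReal (Real.exp (T * l ^ 2 - u)) := by
  classical
  set N : (Fin T → Fin K → ℝ) → (Fin T → Fin K) → ℝ := fun Y A =>
    l * (((secondRounds r A c).card : ℝ) - secondStageSize K r T * secondStageProb r Y c) with hN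
  have hNm : Measurable fun z : (Fin T → Fin K → ℝ) × (Fin T → Fin K) => N z.1 z.2 :=
    measurable_of_slices fun A => by
      simp only [hN]
      exact (((measurable_secondStageProb c).const_mul _).const_sub _).const_mul _
  have hpt : ∀ Y : Fin T → Fin K → ℝ, ∑ A : Fin T → Fin K,
      (∏ t, allocProb r Y t (A t)) * Real.exp (N Y A) ≤ Real.exp (T * l ^ 2) := by
    intro Y
    set q := secondStageProb r Y c with hq
    have hq0 : 0 ≤ q := secondStageProb_nonneg Y c
    have hq1 : q ≤ 1 := by
      rw [← sum_secondStageProb (r := r) Y]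
      exact Finset.single_le_sum (fun a _ => secondStageProb_nonneg Y a) (Finset.mem_univ c)
    have e : ∀ A : Fin T → Fin K, (∏ t, allocProb r Y t (A t)) * Real.exp (N Y A) =
        ∏ t, allocProb r Y t (A t) * (if t ∈ pilotStage K r T then 1 else
          Real.exp (l * ((if A t = c then 1 else 0) - q))) := by
      intro A
      rw [Finset.prod_mul_distrib]
      congr 1
      rw [Finset.prod_ite, Finset.prod_const_one, one_mul, ← Real.exp_sum]
      congr 1
      have hf : (Finset.univ.filter fun t => t ∉ pilotStage K r T) = (pilotStage K r T)ᶜ := by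
        ext t; simp
      rw [hf, ← Finset.mul_sum, Finset.sum_sub_distrib, Finset.sum_const, nsmul_eq_mul,
        Finset.sum_boole]
      rfl
    simp_rw [e]
    have hps := Finset.prod_univ_sum (fun _ : Fin T => (Finset.univ : Finset (Fin K)))
      (fun t a => allocProb r Y t a * (if t ∈ pilotStage K r T then 1 else
          Real.exp (l * ((if a = c then 1 else 0) - q))))
    rw [Fintype.piFinset_univ] at hps
    rw [← hps]
    calc ∏ t, ∑ a, allocProb r Y t a * (if t ∈ pilotStage K r T then 1 else
          Real.exp (l * ((if a = c then 1 else 0) - q)))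
        ≤ ∏ _t : Fin T, Real.exp (l ^ 2) := by
          refine Finset.prod_le_prod (fun t _ => Finset.sum_nonneg fun a _ =>
            mul_nonneg (allocProb_nonneg Y t a) (by split_ifs <;> positivity)) fun t _ => ?_
          by_cases ht : t ∈ pilotStage K r T
          · simp only [if_pos ht, mul_one, sum_allocProb]
            exact Real.one_le_exp (sq_nonneg l)
          · simp only [if_neg ht]
            have ha : ∀ a, allocProb r Y t a = secondStageProb r Y a := fun a =>
              if_neg fun h => ht (mem_pilotStage.2 h)
            simp_rw [ha]
            rw [← Finset.add_sum_erase _ _ (Finset.mem_univ c)]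
            have hs : ∑ a ∈ Finset.univ.erase c, secondStageProb r Y a *
                Real.exp (l * ((if a = c then 1 else 0) - q)) = (1 - q) * Real.exp (-(l * q)) := by
              have h1 : ∑ a ∈ Finset.univ.erase c, secondStageProb r Y a = 1 - q := by
                rw [← sum_secondStageProb (r := r) Y,
                  ← Finset.add_sum_erase _ _ (Finset.mem_univ c)]
                ring
              rw [← h1, Finset.sum_mul]
              refine Finset.sum_congr rfl fun a ha' => ?_
              rw [if_neg (Finset.ne_of_mem_erase ha')]
              congr 2; ring
            rw [hs, if_pos rfl]
            exact exp_bernoulli_le hq0 hq1 hl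
      _ = Real.exp (T * l ^ 2) := by
          rw [Finset.prod_const, Finset.card_univ, Fintype.card_fin, Real.exp_nat_mul]
  have hm : Measurable fun z : (Fin T → Fin K → ℝ) × (Fin T → Fin K) =>
      ENNReal.ofReal (Real.exp (N z.1 z.2)) := hNm.exp.ennreal_ofReal
  have hint : ∫⁻ z, ENNReal.ofReal (Real.exp (N z.1 z.2)) ∂(experimentLaw r T Q) ≤
      ENNReal.ofReal (Real.exp (T * l ^ 2)) := by
    rw [lintegral_experimentLaw' Q hm]
    calc _ ≤ ∫⁻ _Y, ENNReal.ofReal (Real.exp (T * l ^ 2)) ∂(Measure.pi fun _ : Fin T => Q) := by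
          refine lintegral_mono fun Y => ?_
          refine le_trans (le_of_eq ?_) (ENNReal.ofReal_le_ofReal (hpt Y))
          rw [ENNReal.ofReal_sum_of_nonneg fun A _ => mul_nonneg
            (Finset.prod_nonneg fun t _ => allocProb_nonneg Y t (A t)) (Real.exp_pos _).le]
          refine Finset.sum_congr rfl fun A _ => ?_
          rw [ENNReal.ofReal_mul (Finset.prod_nonneg fun t _ => allocProb_nonneg Y t (A t))]
      _ = _ := by simp
  have hmk := mul_meas_ge_le_lintegral (μ := experimentLaw r T Q) hm (ENNReal.ofReal (Real.exp u))
  have hset : {z : (Fin T → Fin K → ℝ) × (Fin T → Fin K) | u ≤ N z.1 z.2} =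
      {z | ENNReal.ofReal (Real.exp u) ≤ ENNReal.ofReal (Real.exp (N z.1 z.2))} := by
    ext z
    simp only [Set.mem_ofPred_eq]
    rw [ENNReal.ofReal_le_ofReal_iff (Real.exp_pos _).le, Real.exp_le_exp]
  change experimentLaw r T Q {z | u ≤ N z.1 z.2} ≤ _
  rw [hset]
  have hpos : ENNReal.ofReal (Real.exp u) ≠ 0 := (ENNReal.ofReal_pos.2 (Real.exp_pos _)).ne'
  rw [← ENNReal.mul_le_mul_iff_right hpos ENNReal.ofReal_ne_top]
  refine (hmk.trans hint).trans (le_of_eq ?_)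
  rw [← ENNReal.ofReal_mul (Real.exp_pos _).le, ← Real.exp_add, add_sub_cancel]

theorem experimentLaw_count_abs [Nonempty (Fin K)] (c : Fin K) {l u : ℝ} (hl0 : 0 ≤ l)
    (hl : l ≤ 1) :
    experimentLaw r T Q {z | u ≤ |((secondRounds r z.2 c).card : ℝ)
      - secondStageSize K r T * secondStageProb r z.1 c|} ≤
      ENNReal.ofReal (2 * Real.exp (T * l ^ 2 - l * u)) := by
  have hl' : |l| ≤ 1 := by rwa [abs_of_nonneg hl0]
  have h1 := experimentLaw_count_chernoff (r := r) (T := T) Q c (u := l * u) hl'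
  have h2 := experimentLaw_count_chernoff (r := r) (T := T) Q c (l := -l) (u := l * u)
    (by rwa [abs_neg])
  rw [neg_sq] at h2
  rw [two_mul, ENNReal.ofReal_add (Real.exp_pos _).le (Real.exp_pos _).le]
  refine (measure_mono fun z hz => ?_).trans ((measure_union_le _ _).trans (add_le_add h1 h2))
  simp only [Set.mem_ofPred_eq, Set.mem_union] at hz ⊢
  rcases le_abs.1 hz with h | h
  · exact Or.inl (mul_le_mul_of_nonneg_left h hl0)
  · exact Or.inr (by rw [neg_mul, ← mul_neg]; exact mul_le_mul_of_nonneg_left h hl0)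

end Deviation

/-! ### The regret as a function of the parameter -/

section Regret

variable {K T : ℕ} {r : ℝ} [Nonempty (Fin K)]

theorem measurableSet_recommend (c : Fin K) :
    MeasurableSet {z : (Fin T → Fin K → ℝ) × (Fin T → Fin K) | recommend r z.1 z.2 = c} :=
  (measurable_of_slices (F := fun z => recommend r z.1 z.2)
    fun A => measurable_recommend A) (measurableSet_singleton c)

/-- The expected regret is the sum over the arms of the gap times the probability of being
recommended. -/
theorem regret_eq_sum (Q : Measure (Fin K → ℝ)) [IsProbabilityMeasure Q] (μ : Fin K → ℝ) :
    regret r T Q μ = ∑ c, (μ (argmax μ) - μ c) *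
      (experimentLaw r T Q {z | recommend r z.1 z.2 = c}).toReal := by
  classical
  have hm : ∀ c, ∀ A : Fin T → Fin K, Measurable fun Y : Fin T → Fin K → ℝ =>
      (∏ t, allocProb r Y t (A t)) * if recommend r Y A = c then 1 else 0 := fun c A =>
    (Finset.measurable_fun_prod _ fun t _ => measurable_allocProb t (A t)).mul
      (Measurable.ite (measurable_recommend A (measurableSet_singleton c)) measurable_const
        measurable_const)
  have hnn : ∀ c, ∀ A : Fin T → Fin K, ∀ Y : Fin T → Fin K → ℝ,
      0 ≤ (∏ t, allocProb r Y t (A t)) * if recommend r Y A = c then (1 : ℝ) else 0 :=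
    fun c A Y => mul_nonneg (Finset.prod_nonneg fun t _ => allocProb_nonneg Y t (A t))
      (by split_ifs <;> norm_num)
  have hle : ∀ c, ∀ Y : Fin T → Fin K → ℝ, ∑ A : Fin T → Fin K,
      (∏ t, allocProb r Y t (A t)) * (if recommend r Y A = c then (1 : ℝ) else 0) ≤ 1 := by
    intro c Y
    refine le_trans ?_ (sum_prod_allocProb (r := r) Y).le
    refine Finset.sum_le_sum fun A _ => mul_le_of_le_one_right
      (Finset.prod_nonneg fun t _ => allocProb_nonneg Y t (A t)) (by split_ifs <;> norm_num)
  have hint : ∀ c, Integrable (fun Y : Fin T → Fin K → ℝ => ∑ A : Fin T → Fin K,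
      (∏ t, allocProb r Y t (A t)) * (if recommend r Y A = c then (1 : ℝ) else 0))
      (Measure.pi fun _ : Fin T => Q) := fun c =>
    (integrable_const (1 : ℝ)).mono'
      (Finset.measurable_fun_sum _ fun A _ => hm c A).aestronglyMeasurable
      (ae_of_all _ fun Y => by
        rw [Real.norm_of_nonneg (Finset.sum_nonneg fun A _ => hnn c A Y)]
        exact hle c Y)
  have e : ∀ Y : Fin T → Fin K → ℝ, ∑ A : Fin T → Fin K,
      (∏ t, allocProb r Y t (A t)) * (μ (argmax μ) - μ (recommend r Y A)) =
      ∑ c, (μ (argmax μ) - μ c) * ∑ A : Fin T → Fin K,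
        (∏ t, allocProb r Y t (A t)) * (if recommend r Y A = c then (1 : ℝ) else 0) := by
    intro Y
    simp_rw [Finset.mul_sum]
    rw [Finset.sum_comm]
    refine Finset.sum_congr rfl fun A _ => ?_
    rw [Finset.sum_eq_single (recommend r Y A) (fun c _ hc => by rw [if_neg (Ne.symm hc)]; ring)
      (by simp), if_pos rfl]
    ring
  unfold regret
  simp_rw [e]
  rw [integral_finsetSum _ fun c _ => (hint c).const_mul _]
  refine Finset.sum_congr rfl fun c _ => ?_
  rw [integral_const_mul]
  congr 1
  rw [integral_eq_lintegral_of_nonneg_ae (ae_of_all _ fun Y => Finset.sum_nonneg fun A _ =>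
    hnn c A Y) (hint c).aestronglyMeasurable]
  congr 1
  have hmi : Measurable fun z : (Fin T → Fin K → ℝ) × (Fin T → Fin K) =>
      {z : (Fin T → Fin K → ℝ) × (Fin T → Fin K) | recommend r z.1 z.2 = c}.indicator
        (1 : (Fin T → Fin K → ℝ) × (Fin T → Fin K) → ℝ≥0∞) z :=
      measurable_one.indicator (measurableSet_recommend c)
  rw [← lintegral_indicator_one (measurableSet_recommend c), lintegral_experimentLaw' Q hmi]
  refine lintegral_congr fun Y => ?_
  rw [ENNReal.ofReal_sum_of_nonneg fun A _ => hnn c A Y]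
  refine Finset.sum_congr rfl fun A _ => ?_
  rw [ENNReal.ofReal_mul (Finset.prod_nonneg fun t _ => allocProb_nonneg Y t (A t))]
  congr 1
  simp only [Set.indicator_apply, Set.mem_ofPred_eq, Pi.one_apply]
  split_ifs <;> simp

theorem sum_recommend (Q : Measure (Fin K → ℝ)) [IsProbabilityMeasure Q] :
    ∑ c, (experimentLaw r T Q {z | recommend r z.1 z.2 = c}).toReal = 1 := by
  have h := sum_measureReal_preimage_singleton (μ := experimentLaw r T Q)
    (Finset.univ : Finset (Fin K))
    (f := fun z : (Fin T → Fin K → ℝ) × (Fin T → Fin K) => recommend r z.1 z.2)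
    (fun c _ => measurableSet_recommend c)
  exact h.trans (by simp)

/-- The recommendation probabilities depend on the joint law of the outcomes through its marginals
only, because a single arm is observed in each round; hence they are measurable in the
parameter. -/
theorem exists_measurable_recommendProb (r : ℝ) (T : ℕ) {θ₁ θ₂ S : ℝ} (hθ : θ₁ ≤ θ₂)
    {v : Fin K → ℝ → ℝ} {P : Fin K → ℝ → Measure ℝ}
    (hP : ∀ a, HasGaussianMGF θ₁ θ₂ S (v a) (P a)) (c : Fin K) :
    ∃ R : (Fin K → ℝ) → ℝ≥0∞, Measurable R ∧ ∀ (μ : Fin K → ℝ) (Q : Measure (Fin K → ℝ)),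
      IsProbabilityMeasure Q → (∀ a, μ a ∈ Set.Icc θ₁ θ₂) →
      (∀ a, Q.map (fun y => y a) = P a (μ a)) →
      experimentLaw r T Q {z | recommend r z.1 z.2 = c} = R μ := by
  classical
  set cl : ℝ → ℝ := fun s => max θ₁ (min θ₂ s) with hcl
  have hclm : ∀ s, cl s ∈ Set.Icc θ₁ θ₂ := fun s =>
    ⟨le_max_left _ _, max_le hθ (min_le_left _ _)⟩
  have hcls : ∀ s ∈ Set.Icc θ₁ θ₂, cl s = s := fun s hs => by
    simp [hcl, hs.1, hs.2]
  set G : (Fin T → Fin K) → (Fin T → Fin K → ℝ) → ℝ≥0∞ := fun A Y =>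
    ENNReal.ofReal (∏ t, allocProb r Y t (A t)) * if recommend r Y A = c then 1 else 0 with hG
  have hGm : ∀ A, Measurable (G A) := fun A => (measurable_allocWeight A).mul
    (Measurable.ite (measurable_recommend A (measurableSet_singleton c)) measurable_const
      measurable_const)
  have hcopy : Measurable fun (z : Fin T → ℝ) (t : Fin T) (_ : Fin K) => z t := by fun_prop
  set M : (Fin T → Fin K) → (Fin K → ℝ) → Measure (Fin T → ℝ) := fun A μ =>
    Measure.pi fun t => P (A t) (cl (μ (A t))) with hM
  have hprob : ∀ a s, IsProbabilityMeasure (P a (cl s)) := fun a s => (hP a).isProb _ (hclm s)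
  have hMm : ∀ A, Measurable (M A) := by
    intro A
    have : ∀ μ, IsProbabilityMeasure (M A μ) := fun μ => by
      have := fun t => hprob (A t) (μ (A t))
      simp only [hM]; infer_instance
    refine Measurable.measure_of_isPiSystem_of_isProbabilityMeasure generateFrom_pi.symm
      isPiSystem_pi ?_
    rintro _ ⟨s, hs, rfl⟩
    have h1 : ∀ μ, M A μ (Set.univ.pi s) = ∏ t, P (A t) (cl (μ (A t))) (s t) := fun μ => by
      have := fun t => hprob (A t) (μ (A t))
      simp only [hM]
      rw [Measure.pi_pi]
    simp_rw [h1]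
    refine Finset.measurable_fun_prod _ fun t _ => ?_
    have h2 : Measurable fun μ : Fin K → ℝ => P (A t) (cl (μ (A t))) :=
      (hP (A t)).measurable.comp (measurable_pi_apply (A t))
    have hst : MeasurableSet (s t) := hs t (Set.mem_univ t)
    exact (Measure.measurable_coe hst).comp h2
  set consistent : (Fin T → Fin K) → Prop := fun A => ∀ a, ∀ t ∈ pilotRounds r T a, A t = a
  refine ⟨fun μ => ∑ A : Fin T → Fin K, if consistent A then
    ∫⁻ z, G A (fun t _ => z t) ∂(M A μ) else 0, ?_, ?_⟩
  · refine Finset.measurable_fun_sum _ fun A _ => ?_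
    split_ifs
    · exact (Measure.measurable_lintegral ((hGm A).comp hcopy)).comp (hMm A)
    · exact measurable_const
  · intro μ Q hQp hμ hQ
    have hmi : Measurable fun z : (Fin T → Fin K → ℝ) × (Fin T → Fin K) =>
        {z : (Fin T → Fin K → ℝ) × (Fin T → Fin K) | recommend r z.1 z.2 = c}.indicator
          (1 : (Fin T → Fin K → ℝ) × (Fin T → Fin K) → ℝ≥0∞) z :=
      measurable_one.indicator (measurableSet_recommend c)
    rw [← lintegral_indicator_one (measurableSet_recommend c), lintegral_experimentLaw Q hmi]
    refine Finset.sum_congr rfl fun A _ => ?_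
    have hGe : ∀ Y, ENNReal.ofReal (∏ t, allocProb r Y t (A t)) *
        {z : (Fin T → Fin K → ℝ) × (Fin T → Fin K) | recommend r z.1 z.2 = c}.indicator
          (1 : (Fin T → Fin K → ℝ) × (Fin T → Fin K) → ℝ≥0∞) (Y, A) = G A Y := fun Y => by
      simp only [hG, Set.indicator_apply, Set.mem_ofPred_eq, Pi.one_apply]
    simp_rw [hGe]
    split_ifs with hA
    · have hobs : ∀ Y, G A Y = G A fun t _ => Y t (A t) := by
        intro Y
        have h1 : ∀ a, ∀ t ∈ pilotRounds r T a, Y t a = (fun t _ => Y t (A t) :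
            Fin T → Fin K → ℝ) t a := fun a t ht => by simp only [hA a t ht]
        have h2 : finalMean Y A = finalMean (fun t _ => Y t (A t)) A := by
          funext a
          simp only [finalMean, sampleMean]
          congr 1
          refine Finset.sum_congr rfl fun t ht => ?_
          rw [(Finset.mem_filter.1 ht).2]
        simp only [hG]
        rw [allocProb_congr h1]
        unfold recommend
        rw [candidates_congr h1, pilotMean_congr h1, h2]
      have hmap : (Measure.pi fun _ : Fin T => Q).map (fun Y t => Y t (A t)) = M A μ := by
        simp only [hM]
        have e : ∀ t, P (A t) (cl (μ (A t))) = Q.map fun y => y (A t) := fun t => by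
          rw [hcls _ (hμ (A t)), hQ]
        simp_rw [e]
        have : ∀ t : Fin T, IsProbabilityMeasure (Q.map fun y : Fin K → ℝ => y (A t)) := fun t =>
          Measure.isProbabilityMeasure_map (measurable_pi_apply (A t)).aemeasurable
        exact Measure.pi_map_pi (f := fun t (y : Fin K → ℝ) => y (A t))
          fun t => (measurable_pi_apply (A t)).aemeasurable
      have hGA : Measurable fun z : Fin T → ℝ => G A fun t _ => z t := (hGm A).comp hcopy
      rw [← hmap, lintegral_map hGA
        (measurable_pi_lambda _ fun t => measurable_apply_apply t (A t))]
      exact lintegral_congr fun Y => hobs Y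
    · refine (lintegral_congr fun Y => ?_).trans lintegral_zero
      have h0 : ∏ t, allocProb r Y t (A t) = 0 := by
        by_contra hne
        exact hA fun a t ht => eq_of_prod_allocProb_ne_zero hne ht
      simp only [hG, h0, ENNReal.ofReal_zero, zero_mul]

end Regret

/-! ### Wrong recommendations force large deviations -/

section Deviations

variable {K T : ℕ} {r : ℝ}

/-- Sum of the centred outcomes of arm `c` in the pilot stage. -/
noncomputable def pilotDev (r : ℝ) (μ : Fin K → ℝ) (Y : Fin T → Fin K → ℝ) (c : Fin K) : ℝ :=
  ∑ t ∈ pilotRounds r T c, (Y t c - μ c)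

/-- Sum of the centred observed outcomes of arm `c` in the second stage. -/
noncomputable def secondDev (r : ℝ) (μ : Fin K → ℝ) (Y : Fin T → Fin K → ℝ) (A : Fin T → Fin K)
    (c : Fin K) : ℝ :=
  ∑ t ∈ secondRounds r A c, (Y t c - μ c)

/-- The rounds allocated to arm `c`. -/
def armRounds (A : Fin T → Fin K) (c : Fin K) : Finset (Fin T) :=
  Finset.univ.filter fun t => A t = c

variable {μ : Fin K → ℝ} {Y : Fin T → Fin K → ℝ} {A : Fin T → Fin K}

theorem armRounds_eq (hA : ∀ a, ∀ t ∈ pilotRounds r T a, A t = a) (c : Fin K) :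
    armRounds A c = pilotRounds r T c ∪ secondRounds r A c ∧
      Disjoint (pilotRounds r T c) (secondRounds r A c) := by
  constructor
  · ext t
    simp only [armRounds, secondRounds, Finset.mem_filter, Finset.mem_univ, true_and,
      Finset.mem_union, Finset.mem_compl]
    constructor
    · intro h
      by_cases ht : t ∈ pilotStage K r T
      · obtain ⟨a, ha⟩ := exists_mem_pilotRounds ht
        have := hA a t ha
        rw [← h, this]; exact Or.inl ha
      · exact Or.inr ⟨ht, h⟩
    · rintro (h | h)
      · exact hA c t h
      · exact h.2
  · rw [Finset.disjoint_left]
    intro t h1 h2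
    simp only [secondRounds, Finset.mem_filter, Finset.mem_compl] at h2
    exact h2.1 (pilotRounds_subset r c h1)

theorem card_armRounds (hr0 : 0 ≤ r) (hr1 : r ≤ 1)
    (hA : ∀ a, ∀ t ∈ pilotRounds r T a, A t = a) (c : Fin K) :
    (armRounds A c).card = pilotSize K r T + (secondRounds r A c).card := by
  obtain ⟨h1, h2⟩ := armRounds_eq hA c
  rw [h1, Finset.card_union_of_disjoint h2, card_pilotRounds hr0 hr1]

theorem sum_armRounds (hA : ∀ a, ∀ t ∈ pilotRounds r T a, A t = a) (c : Fin K) :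
    ∑ t ∈ armRounds A c, (Y t c - μ c) = pilotDev r μ Y c + secondDev r μ Y A c := by
  obtain ⟨h1, h2⟩ := armRounds_eq hA c
  rw [h1, Finset.sum_union h2]
  rfl

theorem sampleMean_eq {s : Finset (Fin T)} (hs : 0 < s.card) (c : Fin K) :
    sampleMean Y s c = μ c + (∑ t ∈ s, (Y t c - μ c)) / s.card := by
  have : (s.card : ℝ) ≠ 0 := by exact_mod_cast hs.ne'
  rw [sampleMean, Finset.sum_sub_distrib, Finset.sum_const, nsmul_eq_mul]
  field_simp
  ring

theorem pilotMean_eq (hr0 : 0 ≤ r) (hr1 : r ≤ 1) (hm : 0 < pilotSize K r T) (c : Fin K) :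
    pilotMean r Y c = μ c + pilotDev r μ Y c / pilotSize K r T := by
  have h := card_pilotRounds (T := T) hr0 hr1 c
  rw [pilotMean, sampleMean_eq (μ := μ) (by rw [h]; exact hm), h]
  rfl

theorem finalMean_eq (hr0 : 0 ≤ r) (hr1 : r ≤ 1) (hm : 0 < pilotSize K r T)
    (hA : ∀ a, ∀ t ∈ pilotRounds r T a, A t = a) (c : Fin K) :
    finalMean Y A c = μ c + (pilotDev r μ Y c + secondDev r μ Y A c) / (armRounds A c).card := by
  have h := card_armRounds hr0 hr1 hA c
  rw [← sum_armRounds hA, finalMean]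
  exact sampleMean_eq (s := armRounds A c) (by omega) c

theorem abs_div_lt_of_lt {D n m u : ℝ} (hm : 0 < m) (hn : m ≤ n) (hu : 0 ≤ u)
    (hD : |D| < m * u) : |D / n| < u := by
  have hn0 : 0 < n := hm.trans_le hn
  rw [abs_div, abs_of_pos hn0, div_lt_iff₀ hn0]
  calc |D| < m * u := hD
    _ ≤ n * u := by gcongr
    _ = u * n := mul_comm _ _

/-- If a worse arm `a` is recommended instead of `b`, then one of the four deviations of these arms
is at least a quarter of the gap per pilot round. -/
theorem exists_large_deviation [Nonempty (Fin K)] (hr0 : 0 ≤ r) (hr1 : r ≤ 1)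
    (hm : 0 < pilotSize K r T) (hA : ∀ a, ∀ t ∈ pilotRounds r T a, A t = a) {a b : Fin K} {u : ℝ}
    (hu : 0 < u) (hΔ : u ≤ μ b - μ a) (hrec : recommend r Y A = a) :
    (pilotSize K r T * (u / 4) ≤ |pilotDev r μ Y a| ∨
      pilotSize K r T * (u / 4) ≤ |secondDev r μ Y A a|) ∨
    (pilotSize K r T * (u / 4) ≤ |pilotDev r μ Y b| ∨
      pilotSize K r T * (u / 4) ≤ |secondDev r μ Y A b|) := by
  by_contra! hcon
  obtain ⟨⟨ha1, ha2⟩, hb1, hb2⟩ := hcon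
  have hm' : (0 : ℝ) < pilotSize K r T := by exact_mod_cast hm
  have hfin : ∀ c, |pilotDev r μ Y c| < pilotSize K r T * (u / 4) →
      |secondDev r μ Y A c| < pilotSize K r T * (u / 4) →
      |(pilotDev r μ Y c + secondDev r μ Y A c) / (armRounds A c).card| < u / 2 := by
    intro c h1 h2
    refine abs_div_lt_of_lt hm' ?_ (by linarith) ?_
    · rw [card_armRounds hr0 hr1 hA]
      push_cast
      linarith [Nat.cast_nonneg (α := ℝ) (secondRounds r A c).card]
    · calc _ ≤ |pilotDev r μ Y c| + |secondDev r μ Y A c| := abs_add_le _ _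
        _ < _ := by linarith
  have hpil : ∀ c, |pilotDev r μ Y c| < pilotSize K r T * (u / 4) →
      |pilotDev r μ Y c / pilotSize K r T| < u / 4 := fun c h =>
    abs_div_lt_of_lt hm' le_rfl (by linarith) h
  unfold recommend at hrec
  split_ifs at hrec with hc
  · have h := argmax_spec (pilotMean r Y) b
    rw [hrec, pilotMean_eq (μ := μ) hr0 hr1 hm, pilotMean_eq (μ := μ) hr0 hr1 hm] at h
    have h1 := abs_lt.1 (hpil a ha1)
    have h2 := abs_lt.1 (hpil b hb1)
    linarith [h1.2, h2.1]
  · have h := argmax_spec (finalMean Y A) b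
    rw [hrec, finalMean_eq (μ := μ) hr0 hr1 hm hA, finalMean_eq (μ := μ) hr0 hr1 hm hA] at h
    have h1 := abs_lt.1 (hfin a ha1 ha2)
    have h2 := abs_lt.1 (hfin b hb1 hb2)
    linarith [h1.2, h2.1]

theorem measurable_pilotDev (μ : Fin K → ℝ) (c : Fin K) :
    Measurable fun Y : Fin T → Fin K → ℝ => pilotDev r μ Y c :=
  Finset.measurable_fun_sum _ fun t _ => (measurable_apply_apply t c).sub_const _

theorem measurable_secondDev (μ : Fin K → ℝ) (A : Fin T → Fin K) (c : Fin K) :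
    Measurable fun Y : Fin T → Fin K → ℝ => secondDev r μ Y A c :=
  Finset.measurable_fun_sum _ fun t _ => (measurable_apply_apply t c).sub_const _

end Deviations

/-! ### Probabilities of large deviations -/

section Probability

variable {K T : ℕ} {r : ℝ} {Q : Measure (Fin K → ℝ)} {μ : Fin K → ℝ}

/-- The pilot rounds of an arm form a fixed set of rounds, so a bound that is uniform over sets of
rounds applies. -/
theorem experimentLaw_pilotDev_le [Nonempty (Fin K)] {c : Fin K} {u : ℝ} {C : ℝ≥0∞}
    (h : ∀ s : Finset (Fin T), s.card ≤ T → (Measure.pi fun _ : Fin T => Q)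
      {Y | u ≤ |∑ t ∈ s, (Y t c - μ c)|} ≤ C) :
    experimentLaw r T Q {z | u ≤ |pilotDev r μ z.1 c|} ≤ C := by
  have hm : MeasurableSet {Y : Fin T → Fin K → ℝ | u ≤ |pilotDev r μ Y c|} :=
    measurableSet_le measurable_const (measurable_pilotDev μ c).abs
  exact (experimentLaw_fst_mem Q hm).le.trans (h _ (card_finset_fin_le _))

variable [IsProbabilityMeasure Q]

/-- Given the allocation, the second-stage rounds of an arm form a fixed set of rounds, and the
allocation does not depend on the second-stage outcomes; hence a bound that is uniform over sets of
rounds applies. -/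
theorem experimentLaw_secondDev_le [Nonempty (Fin K)] {c : Fin K} {u : ℝ} {C : ℝ≥0∞}
    (h : ∀ s : Finset (Fin T), s.card ≤ T → (Measure.pi fun _ : Fin T => Q)
      {Y | u ≤ |∑ t ∈ s, (Y t c - μ c)|} ≤ C) :
    experimentLaw r T Q {z | u ≤ |secondDev r μ z.1 z.2 c|} ≤ C := by
  refine experimentLaw_secondStage_le (r := r) Q
    (E := fun A => {Y | u ≤ |secondDev r μ Y A c|})
    (fun A => measurableSet_le measurable_const (measurable_secondDev μ A c).abs)
    (fun A Y Y' hY => ?_) fun A => h _ (card_finset_fin_le _)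
  have : secondDev r μ Y A c = secondDev r μ Y' A c := by
    refine Finset.sum_congr rfl fun t ht => ?_
    simp only [secondRounds, Finset.mem_filter, Finset.mem_compl] at ht
    rw [hY t ht.1]
  simp only [Set.mem_ofPred_eq, this]

/-- A uniform bound for sums of centred outcomes of the arms `a` and `b` bounds the probability
that `a` is recommended. -/
theorem experimentLaw_recommend_le [Nonempty (Fin K)] (hr0 : 0 ≤ r) (hr1 : r ≤ 1)
    (hm : 0 < pilotSize K r T) {a b : Fin K} {u : ℝ} (hu : 0 < u) (hΔ : u ≤ μ b - μ a) {C : ℝ}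
    (hC : 0 ≤ C)
    (h : ∀ c, c = a ∨ c = b → ∀ s : Finset (Fin T), s.card ≤ T → (Measure.pi fun _ : Fin T => Q)
      {Y | pilotSize K r T * (u / 4) ≤ |∑ t ∈ s, (Y t c - μ c)|} ≤ ENNReal.ofReal C) :
    experimentLaw r T Q {z | recommend r z.1 z.2 = a} ≤ ENNReal.ofReal (4 * C) := by
  have hsub : ∀ᵐ z ∂(experimentLaw r T Q), recommend r z.1 z.2 = a →
      z ∈ ({z | pilotSize K r T * (u / 4) ≤ |pilotDev r μ z.1 a|} ∪
        {z | pilotSize K r T * (u / 4) ≤ |secondDev r μ z.1 z.2 a|}) ∪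
        ({z | pilotSize K r T * (u / 4) ≤ |pilotDev r μ z.1 b|} ∪
        {z | pilotSize K r T * (u / 4) ≤ |secondDev r μ z.1 z.2 b|}) := by
    filter_upwards [ae_alloc_pilot (r := r) (T := T) Q] with z hz hrec
    exact exists_large_deviation hr0 hr1 hm hz hu hΔ hrec
  refine (measure_mono_ae hsub).trans ?_
  have e : ENNReal.ofReal (4 * C) = (ENNReal.ofReal C + ENNReal.ofReal C) +
      (ENNReal.ofReal C + ENNReal.ofReal C) := by
    rw [← ENNReal.ofReal_add hC hC, ← ENNReal.ofReal_add (by linarith) (by linarith)]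
    congr 1; ring
  rw [e]
  refine (measure_union_le _ _).trans (add_le_add ((measure_union_le _ _).trans (add_le_add ?_ ?_))
    ((measure_union_le _ _).trans (add_le_add ?_ ?_)))
  · exact experimentLaw_pilotDev_le (h a (Or.inl rfl))
  · exact experimentLaw_secondDev_le (h a (Or.inl rfl))
  · exact experimentLaw_pilotDev_le (h b (Or.inr rfl))
  · exact experimentLaw_secondDev_le (h b (Or.inr rfl))

variable {θ₁ θ₂ S : ℝ} {v : Fin K → ℝ → ℝ} {P : Fin K → ℝ → Measure ℝ}

theorem HasGaussianMGF.integral_centred {θ₁ θ₂ S : ℝ} {v : ℝ → ℝ} {P : ℝ → Measure ℝ}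
    (hP : HasGaussianMGF θ₁ θ₂ S v P) {x : ℝ} (hx : x ∈ Set.Icc θ₁ θ₂) :
    ∫ y, (y - x) ∂(P x) = 0 ∧ Integrable (fun y => (y - x) ^ 2) (P x) := by
  have := hP.isProb x hx
  have hL : MemLp (fun y : ℝ => y) 2 (P x) := by
    rw [memLp_two_iff_integrable_sq measurable_id'.aestronglyMeasurable]
    exact hP.integrable_sq x hx
  refine ⟨?_, (hL.sub (memLp_const x)).integrable_sq⟩
  rw [integral_sub (hL.integrable one_le_two) (integrable_const x), hP.mean_eq x hx]
  simp

theorem pi_sum_chebyshev (hP : ∀ a, HasGaussianMGF θ₁ θ₂ S (v a) (P a))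
    (hvS : ∀ a, ∀ s ∈ Set.Icc θ₁ θ₂, v a s ≤ S) (hQ : ∀ a, Q.map (fun y => y a) = P a (μ a))
    {c : Fin K} (hμ : μ c ∈ Set.Icc θ₁ θ₂) (s : Finset (Fin T)) (hs : s.card ≤ T) {u : ℝ}
    (hu : 0 < u) (hS : 0 ≤ S) :
    (Measure.pi fun _ : Fin T => Q) {Y | u ≤ |∑ t ∈ s, (Y t c - μ c)|} ≤
      ENNReal.ofReal (T * S / u ^ 2) := by
  obtain ⟨h0, hi⟩ := (hP c).integral_centred hμ
  refine (pi_chebyshev Q s c (g := fun y => y - μ c) (by fun_prop) (V := S) ?_ ?_ ?_ hu).trans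
    (ENNReal.ofReal_le_ofReal ?_)
  · rw [hQ]; exact hi
  · rw [hQ]; exact h0
  · rw [hQ, (hP c).var_eq _ hμ]; exact hvS c _ hμ
  · gcongr

theorem pi_sum_chernoff (hP : ∀ a, HasGaussianMGF θ₁ θ₂ S (v a) (P a))
    (hQ : ∀ a, Q.map (fun y => y a) = P a (μ a)) {c : Fin K} {l M u : ℝ} (hl : 0 ≤ l) (hM : 0 ≤ M)
    (h1 : θ₁ ≤ μ c - S * l) (h2 : μ c + S * l ≤ θ₂)
    (hvM : ∀ s ∈ Set.Icc (μ c - S * l) (μ c + S * l), v c s ≤ M) {n : ℕ}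
    (s : Finset (Fin T)) (hs : s.card ≤ n) :
    (Measure.pi fun _ : Fin T => Q) {Y | u ≤ |∑ t ∈ s, (Y t c - μ c)|} ≤
      ENNReal.ofReal (2 * Real.exp (n * (l ^ 2 * M / 2) - l * u)) := by
  refine pi_chernoff_abs Q s c hs hM ?_ ?_ hl
  · rw [hQ]
    exact (hP c).lintegral_exp_le _ l M (by rwa [abs_of_nonneg hl]) (by rwa [abs_of_nonneg hl])
      (by rwa [abs_of_nonneg hl])
  · rw [hQ, ← neg_sq l]
    exact (hP c).lintegral_exp_le _ (-l) M (by rwa [abs_neg, abs_of_nonneg hl])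
      (by rwa [abs_neg, abs_of_nonneg hl]) (by rwa [abs_neg, abs_of_nonneg hl])

/-- Sub-Gaussian tail for sums of at most `T` outcomes, away from the endpoints; `m` stands for the
size of the pilot stage, which is of order `ρ T`. -/
theorem pi_sum_subgaussian (hP : ∀ a, HasGaussianMGF θ₁ θ₂ S (v a) (P a))
    (hvS : ∀ a, ∀ s ∈ Set.Icc θ₁ θ₂, v a s ≤ S) (hS : 0 < S)
    (hQ : ∀ a, Q.map (fun y => y a) = P a (μ a)) {c : Fin K} {ρ δ m : ℝ} (hρ : 0 < ρ) (hρ1 : ρ ≤ 1)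
    (hδ : 0 < δ) (hm : ρ * T / 2 ≤ m) (h1 : θ₁ + δ ≤ μ c) (h2 : μ c + δ ≤ θ₂)
    (s : Finset (Fin T)) (hs : s.card ≤ T) :
    (Measure.pi fun _ : Fin T => Q) {Y | m * (δ / 4) ≤ |∑ t ∈ s, (Y t c - μ c)|} ≤
      ENNReal.ofReal (2 * Real.exp (-(ρ ^ 2 * (T * δ ^ 2) / (128 * S)))) := by
  set l : ℝ := ρ * δ / (8 * S) with hl
  have hSl : S * l = ρ * δ / 8 := by rw [hl]; field_simp
  have hle : S * l ≤ δ := by rw [hSl]; nlinarith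
  have hl0 : 0 ≤ l := by positivity
  refine (pi_sum_chernoff hP hQ hl0 hS.le (by linarith) (by linarith)
    (fun s hs => hvS c s ⟨by linarith [hs.1], by linarith [hs.2]⟩) s hs).trans
    (ENNReal.ofReal_le_ofReal ?_)
  gcongr
  have h3 : l * (ρ * T / 2 * (δ / 4)) ≤ l * (m * (δ / 4)) := by gcongr
  have h4 : T * (l ^ 2 * S / 2) - l * (ρ * T / 2 * (δ / 4)) =
      -(ρ ^ 2 * (T * δ ^ 2) / (128 * S)) := by
    rw [hl]; field_simp; ring
  linarith

theorem half_le_pilotSize (hK : 0 < K) (hr0 : 0 < r) (hT : 2 ≤ r / K * T) :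
    r / K * T / 2 ≤ pilotSize K r T ∧ |(pilotSize K r T : ℝ) - r / K * T| ≤ 1 := by
  have e : r * T / K = r / K * T := by ring
  have h1 : r / K * T < pilotSize K r T + 1 := by
    rw [← e]; exact Nat.lt_floor_add_one _
  have h2 : (pilotSize K r T : ℝ) ≤ r / K * T := by
    rw [← e]; exact Nat.floor_le (by positivity)
  exact ⟨by linarith, abs_le.2 ⟨by linarith, by linarith⟩⟩

/-- The recommendation of a worse arm, without restriction on the parameter. -/
theorem recommend_le_chebyshev [Nonempty (Fin K)] (hP : ∀ a, HasGaussianMGF θ₁ θ₂ S (v a) (P a))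
    (hvS : ∀ a, ∀ s ∈ Set.Icc θ₁ θ₂, v a s ≤ S) (hS : 0 < S)
    (hQ : ∀ a, Q.map (fun y => y a) = P a (μ a)) (hμ : ∀ a, μ a ∈ Set.Icc θ₁ θ₂) (hK : 0 < K)
    (hr0 : 0 < r) (hr1 : r ≤ 1) (hT : 2 ≤ r / K * T) {a b : Fin K} (hab : μ a < μ b) :
    experimentLaw r T Q {z | recommend r z.1 z.2 = a} ≤
      ENNReal.ofReal (256 * S / (r / K) ^ 2 / (T * (μ b - μ a) ^ 2)) := by
  have hK' : (0 : ℝ) < K := by exact_mod_cast hK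
  have hρ : 0 < r / K := by positivity
  obtain ⟨hm, -⟩ := half_le_pilotSize hK hr0 hT
  have hm1 : (1 : ℝ) ≤ pilotSize K r T := by linarith
  have hm0 : 0 < pilotSize K r T := by
    by_contra h
    have : pilotSize K r T = 0 := by omega
    rw [this] at hm1; norm_num at hm1
  have hΔ : 0 < μ b - μ a := sub_pos.2 hab
  have hT0 : (0 : ℝ) < T := by
    by_contra h
    have : r / K * T ≤ 0 := mul_nonpos_of_nonneg_of_nonpos hρ.le (not_lt.1 h)
    linarith
  refine (experimentLaw_recommend_le (μ := μ) hr0.le hr1 hm0 hΔ le_rfl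
    (C := 64 * S / (r / K) ^ 2 / (T * (μ b - μ a) ^ 2)) (by positivity) ?_).trans
    (ENNReal.ofReal_le_ofReal (le_of_eq (by ring)))
  intro c _ s hs
  refine (pi_sum_chebyshev hP hvS hQ (hμ c) s hs (by positivity) hS.le).trans
    (ENNReal.ofReal_le_ofReal ?_)
  calc T * S / (pilotSize K r T * ((μ b - μ a) / 4)) ^ 2
      ≤ T * S / (r / K * T / 2 * ((μ b - μ a) / 4)) ^ 2 := by gcongr
    _ = 64 * S / (r / K) ^ 2 / (T * (μ b - μ a) ^ 2) := by field_simp; ring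

/-- The recommendation of an arm worse by `δ`, for parameters away from the endpoints. -/
theorem recommend_le_subgaussian [Nonempty (Fin K)] (hP : ∀ a, HasGaussianMGF θ₁ θ₂ S (v a) (P a))
    (hvS : ∀ a, ∀ s ∈ Set.Icc θ₁ θ₂, v a s ≤ S) (hS : 0 < S)
    (hQ : ∀ a, Q.map (fun y => y a) = P a (μ a)) (hK : 0 < K)
    (hr0 : 0 < r) (hr1 : r ≤ 1) (hT : 2 ≤ r / K * T) {a b : Fin K} {δ : ℝ} (hδ : 0 < δ)
    (hab : δ ≤ μ b - μ a) (hc : ∀ c, c = a ∨ c = b → θ₁ + δ ≤ μ c ∧ μ c + δ ≤ θ₂) :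
    experimentLaw r T Q {z | recommend r z.1 z.2 = a} ≤
      ENNReal.ofReal (8 * Real.exp (-((r / K) ^ 2 * (T * δ ^ 2) / (128 * S)))) := by
  have hK' : (1 : ℝ) ≤ K := by exact_mod_cast hK
  have hρ : 0 < r / K := by positivity
  have hρ1 : r / K ≤ 1 := by rw [div_le_one (by positivity)]; linarith
  obtain ⟨hm, -⟩ := half_le_pilotSize hK hr0 hT
  have hm1 : (1 : ℝ) ≤ pilotSize K r T := by linarith
  have hm0 : 0 < pilotSize K r T := by
    by_contra h
    have : pilotSize K r T = 0 := by omega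
    rw [this] at hm1; norm_num at hm1
  refine (experimentLaw_recommend_le (μ := μ) hr0.le hr1 hm0 hδ hab
    (C := 2 * Real.exp (-((r / K) ^ 2 * (T * δ ^ 2) / (128 * S)))) (by positivity) ?_).trans
    (ENNReal.ofReal_le_ofReal (le_of_eq (by ring)))
  intro c hc' s hs
  exact pi_sum_subgaussian hP hvS hS hQ hρ hρ1 hδ hm (hc c hc').1 (hc c hc').2 s hs

end Probability

/-! ### The allocation between two candidates -/

theorem abs_div_add_sub_div_add_le {p q p' q' e l : ℝ} (hp' : 0 ≤ p') (hq' : 0 ≤ q')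
    (hs' : 0 < p' + q') (hl : 0 < l) (hs : l ≤ p + q) (hp : |p - p'| ≤ e) (hq : |q - q'| ≤ e) :
    |p / (p + q) - p' / (p' + q')| ≤ e / l := by
  have hs0 : 0 < p + q := hl.trans_le hs
  have he : 0 ≤ e := (abs_nonneg _).trans hp
  have h1 : p / (p + q) - p' / (p' + q') =
      ((p - p') * q' - p' * (q - q')) / ((p + q) * (p' + q')) := by
    field_simp; ring
  have h2 : |(p - p') * q' - p' * (q - q')| ≤ e * (p' + q') := by
    calc _ ≤ |(p - p') * q'| + |p' * (q - q')| := abs_sub _ _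
      _ = |p - p'| * q' + p' * |q - q'| := by rw [abs_mul, abs_mul, abs_of_nonneg hp',
          abs_of_nonneg hq']
      _ ≤ e * q' + p' * e := by gcongr
      _ = _ := by ring
  rw [h1, abs_div, abs_of_pos (by positivity : 0 < (p + q) * (p' + q')), div_le_div_iff₀
    (by positivity) hl]
  calc _ ≤ (e * (p' + q')) * (p + q) := by gcongr
    _ = _ := by ring

/-- The share of the second stage that an arm of ideal ratio `w` receives when it has one competitor
and every arm has already received the fraction `ρ` of the budget. -/
noncomputable def share (ρ w : ℝ) : ℝ :=
  max (w - ρ) 0 / (max (w - ρ) 0 + max (1 - w - ρ) 0)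

theorem share_denom_ge (ρ w : ℝ) : 1 - 2 * ρ ≤ max (w - ρ) 0 + max (1 - w - ρ) 0 := by
  linarith [le_max_left (w - ρ) 0, le_max_left (1 - w - ρ) 0]

theorem share_nonneg (ρ w : ℝ) : 0 ≤ share ρ w :=
  div_nonneg (le_max_right _ _) (add_nonneg (le_max_right _ _) (le_max_right _ _))

theorem share_add_share {ρ : ℝ} (hρ : 2 * ρ < 1) (w : ℝ) : share ρ w + share ρ (1 - w) = 1 := by
  have h := share_denom_ge ρ w
  have h0 : 0 < max (w - ρ) 0 + max (1 - w - ρ) 0 := by linarith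
  rw [share, share, sub_sub_cancel, add_comm (max (1 - w - ρ) 0), ← add_div, div_self h0.ne']

theorem share_le_one {ρ : ℝ} (hρ : 2 * ρ < 1) (w : ℝ) : share ρ w ≤ 1 := by
  linarith [share_add_share hρ w, share_nonneg ρ (1 - w)]

/-- The share is Lipschitz in the ideal ratio, because its denominator is at least `1 - 2 ρ`. -/
theorem abs_share_sub_le {ρ : ℝ} (hρ : 2 * ρ < 1) (w w' : ℝ) :
    |share ρ w - share ρ w'| ≤ |w - w'| / (1 - 2 * ρ) := by
  refine abs_div_add_sub_div_add_le (le_max_right _ _) (le_max_right _ _) ?_ (by linarith)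
    (share_denom_ge ρ w) ?_ ?_
  · linarith [share_denom_ge ρ w']
  · refine (abs_max_sub_max_le_abs _ _ _).trans (le_of_eq ?_)
    congr 1; ring
  · refine (abs_max_sub_max_le_abs _ _ _).trans (le_of_eq ?_)
    rw [show 1 - w - ρ - (1 - w' - ρ) = -(w - w') by ring, abs_neg]

/-- The limiting fraction of the whole budget that goes to a candidate of ideal ratio `w` when there
are two candidates. -/
noncomputable def fraction (K : ℕ) (ρ w : ℝ) : ℝ := ρ + (1 - K * ρ) * share ρ w

theorem le_fraction {K : ℕ} {ρ : ℝ} (hKρ : K * ρ ≤ 1) (w : ℝ) : ρ ≤ fraction K ρ w := by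
  have := mul_nonneg (by linarith : 0 ≤ 1 - K * ρ) (share_nonneg ρ w)
  rw [fraction]; linarith

theorem fraction_add_fraction {K : ℕ} {ρ : ℝ} (hρ : 2 * ρ < 1) (w : ℝ) :
    fraction K ρ w + fraction K ρ (1 - w) = 1 - (K - 2) * ρ := by
  have := share_add_share hρ w
  rw [fraction, fraction, show share ρ (1 - w) = 1 - share ρ w by linarith]; ring

/-- For the arm with the larger standard deviation, the actual fraction lies between that of the
uniform allocation and that of the ideal one. -/
theorem fraction_bounds {K : ℕ} {ρ w : ℝ} (hK : 2 ≤ K) (hρ0 : 0 ≤ ρ) (hρ : 2 * ρ < 1)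
    (hKρ : K * ρ ≤ 1) (hw : 1 / 2 ≤ w) (hw1 : w ≤ 1) :
    (1 - (K - 2) * ρ) / 2 ≤ fraction K ρ w ∧ fraction K ρ w ≤ (1 - (K - 2) * ρ) * w := by
  have hK' : (2 : ℝ) ≤ K := by exact_mod_cast hK
  have h1 : max (w - ρ) 0 = w - ρ := max_eq_left (by linarith)
  rw [fraction, share, h1]
  rcases le_total 0 (1 - w - ρ) with h | h
  · rw [max_eq_left h, show w - ρ + (1 - w - ρ) = 1 - 2 * ρ by ring]
    have h2 : 0 < 1 - 2 * ρ := by linarith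
    have hne : 1 - 2 * ρ ≠ 0 := h2.ne'
    have h3 : (1 - K * ρ) / (1 - 2 * ρ) ≤ 1 := by rw [div_le_one h2]; nlinarith
    have h4 : 0 ≤ (1 - K * ρ) / (1 - 2 * ρ) := div_nonneg (by linarith) h2.le
    have e : (1 - K * ρ) * ((w - ρ) / (1 - 2 * ρ)) =
        (1 - K * ρ) / 2 + (1 - K * ρ) / (1 - 2 * ρ) * (w - 1 / 2) := by
      rw [show (w - ρ) / (1 - 2 * ρ) = 1 / 2 + (w - 1 / 2) / (1 - 2 * ρ) by
        rw [div_eq_iff hne, add_mul, div_mul_cancel₀ _ hne]; ring]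
      ring
    have e' : (1 - K * ρ) * ((w - ρ) / (1 - 2 * ρ)) =
        (1 - K * ρ) * w + (1 - K * ρ) / (1 - 2 * ρ) * (ρ * (2 * w - 1)) := by
      rw [show (w - ρ) / (1 - 2 * ρ) = w + ρ * (2 * w - 1) / (1 - 2 * ρ) by
        rw [div_eq_iff hne, add_mul, div_mul_cancel₀ _ hne]; ring]
      ring
    constructor
    · rw [e]; nlinarith
    · rw [e']
      have : (1 - K * ρ) / (1 - 2 * ρ) * (ρ * (2 * w - 1)) ≤ 1 * (ρ * (2 * w - 1)) :=
        mul_le_mul_of_nonneg_right h3 (mul_nonneg hρ0 (by linarith))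
      nlinarith
  · rw [max_eq_right h, add_zero, div_self (by linarith : w - ρ ≠ 0)]
    have hc : 0 ≤ (K - 2) * ρ * (1 - w) :=
      mul_nonneg (mul_nonneg (by linarith) hρ0) (by linarith)
    constructor <;> nlinarith

/-- Chebyshev's sum inequality for two terms: if the larger numerator has the larger denominator,
but not disproportionately so, then equal denominators are worse. -/
theorem div_add_div_le_of_ge {va vb p q : ℝ} (hq : 0 < q) (hpq : q ≤ p)
    (h : vb * p ≤ va * q) : va / p + vb / q ≤ 2 * (va + vb) / (p + q) := by
  have hp : 0 < p := hq.trans_le hpq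
  rw [div_add_div _ _ hp.ne' hq.ne', div_le_div_iff₀ (by positivity) (by positivity)]
  nlinarith [mul_nonneg (sub_nonneg.2 hpq) (sub_nonneg.2 h)]

theorem half_le_div_sqrt {va vb : ℝ} (hb : 0 < vb) (hab : vb ≤ va) :
    1 / 2 ≤ √va / (√va + √vb) := by
  have hb' := Real.sqrt_pos.2 hb
  have h := Real.sqrt_le_sqrt hab
  rw [div_le_div_iff₀ (by norm_num) (by linarith)]
  linarith

theorem variance_div_fraction_le_aux {K : ℕ} {ρ va vb : ℝ} (hK : 2 ≤ K) (hρ0 : 0 < ρ)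
    (hρ : 2 * ρ < 1) (hKρ : K * ρ ≤ 1) (hb : 0 < vb) (hab : vb ≤ va) :
    va / fraction K ρ (√va / (√va + √vb)) + vb / fraction K ρ (1 - √va / (√va + √vb)) ≤
      2 * (va + vb) / (1 - (K - 2) * ρ) := by
  have ha : 0 < va := hb.trans_le hab
  have ha' := Real.sqrt_pos.2 ha
  have hb' := Real.sqrt_pos.2 hb
  have hs := Real.sqrt_le_sqrt hab
  set w := √va / (√va + √vb) with hw
  have hw1 : w ≤ 1 := by rw [hw, div_le_one (by positivity)]; linarith
  obtain ⟨h1, h2⟩ := fraction_bounds hK hρ0.le hρ hKρ (half_le_div_sqrt hb hab) hw1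
  have hsum := fraction_add_fraction (K := K) hρ w
  have hq := hρ0.trans_le (le_fraction hKρ (1 - w))
  rw [← hsum]
  refine div_add_div_le_of_ge hq (by linarith) ?_
  set c : ℝ := 1 - (K - 2) * ρ
  have hc : 0 < c := by linarith [hρ0.trans_le (le_fraction hKρ w)]
  have h3 : c * (1 - w) ≤ fraction K ρ (1 - w) := by nlinarith
  have e1 : 1 - w = √vb / (√va + √vb) := by rw [hw]; field_simp; ring
  calc vb * fraction K ρ w ≤ vb * (c * w) := by gcongr
    _ ≤ va * (c * (1 - w)) := by
        rw [e1, hw, ← mul_div_assoc, ← mul_div_assoc, ← mul_div_assoc, ← mul_div_assoc]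
        gcongr 1
        have : vb * √va ≤ va * √vb := by
          have e2 := Real.mul_self_sqrt ha.le
          have e3 := Real.mul_self_sqrt hb.le
          calc vb * √va = √vb * (√vb * √va) := by rw [← mul_assoc, e3]
            _ ≤ √va * (√vb * √va) := by gcongr
            _ = (√va * √va) * √vb := by ring
            _ = _ := by rw [e2]
        nlinarith
    _ ≤ _ := by gcongr

/-- Up to the factor `1 / (1 - (K - 2) ρ)`, the actual allocation to two candidates, which lies
between the ideal one and the uniform one, is no worse than the uniform one. -/
theorem variance_div_fraction_le {K : ℕ} {ρ va vb : ℝ} (hK : 2 ≤ K) (hρ0 : 0 < ρ)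
    (hρ : 2 * ρ < 1) (hKρ : K * ρ ≤ 1) (ha : 0 < va) (hb : 0 < vb) :
    va / fraction K ρ (√va / (√va + √vb)) + vb / fraction K ρ (√vb / (√va + √vb)) ≤
      2 * (va + vb) / (1 - (K - 2) * ρ) := by
  have ha' := Real.sqrt_pos.2 ha
  have hb' := Real.sqrt_pos.2 hb
  rcases le_total vb va with h | h
  · have := variance_div_fraction_le_aux hK hρ0 hρ hKρ hb h
    rwa [show 1 - √va / (√va + √vb) = √vb / (√va + √vb) by field_simp; ring] at this
  · have := variance_div_fraction_le_aux hK hρ0 hρ hKρ ha h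
    rw [show 1 - √vb / (√vb + √va) = √va / (√vb + √va) by field_simp; ring] at this
    rw [add_comm (√va), add_comm va vb]
    linarith

/-! ### Typical runs of the experiment -/

section Typical

variable {K T : ℕ} {r : ℝ}

/-- The factor of the estimated standard deviation in the width of the confidence intervals. -/
noncomputable def widthFactor (K : ℕ) (r : ℝ) (T : ℕ) : ℝ := √(K * Real.log T / (r * T))

/-- The run `(Y, A)` of the experiment is typical: in both stages the sums of outcomes, in the pilot
stage the sums of squared outcomes, and in the second stage the number of rounds of each arm, are
close to their (conditional) expectations; `μ` are the means and `v` the variances. -/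
structure IsTypical (r δ η κ : ℝ) (μ v : Fin K → ℝ) (Y : Fin T → Fin K → ℝ)
    (A : Fin T → Fin K) : Prop where
  pilot : ∀ c, |pilotDev r μ Y c| < pilotSize K r T * (δ / 4)
  second : ∀ c, |secondDev r μ Y A c| < pilotSize K r T * (δ / 4)
  square : ∀ c, |∑ t ∈ pilotRounds r T c, ((Y t c - μ c) ^ 2 - v c)| < pilotSize K r T * η
  count : ∀ c, |((secondRounds r A c).card : ℝ) - secondStageSize K r T * secondStageProb r Y c| < κ
  /-- If the empirical variances are at least half the true ones, the means lie in the confidence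
  intervals. -/
  cover : ∀ c, |pilotDev r μ Y c| < pilotSize K r T * (widthFactor K r T * √(v c / 2))

variable {μ v : Fin K → ℝ} {Y : Fin T → Fin K → ℝ} {A : Fin T → Fin K} {δ η κ S s₀ τ : ℝ}

theorem sum_sq_sub_mean {ι : Type*} (s : Finset ι) (y : ι → ℝ) {m D x : ℝ} (hm : (s.card : ℝ) = m)
    (hm0 : 0 < m) (hD : ∑ t ∈ s, (y t - x) = D) :
    ∑ t ∈ s, (y t - (x + D / m)) ^ 2 = ∑ t ∈ s, (y t - x) ^ 2 - D ^ 2 / m := by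
  have h : ∀ t, (y t - (x + D / m)) ^ 2 = (y t - x) ^ 2 - 2 * (D / m) * (y t - x) + (D / m) ^ 2 :=
    fun t => by ring
  rw [Finset.sum_congr rfl fun t _ => h t, Finset.sum_add_distrib,
    Finset.sum_sub_distrib (f := fun t => (y t - x) ^ 2), ← Finset.mul_sum, hD, Finset.sum_const,
    nsmul_eq_mul, hm]
  field_simp
  ring

/-- In a typical run the empirical variance is close to the true one: replacing the true mean by the
sample mean costs `(δ / 4) ^ 2`, the normalization by `m - 1` costs `S / (m - 1)`. -/
theorem abs_pilotVar_sub_le (hr0 : 0 ≤ r) (hr1 : r ≤ 1) (hm : 2 ≤ pilotSize K r T) {c : Fin K}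
    (hD : |pilotDev r μ Y c| < pilotSize K r T * (δ / 4))
    (hQ : |∑ t ∈ pilotRounds r T c, ((Y t c - μ c) ^ 2 - v c)| < pilotSize K r T * η)
    (hv0 : 0 ≤ v c) (hvS : v c ≤ S)
    (hτ : pilotSize K r T * η + S + pilotSize K r T * (δ / 4) ^ 2 ≤
      ((pilotSize K r T : ℝ) - 1) * τ) :
    |pilotVar r Y c - v c| ≤ τ := by
  set m : ℝ := ((pilotSize K r T : ℕ) : ℝ) with hmdef
  have hm2 : (2 : ℝ) ≤ m := by rw [hmdef]; exact_mod_cast hm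
  have hcard : ((pilotRounds r T c).card : ℝ) = m := by rw [card_pilotRounds hr0 hr1]
  set D := pilotDev r μ Y c with hDdef
  have h1 : pilotVar r Y c - v c =
      (∑ t ∈ pilotRounds r T c, ((Y t c - μ c) ^ 2 - v c) + v c - D ^ 2 / m) / (m - 1) := by
    rw [pilotVar, pilotMean_eq (μ := μ) hr0 hr1 (by omega), ← hDdef, ← hmdef,
      sum_sq_sub_mean (D := D) _ (fun t => Y t c) hcard (by linarith) rfl, Finset.sum_sub_distrib,
      Finset.sum_const, nsmul_eq_mul, hcard, eq_div_iff (by linarith), sub_mul,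
      div_mul_cancel₀ _ (by linarith)]
    ring
  have hDm : D ^ 2 / m ≤ m * (δ / 4) ^ 2 := by
    rw [div_le_iff₀ (by linarith)]
    calc D ^ 2 = |D| ^ 2 := (sq_abs D).symm
      _ ≤ (m * (δ / 4)) ^ 2 := by gcongr
      _ = _ := by ring
  have hDm0 : 0 ≤ D ^ 2 / m := by positivity
  rw [h1, abs_div, abs_of_pos (by linarith : 0 < m - 1), div_le_iff₀ (by linarith), mul_comm τ]
  refine le_trans ?_ hτ
  have := abs_lt.1 hQ
  rw [abs_le]
  constructor <;> nlinarith [sq_nonneg δ]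

theorem abs_sqrt_sub_sqrt_le {x y e s : ℝ} (hs : 0 < s) (hy : s ≤ y) (hx : 0 ≤ x)
    (h : |x - y| ≤ e) : |√x - √y| ≤ e / √s := by
  have hs' := Real.sqrt_pos.2 hs
  have hy' : √s ≤ √y := Real.sqrt_le_sqrt hy
  have hx' := Real.sqrt_nonneg x
  have e1 : (√x - √y) * (√x + √y) = x - y := by
    have h1 := Real.mul_self_sqrt hx
    have h2 := Real.mul_self_sqrt (hs.le.trans hy)
    nlinarith
  rw [le_div_iff₀ hs']
  calc |√x - √y| * √s ≤ |√x - √y| * (√x + √y) := by gcongr; linarith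
    _ = |x - y| := by rw [← e1, abs_mul, abs_of_nonneg (by linarith : 0 ≤ √x + √y)]
    _ ≤ e := h

/-- In a typical run in which a worse arm `a` is recommended instead of the best arm `b`, and all
other arms are much worse, exactly these two arms survive the pilot stage. -/
theorem IsTypical.candidates_eq [Nonempty (Fin K)] (hY : IsTypical r δ η κ μ v Y A) (hr0 : 0 ≤ r)
    (hr1 : r ≤ 1) (hm : 0 < pilotSize K r T) (hδ : 0 < δ)
    (hvar : ∀ c, v c / 2 ≤ pilotVar r Y c ∧ pilotVar r Y c ≤ 2 * S) {a b : Fin K} (hab : μ a ≤ μ b)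
    (hne : a ≠ b)
    (hgap : ∀ c, c ≠ a → c ≠ b → μ c + (2 * (widthFactor K r T * √(2 * S)) + δ) ≤ μ b)
    (hrec : recommend r Y A = a) :
    candidates r Y = {a, b} ∧ finalMean Y A b ≤ finalMean Y A a := by
  have hm' : (0 : ℝ) < pilotSize K r T := by exact_mod_cast hm
  have hL : 0 ≤ widthFactor K r T := Real.sqrt_nonneg _
  have hw : ∀ c, widthFactor K r T * √(v c / 2) ≤ width r Y := fun c => by
    rw [width]
    exact mul_le_mul_of_nonneg_left ((Real.sqrt_le_sqrt (hvar c).1).trans (pilotSd_le_iSup Y c)) hL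
  have hw' : width r Y ≤ widthFactor K r T * √(2 * S) := by
    rw [width]
    exact mul_le_mul_of_nonneg_left (ciSup_le fun c => Real.sqrt_le_sqrt (hvar c).2) hL
  have hpil : ∀ c, |pilotDev r μ Y c / pilotSize K r T| < δ / 4 := fun c =>
    abs_div_lt_of_lt hm' le_rfl (by linarith) (hY.pilot c)
  have hcov : ∀ c, |pilotDev r μ Y c / pilotSize K r T| < width r Y := fun c =>
    (abs_div_lt_of_lt hm' le_rfl (mul_nonneg hL (Real.sqrt_nonneg _)) (hY.cover c)).trans_le (hw c)
  have hpm := fun c => pilotMean_eq (μ := μ) (Y := Y) hr0 hr1 hm c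
  have hother : ∀ c, c ≠ a → c ≠ b → pilotMean r Y c + 2 * width r Y < pilotMean r Y b := by
    intro c hca hcb
    have h1 := (abs_lt.1 (hpil c)).2
    have h2 := (abs_lt.1 (hpil b)).1
    have h3 := hgap c hca hcb
    rw [hpm c, hpm b]
    linarith
  have hb : b ∈ candidates r Y := by
    rw [mem_candidates]
    intro c
    by_cases hca : c = a
    · subst hca
      have h1 := (abs_lt.1 (hcov c)).2
      have h2 := (abs_lt.1 (hcov b)).1
      rw [hpm c, hpm b]
      linarith
    · by_cases hcb : c = b
      · subst hcb; linarith [width_nonneg (r := r) Y]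
      · linarith [hother c hca hcb, width_nonneg (r := r) Y]
  have hsub : candidates r Y ⊆ {a, b} := by
    intro c hc
    rw [mem_candidates] at hc
    by_contra hcon
    simp only [Finset.mem_insert, Finset.mem_singleton, not_or] at hcon
    linarith [hother c hcon.1 hcon.2, hc b]
  have ha : a ∈ candidates r Y := by
    by_contra hcon
    have hs : candidates r Y = {b} := by
      refine Finset.Subset.antisymm (fun c hc => ?_) (by simpa using hb)
      have := hsub hc
      simp only [Finset.mem_insert, Finset.mem_singleton] at this ⊢
      rcases this with rfl | h
      · exact absurd hc hcon
      · exact h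
    rw [recommend, if_pos (by rw [hs]; simp)] at hrec
    exact hcon (hrec ▸ argmax_pilotMean_mem_candidates Y)
  have heq : candidates r Y = {a, b} :=
    Finset.Subset.antisymm hsub (by
      intro c hc
      simp only [Finset.mem_insert, Finset.mem_singleton] at hc
      rcases hc with rfl | rfl <;> assumption)
  refine ⟨heq, ?_⟩
  rw [recommend, if_neg (by rw [heq, Finset.card_pair hne]; norm_num)] at hrec
  rw [← hrec]
  exact argmax_spec _ b

/-- With two candidates the ideal ratios are `w` and `1 - w`, and the second-stage probabilities are
the shares. -/
theorem secondStageProb_eq_share (hρ : 2 * (r / K) < 1) {a b : Fin K} (hne : a ≠ b)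
    (hc : candidates r Y = {a, b}) (hpos : 0 < pilotSd r Y a + pilotSd r Y b) :
    secondStageProb r Y a = share (r / K) (pilotSd r Y a / (pilotSd r Y a + pilotSd r Y b)) ∧
    secondStageProb r Y b = share (r / K) (pilotSd r Y b / (pilotSd r Y a + pilotSd r Y b)) := by
  set w := pilotSd r Y a / (pilotSd r Y a + pilotSd r Y b) with hw
  have hw' : pilotSd r Y b / (pilotSd r Y a + pilotSd r Y b) = 1 - w := by
    rw [hw, eq_sub_iff_add_eq, ← add_div, add_comm, div_self hpos.ne']
  have hcard : (candidates r Y).card = 2 := by rw [hc, Finset.card_pair hne]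
  have ha : secondStageWeight r Y a = max (w - r / K) 0 := by
    rw [secondStageWeight, idealRatio, if_pos hcard, hc, if_pos (by simp), Finset.sum_pair hne]
  have hb : secondStageWeight r Y b = max (1 - w - r / K) 0 := by
    rw [secondStageWeight, idealRatio, if_pos hcard, hc, if_pos (by simp), Finset.sum_pair hne, hw']
  have hsum : ∑ c, secondStageWeight r Y c = max (w - r / K) 0 + max (1 - w - r / K) 0 := by
    rw [← Finset.sum_subset (Finset.subset_univ {a, b}), Finset.sum_pair hne, ha, hb]
    intro c _ hc'
    rw [secondStageWeight, hc, if_neg hc']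
  have hden := share_denom_ge (r / K) w
  have hne0 : max (w - r / K) 0 + max (1 - w - r / K) 0 ≠ 0 := by linarith
  constructor
  · rw [secondStageProb, hsum, if_neg hne0, ha, share]
  · rw [secondStageProb, hsum, if_neg hne0, hb, hw', share, sub_sub_cancel, add_comm]

theorem secondStageSize_add (hr0 : 0 ≤ r) (hr1 : r ≤ 1) :
    (secondStageSize K r T : ℝ) = T - K * pilotSize K r T := by
  have h := Finset.card_compl_add_card (pilotStage K r T)
  rw [card_pilotStage hr0 hr1, Fintype.card_fin] at h
  rw [secondStageSize, eq_sub_iff_add_eq]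
  exact_mod_cast h

/-- In a typical run with the two candidates `a` and `b`, their shares of the budget are close to
the limiting ones. -/
theorem IsTypical.abs_card_armRounds_sub_le (hY : IsTypical r δ η κ μ v Y A) (hK : 0 < K)
    (hr0 : 0 < r) (hr1 : r ≤ 1) (hρ : 2 * (r / K) < 1) (hT : 2 ≤ r / K * T)
    (hA : ∀ a, ∀ t ∈ pilotRounds r T a, A t = a)
    (hs₀ : 0 < s₀) (hv : ∀ c, s₀ ≤ v c) (hvar : ∀ c, |pilotVar r Y c - v c| ≤ τ) (hτ : 2 * τ ≤ s₀)
    {a b : Fin K} (hne : a ≠ b) (hc : candidates r Y = {a, b}) :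
    |((armRounds A a).card : ℝ) - T * fraction K (r / K) (√(v a) / (√(v a) + √(v b)))| ≤
      1 + K + κ + T * (τ / s₀ / (1 - 2 * (r / K))) ∧
    |((armRounds A b).card : ℝ) - T * fraction K (r / K) (√(v b) / (√(v a) + √(v b)))| ≤
      1 + K + κ + T * (τ / s₀ / (1 - 2 * (r / K))) := by
  have hK0 : (0 : ℝ) < K := by exact_mod_cast hK
  have hs₀' := Real.sqrt_pos.2 hs₀
  have hvp : ∀ c, s₀ / 2 ≤ pilotVar r Y c := fun c => by
    linarith [hv c, (abs_le.1 (hvar c)).1]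
  have hsd : ∀ c, |pilotSd r Y c - √(v c)| ≤ τ / √s₀ := fun c =>
    abs_sqrt_sub_sqrt_le hs₀ (hv c) (by linarith [hvp c]) (hvar c)
  have hsd2 : ∀ c, √s₀ / 2 ≤ pilotSd r Y c := fun c => by
    refine Real.le_sqrt_of_sq_le (le_trans ?_ (hvp c))
    rw [div_pow, Real.sq_sqrt hs₀.le]; linarith
  have hvs : ∀ c, 0 < √(v c) := fun c => Real.sqrt_pos.2 (hs₀.trans_le (hv c))
  have hsum : √s₀ ≤ pilotSd r Y a + pilotSd r Y b := by linarith [hsd2 a, hsd2 b]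
  have hτ0 : 0 ≤ τ := (abs_nonneg _).trans (hvar a)
  have hw1 : |pilotSd r Y a / (pilotSd r Y a + pilotSd r Y b) - √(v a) / (√(v a) + √(v b))| ≤
      τ / s₀ := by
    refine (abs_div_add_sub_div_add_le (hvs a).le (hvs b).le (by linarith [hvs a, hvs b]) hs₀' hsum
      (hsd a) (hsd b)).trans (le_of_eq ?_)
    rw [div_div, Real.mul_self_sqrt hs₀.le]
  have hw2 : |pilotSd r Y b / (pilotSd r Y a + pilotSd r Y b) - √(v b) / (√(v a) + √(v b))| ≤
      τ / s₀ := by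
    rw [add_comm (pilotSd r Y a), add_comm (√(v a))]
    refine (abs_div_add_sub_div_add_le (hvs b).le (hvs a).le (by linarith [hvs a, hvs b]) hs₀'
      (by linarith) (hsd b) (hsd a)).trans (le_of_eq ?_)
    rw [div_div, Real.mul_self_sqrt hs₀.le]
  obtain ⟨hqa, hqb⟩ := secondStageProb_eq_share hρ hne hc (hs₀'.trans_le hsum)
  obtain ⟨-, hm⟩ := half_le_pilotSize hK hr0 hT
  have key : ∀ c w, |secondStageProb r Y c - share (r / K) w| ≤ τ / s₀ / (1 - 2 * (r / K)) →
      |((armRounds A c).card : ℝ) - T * fraction K (r / K) w| ≤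
        1 + K + κ + T * (τ / s₀ / (1 - 2 * (r / K))) := by
    intro c w h
    have hcount := (hY.count c).le
    have hcard : ((armRounds A c).card : ℝ) = pilotSize K r T + (secondRounds r A c).card := by
      rw [card_armRounds hr0.le hr1 hA]; push_cast; rfl
    set q := secondStageProb r Y c with hq
    have hq0 : 0 ≤ q := secondStageProb_nonneg Y c
    have hq1 : q ≤ 1 := by
      by_contra hcon
      have h1 := share_nonneg (r / K)
      have h2 := share_le_one hρ
      have : q = share (r / K) (pilotSd r Y a / (pilotSd r Y a + pilotSd r Y b)) ∨
          q = share (r / K) (pilotSd r Y b / (pilotSd r Y a + pilotSd r Y b)) ∨ q = 0 := by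
        by_cases hca : c = a
        · left; rw [hq, hca, hqa]
        · by_cases hcb : c = b
          · right; left; rw [hq, hcb, hqb]
          · right; right
            have hcc : c ∉ candidates r Y := by rw [hc]; simp [hca, hcb]
            rw [hq, secondStageProb, secondStageWeight, if_neg hcc]; simp [hcc]
      rcases this with h | h | h <;> linarith [h2 (pilotSd r Y a / (pilotSd r Y a + pilotSd r Y b)),
        h2 (pilotSd r Y b / (pilotSd r Y a + pilotSd r Y b))]
    have hN := secondStageSize_add (K := K) (T := T) hr0.le hr1
    set m : ℝ := ((pilotSize K r T : ℕ) : ℝ)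
    set ρ := r / K with hρdef
    have hKρ : K * ρ ≤ 1 := by rw [hρdef, mul_div_cancel₀ _ hK0.ne']; exact hr1
    have hKρ0 : 0 ≤ K * ρ := by positivity
    have e : ((armRounds A c).card : ℝ) - T * fraction K ρ w = (m - ρ * T) +
        (((secondRounds r A c).card : ℝ) - secondStageSize K r T * q) + K * (ρ * T - m) * q +
        T * (1 - K * ρ) * (q - share ρ w) := by
      rw [hcard, hN, fraction]; ring
    have h4 : |K * (ρ * T - m) * q| ≤ K := by
      rw [abs_mul, abs_mul, abs_of_nonneg hK0.le, abs_of_nonneg hq0, abs_sub_comm]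
      calc K * |m - ρ * T| * q ≤ K * 1 * 1 := by gcongr
        _ = K := by ring
    have h5 : |T * (1 - K * ρ) * (q - share ρ w)| ≤ T * (τ / s₀ / (1 - 2 * ρ)) := by
      rw [abs_mul, abs_of_nonneg (mul_nonneg T.cast_nonneg (by linarith))]
      have h6 : 0 ≤ τ / s₀ / (1 - 2 * ρ) := div_nonneg (by positivity) (by linarith)
      calc _ ≤ T * 1 * (τ / s₀ / (1 - 2 * ρ)) := by gcongr; linarith
        _ = _ := by rw [mul_one]
    rw [e]
    refine (abs_add_le _ _).trans ?_
    refine (add_le_add ((abs_add_le _ _).trans (add_le_add (abs_add_le _ _) le_rfl))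
      le_rfl).trans ?_
    linarith
  constructor
  · refine key a _ ?_
    rw [hqa]
    exact (abs_share_sub_le hρ _ _).trans (by gcongr)
  · refine key b _ ?_
    rw [hqb]
    exact (abs_share_sub_le hρ _ _).trans (by gcongr)

end Typical

/-! ### The exponential bound for typical runs -/

section Exponential

variable {K T : ℕ} {r : ℝ} {Q : Measure (Fin K → ℝ)} [IsProbabilityMeasure Q]

theorem sum_armRounds_eq (ℓ ψ μ : Fin K → ℝ) (Y : Fin T → Fin K → ℝ) (A : Fin T → Fin K) :
    ∑ c, (ℓ c * ∑ t ∈ armRounds A c, (Y t c - μ c) - (armRounds A c).card * ψ c) =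
      ∑ t, (ℓ (A t) * (Y t (A t) - μ (A t)) - ψ (A t)) := by
  rw [← Finset.sum_fiberwise Finset.univ A]
  refine Finset.sum_congr rfl fun c _ => ?_
  rw [Finset.mul_sum, ← nsmul_eq_mul, ← Finset.sum_const, ← Finset.sum_sub_distrib]
  refine Finset.sum_congr rfl fun t ht => ?_
  have : A t = c := by simpa [armRounds] using ht
  subst this
  rfl

/-- Chernoff's bound for a linear combination of the observed centred outcomes, with random numbers
of observations. -/
theorem experimentLaw_exp_le [Nonempty (Fin K)] {ℓ ψ μ : Fin K → ℝ}
    (h : ∀ c, ∫⁻ y, ENNReal.ofReal (Real.exp (ℓ c * (y c - μ c))) ∂Q ≤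
      ENNReal.ofReal (Real.exp (ψ c))) (w : ℝ) :
    experimentLaw r T Q {z | w ≤ ∑ c, (ℓ c * ∑ t ∈ armRounds z.2 c, (z.1 t c - μ c)
      - (armRounds z.2 c).card * ψ c)} ≤ ENNReal.ofReal (Real.exp (-w)) := by
  set g : Fin K → ℝ → ℝ≥0∞ := fun c y => ENNReal.ofReal (Real.exp (ℓ c * (y - μ c) - ψ c))
  have hg : ∀ c, Measurable (g c) := fun c => by fun_prop
  have hle : ∀ c, ∫⁻ y, g c (y c) ∂Q ≤ 1 := by
    intro c
    have e : ∀ y : Fin K → ℝ, g c (y c) = ENNReal.ofReal (Real.exp (ℓ c * (y c - μ c))) *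
        ENNReal.ofReal (Real.exp (-ψ c)) := fun y => by
      rw [← ENNReal.ofReal_mul (Real.exp_pos _).le, ← Real.exp_add, ← sub_eq_add_neg]
    rw [lintegral_congr e, lintegral_mul_const _ (by fun_prop)]
    calc _ ≤ ENNReal.ofReal (Real.exp (ψ c)) * ENNReal.ofReal (Real.exp (-ψ c)) := by
          gcongr; exact h c
      _ = 1 := by
          rw [← ENNReal.ofReal_mul (Real.exp_pos _).le, ← Real.exp_add, add_neg_cancel,
            Real.exp_zero, ENNReal.ofReal_one]
  have hint := lintegral_prod_observed_le_one (r := r) (T := T) Q hg hle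
  have hpos : ENNReal.ofReal (Real.exp w) ≠ 0 := (ENNReal.ofReal_pos.2 (Real.exp_pos _)).ne'
  have hmeas : Measurable fun z : (Fin T → Fin K → ℝ) × (Fin T → Fin K) =>
      ∏ t, g (z.2 t) (z.1 t (z.2 t)) := by
    refine measurable_of_slices fun A => ?_
    exact Finset.measurable_fun_prod _ fun t _ => (hg _).comp (measurable_apply_apply t (A t))
  have hmk := mul_meas_ge_le_lintegral (μ := experimentLaw r T Q) hmeas
    (ENNReal.ofReal (Real.exp w))
  have hsub : {z : (Fin T → Fin K → ℝ) × (Fin T → Fin K) | w ≤ ∑ c,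
      (ℓ c * ∑ t ∈ armRounds z.2 c, (z.1 t c - μ c) - (armRounds z.2 c).card * ψ c)} ⊆
      {z | ENNReal.ofReal (Real.exp w) ≤ ∏ t, g (z.2 t) (z.1 t (z.2 t))} := by
    intro z hz
    simp only [Set.mem_ofPred_eq] at hz ⊢
    rw [sum_armRounds_eq] at hz
    simp only [g]
    rw [← ENNReal.ofReal_prod_of_nonneg fun _ _ => (Real.exp_pos _).le, ← Real.exp_sum]
    exact ENNReal.ofReal_le_ofReal (Real.exp_le_exp.2 hz)
  refine (measure_mono hsub).trans ?_
  rw [← ENNReal.mul_le_mul_iff_right hpos ENNReal.ofReal_ne_top]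
  refine (hmk.trans hint).trans (le_of_eq ?_)
  rw [← ENNReal.ofReal_mul (Real.exp_pos _).le, ← Real.exp_add, add_neg_cancel, Real.exp_zero,
    ENNReal.ofReal_one]

/-- If arm `a` beats arm `b` in the final comparison although the mean of `b` is larger by `Δ`,
the exponent with weights matched to the expected numbers of observations `N a`, `N b` is large. -/
theorem exponent_ge {Da Db na nb Na Nb Δ δ e₁ e₂ va vb V lam : ℝ} (hNa : 0 < Na) (hNb : 0 < Nb)
    (hna : 0 < na) (hnb : 0 < nb)
    (ha : |na - Na| ≤ e₁ * Na) (hb : |nb - Nb| ≤ e₁ * Nb) (hDa : |Da| ≤ na * (δ / 2))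
    (hDb : |Db| ≤ nb * (δ / 2)) (hlam : 0 ≤ lam) (he₂ : 0 ≤ e₂) (hva : 0 ≤ va)
    (hvb : 0 ≤ vb) (hV : va / Na + vb / Nb ≤ V) (h : Δ + Db / nb ≤ Da / na) :
    lam * (Δ - e₁ * δ) - (1 + e₁) * (1 + e₂) * lam ^ 2 * V / 2 ≤
      (lam / Na * Da - na * ((lam / Na) ^ 2 * ((1 + e₂) * va) / 2)) +
      (-(lam / Nb) * Db - nb * ((-(lam / Nb)) ^ 2 * ((1 + e₂) * vb) / 2)) := by
  have he₁ : 0 ≤ e₁ := by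
    by_contra hcon
    have := (abs_nonneg _).trans ha
    nlinarith
  have mism : ∀ D n N : ℝ, 0 < N → 0 < n → |n - N| ≤ e₁ * N → |D| ≤ n * (δ / 2) →
      |D / N - D / n| ≤ e₁ * (δ / 2) := by
    intro D n N hN hn h1 h2
    have e : D / N - D / n = D * (n - N) / (n * N) := by field_simp
    rw [e, abs_div, abs_mul, abs_of_pos (mul_pos hn hN), div_le_iff₀ (mul_pos hn hN)]
    calc |D| * |n - N| ≤ (n * (δ / 2)) * (e₁ * N) :=
          mul_le_mul h2 h1 (abs_nonneg _) ((abs_nonneg _).trans h2)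
      _ = _ := by ring
  have quad : ∀ n N v : ℝ, 0 < N → |n - N| ≤ e₁ * N → 0 ≤ v →
      n * ((lam / N) ^ 2 * ((1 + e₂) * v) / 2) ≤ (1 + e₁) * (1 + e₂) * lam ^ 2 / 2 * (v / N) := by
    intro n N v hN h1 hv
    have : n ≤ (1 + e₁) * N := by linarith [(abs_le.1 h1).2]
    calc _ ≤ (1 + e₁) * N * ((lam / N) ^ 2 * ((1 + e₂) * v) / 2) := by gcongr
      _ = _ := by field_simp
  have m1 := (abs_le.1 (mism Da na Na hNa hna ha hDa)).1
  have m2 := (abs_le.1 (mism Db nb Nb hNb hnb hb hDb)).2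
  have q1 := quad na Na va hNa ha hva
  have q2 := quad nb Nb vb hNb hb hvb
  rw [neg_sq]
  have h3 : Δ - e₁ * δ ≤ Da / Na - Db / Nb := by linarith
  have h4 : lam * (Δ - e₁ * δ) ≤ lam / Na * Da + -(lam / Nb) * Db := by
    calc _ ≤ lam * (Da / Na - Db / Nb) := by gcongr
      _ = _ := by ring
  have h5 : (1 + e₁) * (1 + e₂) * lam ^ 2 / 2 * (va / Na + vb / Nb) ≤
      (1 + e₁) * (1 + e₂) * lam ^ 2 / 2 * V := by gcongr
  linarith

variable {θ₁ θ₂ S : ℝ} {v : Fin K → ℝ → ℝ} {P : Fin K → ℝ → Measure ℝ} {μ : Fin K → ℝ}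

/-- The probability of a typical run in which the second best arm is recommended. -/
theorem experimentLaw_typical_le [Nonempty (Fin K)]
    (hP : ∀ a, HasGaussianMGF θ₁ θ₂ S (v a) (P a)) (hS : 0 < S)
    (hQ : ∀ a, Q.map (fun y => y a) = P a (μ a)) (hK : 2 ≤ K) (hr0 : 0 < r) (hr1 : r < 1)
    {s₀ δ η κ τ d e₁ e₂ e : ℝ} (hs₀ : 0 < s₀) (hv : ∀ c, s₀ ≤ v c (μ c)) (hvS : ∀ c, v c (μ c) ≤ S)
    (hT : 4 ≤ r / K * T) (hδ : 0 < δ)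
    (hτ : pilotSize K r T * η + S + pilotSize K r T * (δ / 4) ^ 2 ≤
      ((pilotSize K r T : ℝ) - 1) * τ) (hτs : 2 * τ ≤ s₀)
    (he₁ : 1 + K + κ + T * (τ / s₀ / (1 - 2 * (r / K))) ≤ e₁ * (r / K * T)) (he₂ : 0 ≤ e₂)
    (he : (1 + e₁) * (1 + e₂) ≤ 1 + e)
    (hd : S * δ / (4 * s₀ * (r / K)) ≤ d) (hμ : ∀ c, θ₁ + d ≤ μ c ∧ μ c + d ≤ θ₂)
    (hvd : ∀ c, ∀ s ∈ Set.Icc (μ c - d) (μ c + d), v c s ≤ (1 + e₂) * v c (μ c)) {a b : Fin K}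
    (hab : μ a < μ b) (habδ : μ b - μ a ≤ δ)
    (hgap : ∀ c, c ≠ a → c ≠ b → μ c + (2 * (widthFactor K r T * √(2 * S)) + δ) ≤ μ b) {V : ℝ}
    (hV : V = 2 * (v a (μ a) + v b (μ b)) / (1 - (K - 2) * (r / K))) :
    experimentLaw r T Q {z | recommend r z.1 z.2 = a ∧
      IsTypical r δ η κ μ (fun c => v c (μ c)) z.1 z.2} ≤
      ENNReal.ofReal (Real.exp (-((1 - e) * (T * (μ b - μ a) ^ 2 / (2 * V))
        - e₁ * δ * (μ b - μ a) * T / V))) := by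
  have hK2 : (2 : ℝ) ≤ K := by exact_mod_cast hK
  have hK0 : (0 : ℝ) < K := by linarith
  set ρ := r / K with hρdef
  have hρ0 : 0 < ρ := by positivity
  have hKρ : K * ρ ≤ 1 := by rw [hρdef, mul_div_cancel₀ _ hK0.ne']; exact hr1.le
  have hρ2 : 2 * ρ < 1 := by
    have : K * ρ < 1 := by rw [hρdef, mul_div_cancel₀ _ hK0.ne']; exact hr1
    nlinarith
  have hT0 : (0 : ℝ) < T := by
    by_contra hcon
    have := mul_nonpos_of_nonneg_of_nonpos hρ0.le (not_lt.1 hcon)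
    linarith
  obtain ⟨hm, -⟩ := half_le_pilotSize (by omega) hr0 (by linarith : 2 ≤ r / K * T)
  have hm2 : 2 ≤ pilotSize K r T := by
    have : (2 : ℝ) ≤ pilotSize K r T := by rw [← hρdef] at hm; linarith
    exact_mod_cast this
  have hne : a ≠ b := fun h => by rw [h] at hab; exact lt_irrefl _ hab
  set va := v a (μ a) with hva
  set vb := v b (μ b) with hvb
  have hva0 : 0 < va := hs₀.trans_le (hv a)
  have hvb0 : 0 < vb := hs₀.trans_le (hv b)
  set Fa := fraction K ρ (√va / (√va + √vb)) with hFa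
  set Fb := fraction K ρ (√vb / (√va + √vb)) with hFb
  have hFa0 : ρ ≤ Fa := le_fraction hKρ _
  have hFb0 : ρ ≤ Fb := le_fraction hKρ _
  have hVF : va / Fa + vb / Fb ≤ V := hV ▸ variance_div_fraction_le hK hρ0 hρ2 hKρ hva0 hvb0
  have hc0 : 0 < 1 - (K - 2) * ρ := by nlinarith
  have hV4 : 4 * s₀ ≤ V := by
    rw [hV, le_div_iff₀ hc0]
    have : 4 * s₀ * (1 - (K - 2) * ρ) ≤ 4 * s₀ * 1 := by
      gcongr
      have : 0 ≤ (K - 2) * ρ := mul_nonneg (by linarith) hρ0.le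
      linarith
    linarith [hv a, hv b]
  have hV0 : 0 < V := by linarith
  set Δ := μ b - μ a with hΔ
  have hΔ0 : 0 < Δ := sub_pos.2 hab
  -- the optimal Laplace parameter for a Gaussian difference of sample means with variance `V / T`
  set lam := Δ * T / V with hlam
  have hlam0 : 0 ≤ lam := by positivity
  have hrate : ∀ F, ρ ≤ F → 0 ≤ lam / (T * F) ∧ S * (lam / (T * F)) ≤ d := by
    intro F hF
    have hF0 : 0 < F := hρ0.trans_le hF
    refine ⟨by positivity, le_trans ?_ hd⟩
    calc S * (lam / (T * F)) = S * Δ / (V * F) := by rw [hlam]; field_simp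
      _ ≤ S * δ / (4 * s₀ * ρ) := by gcongr
  set ℓ : Fin K → ℝ := fun c => if c = a then lam / (T * Fa) else if c = b then -(lam / (T * Fb))
    else 0 with hℓ
  have hℓa : ℓ a = lam / (T * Fa) := by simp [hℓ]
  have hℓb : ℓ b = -(lam / (T * Fb)) := by simp [hℓ, hne.symm]
  have hℓd : ∀ c, S * |ℓ c| ≤ d := by
    intro c
    have hd0 : 0 ≤ d := le_trans (by positivity) hd
    simp only [hℓ]
    split_ifs
    · rw [abs_of_nonneg (hrate Fa hFa0).1]; exact (hrate Fa hFa0).2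
    · rw [abs_neg, abs_of_nonneg (hrate Fb hFb0).1]; exact (hrate Fb hFb0).2
    · simpa using hd0
  set ψ : Fin K → ℝ := fun c => ℓ c ^ 2 * ((1 + e₂) * v c (μ c)) / 2 with hψ
  have hmgf : ∀ c, ∫⁻ y, ENNReal.ofReal (Real.exp (ℓ c * (y c - μ c))) ∂Q ≤
      ENNReal.ofReal (Real.exp (ψ c)) := by
    intro c
    have h1 := (hP c).lintegral_exp_le (μ c) (ℓ c) ((1 + e₂) * v c (μ c))
      (by linarith [hℓd c, (hμ c).1]) (by linarith [hℓd c, (hμ c).2])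
      (fun s hs => hvd c s ⟨by linarith [hs.1, hℓd c], by linarith [hs.2, hℓd c]⟩)
    rw [← hQ c, lintegral_map (by fun_prop) (measurable_pi_apply c)] at h1
    exact h1
  refine le_trans (measure_mono_ae ?_) (experimentLaw_exp_le (r := r) (T := T) hmgf _)
  filter_upwards [ae_alloc_pilot (r := r) (T := T) Q] with z hz hz2
  obtain ⟨hrec, htyp⟩ := hz2
  set Y := z.1
  set A := z.2
  have hvar : ∀ c, |pilotVar r Y c - v c (μ c)| ≤ τ := fun c =>
    abs_pilotVar_sub_le (v := fun c => v c (μ c)) hr0.le hr1.le hm2 (htyp.pilot c) (htyp.square c)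
      (hs₀.le.trans (hv c)) (hvS c) hτ
  obtain ⟨hcand, hfin⟩ := htyp.candidates_eq hr0.le hr1.le (by omega) hδ (S := S) (fun c => by
    have h1 := abs_le.1 (hvar c)
    have h2 := hv c
    have h3 := hvS c
    exact ⟨by linarith [h1.1], by linarith [h1.2]⟩) hab.le hne hgap hrec
  obtain ⟨hca, hcb⟩ := htyp.abs_card_armRounds_sub_le (by omega) hr0 hr1.le hρ2 (by linarith) hz hs₀
    hv hvar hτs hne hcand
  have hm0 : (0 : ℝ) < pilotSize K r T := by exact_mod_cast (by omega : 0 < pilotSize K r T)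
  have hcard : ∀ c, (pilotSize K r T : ℝ) ≤ (armRounds A c).card := fun c => by
    rw [card_armRounds hr0.le hr1.le hz]
    push_cast
    linarith [Nat.cast_nonneg (α := ℝ) (secondRounds r A c).card]
  have hdev : ∀ c, |∑ t ∈ armRounds A c, (Y t c - μ c)| ≤ (armRounds A c).card * (δ / 2) := by
    intro c
    rw [sum_armRounds hz]
    calc _ ≤ |pilotDev r μ Y c| + |secondDev r μ Y A c| := abs_add_le _ _
      _ ≤ pilotSize K r T * (δ / 2) := by linarith [htyp.pilot c, htyp.second c]
      _ ≤ _ := by gcongr; exact_mod_cast hcard c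
  have herr : ∀ F, ρ ≤ F → e₁ * (ρ * T) ≤ e₁ * (T * F) := by
    intro F hF
    have he₁0 : 0 ≤ e₁ := by
      have h1 := (abs_nonneg _).trans hca
      by_contra hcon
      have : e₁ * (ρ * T) < 0 := mul_neg_of_neg_of_pos (not_le.1 hcon) (by positivity)
      linarith
    rw [mul_comm ρ]
    gcongr
  rw [finalMean_eq (μ := μ) hr0.le hr1.le (by omega) hz,
    finalMean_eq (μ := μ) hr0.le hr1.le (by omega) hz, ← sum_armRounds hz,
    ← sum_armRounds hz] at hfin
  have hfa0 : 0 < Fa := by linarith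
  have hfb0 : 0 < Fb := by linarith
  have hexp := exponent_ge (V := V / T) (e₂ := e₂) (va := va) (vb := vb) (lam := lam) (Δ := Δ)
    (by positivity : 0 < T * Fa) (by positivity : 0 < T * Fb)
    (hm0.trans_le (hcard a)) (hm0.trans_le (hcard b)) ((hca.trans he₁).trans (herr Fa hFa0))
    ((hcb.trans he₁).trans (herr Fb hFb0)) (hdev a) (hdev b) hlam0 he₂ hva0.le hvb0.le
    (by
      have : va / (T * Fa) + vb / (T * Fb) = (va / Fa + vb / Fb) / T := by field_simp
      rw [this]; gcongr) (by rw [hΔ]; linarith)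
  have hsum : ∑ c, (ℓ c * ∑ t ∈ armRounds A c, (Y t c - μ c) - (armRounds A c).card * ψ c) =
      (lam / (T * Fa) * ∑ t ∈ armRounds A a, (Y t a - μ a) -
        (armRounds A a).card * ((lam / (T * Fa)) ^ 2 * ((1 + e₂) * va) / 2)) +
      (-(lam / (T * Fb)) * ∑ t ∈ armRounds A b, (Y t b - μ b) -
        (armRounds A b).card * ((-(lam / (T * Fb))) ^ 2 * ((1 + e₂) * vb) / 2)) := by
    rw [← Finset.sum_subset (Finset.subset_univ {a, b}), Finset.sum_pair hne]
    · simp only [hψ, hℓa, hℓb, ← hva, ← hvb]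
    · intro c _ hc
      simp only [Finset.mem_insert, Finset.mem_singleton, not_or] at hc
      simp [hψ, hℓ, hc.1, hc.2]
  show _ ≤ _
  rw [hsum]
  refine le_trans ?_ hexp
  have hlV : lam * (Δ - e₁ * δ) - (1 + e) * lam ^ 2 * (V / T) / 2 =
      (1 - e) * (T * Δ ^ 2 / (2 * V)) - e₁ * δ * Δ * T / V := by
    rw [hlam]; field_simp; ring
  rw [← hlV]
  gcongr

end Exponential

/-! ### Atypical runs are rare -/

section Atypical

variable {K T : ℕ} {r : ℝ} {Q : Measure (Fin K → ℝ)} [IsProbabilityMeasure Q]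
  {θ₁ θ₂ S : ℝ} {v : Fin K → ℝ → ℝ} {P : Fin K → ℝ → Measure ℝ} {μ : Fin K → ℝ}

/-- The centred squared outcome has mean zero and a variance bounded by the fourth central
moment. -/
theorem HasGaussianMGF.sq_sub_var {v : ℝ → ℝ} {P : ℝ → Measure ℝ}
    (hP : HasGaussianMGF θ₁ θ₂ S v P) {x C : ℝ} (hx : x ∈ Set.Icc θ₁ θ₂)
    (hC : ∫⁻ y, ENNReal.ofReal ((y - x) ^ 4) ∂(P x) ≤ ENNReal.ofReal C) (hC0 : 0 ≤ C) :
    Integrable (fun y => ((y - x) ^ 2 - v x) ^ 2) (P x) ∧ ∫ y, ((y - x) ^ 2 - v x) ∂(P x) = 0 ∧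
      ∫ y, ((y - x) ^ 2 - v x) ^ 2 ∂(P x) ≤ C := by
  have := hP.isProb x hx
  obtain ⟨-, hi2⟩ := hP.integral_centred hx
  have hnn : ∀ y : ℝ, 0 ≤ (y - x) ^ 4 := fun y => by positivity
  have hi4 : Integrable (fun y => (y - x) ^ 4) (P x) := by
    refine ⟨by fun_prop, ?_⟩
    rw [hasFiniteIntegral_iff_ofReal (ae_of_all _ hnn)]
    exact hC.trans_lt ENNReal.ofReal_lt_top
  have h4 : ∫ y, (y - x) ^ 4 ∂(P x) ≤ C := by
    rw [integral_eq_lintegral_of_nonneg_ae (ae_of_all _ hnn) (by fun_prop)]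
    exact ENNReal.toReal_le_of_le_ofReal hC0 hC
  have e : ∀ y : ℝ, ((y - x) ^ 2 - v x) ^ 2 = (y - x) ^ 4 - 2 * v x * (y - x) ^ 2 + v x ^ 2 :=
    fun y => by ring
  refine ⟨?_, ?_, ?_⟩
  · simp only [e]
    exact (hi4.sub (hi2.const_mul _)).add (integrable_const _)
  · rw [integral_sub hi2 (integrable_const _), hP.var_eq x hx]; simp
  · simp only [e]
    rw [integral_add (f := fun y => (y - x) ^ 4 - 2 * v x * (y - x) ^ 2)
      (hi4.sub (hi2.const_mul _)) (integrable_const _), integral_sub hi4 (hi2.const_mul _),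
      integral_const_mul, hP.var_eq x hx]
    simp only [integral_const, probReal_univ, one_smul]
    nlinarith [sq_nonneg (v x)]

theorem experimentLaw_square_le [Nonempty (Fin K)] (hP : ∀ a, HasGaussianMGF θ₁ θ₂ S (v a) (P a))
    (hQ : ∀ a, Q.map (fun y => y a) = P a (μ a)) {c : Fin K}
    (hμ : μ c ∈ Set.Icc θ₁ θ₂) {C u : ℝ} (hC0 : 0 ≤ C) (hu : 0 < u)
    (hC : ∫⁻ y, ENNReal.ofReal ((y - μ c) ^ 4) ∂(P c (μ c)) ≤ ENNReal.ofReal C) :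
    experimentLaw r T Q {z | u ≤ |∑ t ∈ pilotRounds r T c, ((z.1 t c - μ c) ^ 2 - v c (μ c))|} ≤
      ENNReal.ofReal (T * C / u ^ 2) := by
  obtain ⟨h1, h2, h3⟩ := (hP c).sq_sub_var hμ hC hC0
  have hm : MeasurableSet {Y : Fin T → Fin K → ℝ |
      u ≤ |∑ t ∈ pilotRounds r T c, ((Y t c - μ c) ^ 2 - v c (μ c))|} := by
    refine measurableSet_le measurable_const (Measurable.abs ?_)
    exact Finset.measurable_fun_sum _ fun t _ =>
      (((measurable_apply_apply t c).sub_const _).pow_const _).sub_const _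
  refine (experimentLaw_fst_mem Q hm).le.trans ?_
  refine (pi_chebyshev Q _ c (g := fun y => (y - μ c) ^ 2 - v c (μ c)) (by fun_prop) (V := C)
    (by rw [hQ]; exact h1) (by rw [hQ]; exact h2) (by rw [hQ]; exact h3) hu).trans
    (ENNReal.ofReal_le_ofReal ?_)
  gcongr
  exact card_finset_fin_le _

/-- A pilot mean leaves the confidence interval with probability at most a negative power of `T`:
this is what the logarithm in the width of the intervals is for. -/
theorem experimentLaw_cover_le [Nonempty (Fin K)] (hP : ∀ a, HasGaussianMGF θ₁ θ₂ S (v a) (P a))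
    (hQ : ∀ a, Q.map (fun y => y a) = P a (μ a)) (hK : 0 < K) (hr0 : 0 < r) (hr1 : r ≤ 1)
    (hT : 2 ≤ r / K * T) {c : Fin K} {s₀ d : ℝ} (hs₀ : 0 < s₀) (hv : s₀ ≤ v c (μ c))
    (hvS : v c (μ c) ≤ S) (hd : S * (widthFactor K r T * √S / (2 * s₀)) ≤ d)
    (hμ : θ₁ + d ≤ μ c ∧ μ c + d ≤ θ₂)
    (hvd : ∀ s ∈ Set.Icc (μ c - d) (μ c + d), v c s ≤ 2 * v c (μ c)) :
    experimentLaw r T Q {z | pilotSize K r T * (widthFactor K r T * √(v c (μ c) / 2)) ≤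
      |pilotDev r μ z.1 c|} ≤ ENNReal.ofReal (2 * Real.exp (-(Real.log T / 16))) := by
  have hK0 : (0 : ℝ) < K := by exact_mod_cast hK
  obtain ⟨hm, -⟩ := half_le_pilotSize hK hr0 hT
  have hT0 : (0 : ℝ) < T := by
    by_contra hcon
    have := mul_nonpos_of_nonneg_of_nonpos (by positivity : 0 ≤ r / K) (not_lt.1 hcon)
    linarith
  have hT1 : (1 : ℝ) ≤ T := by exact_mod_cast (by exact_mod_cast hT0 : 0 < T)
  have hlog : 0 ≤ Real.log T := Real.log_nonneg hT1
  set L := widthFactor K r T with hL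
  have hL0 : 0 ≤ L := Real.sqrt_nonneg _
  have hL2 : L ^ 2 = Real.log T / (r / K * T) := by
    rw [hL, widthFactor, Real.sq_sqrt (by positivity)]; field_simp
  set x := v c (μ c) with hx
  have hx0 : 0 < x := hs₀.trans_le hv
  have hS0 : 0 < S := hx0.trans_le hvS
  set w := L * √(x / 2) with hw
  have hw2 : w ^ 2 = L ^ 2 * (x / 2) := by rw [hw, mul_pow, Real.sq_sqrt (by positivity)]
  have hl0 : 0 ≤ w / (2 * x) := by positivity
  have hld : S * (w / (2 * x)) ≤ d := by
    refine le_trans ?_ hd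
    rw [hw]
    gcongr
    linarith
  have hmeas : MeasurableSet {Y : Fin T → Fin K → ℝ | pilotSize K r T * w ≤ |pilotDev r μ Y c|} :=
    measurableSet_le measurable_const (measurable_pilotDev μ c).abs
  refine (experimentLaw_fst_mem Q hmeas).le.trans ?_
  refine (pi_sum_chernoff (T := T) hP hQ (M := 2 * x) hl0 (by positivity) (by linarith [hμ.1])
    (by linarith [hμ.2]) (fun s hs => hvd s ⟨by linarith [hs.1], by linarith [hs.2]⟩)
    (pilotRounds r T c) (card_pilotRounds hr0.le hr1 c).le).trans (ENNReal.ofReal_le_ofReal ?_)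
  gcongr
  have e : pilotSize K r T * ((w / (2 * x)) ^ 2 * (2 * x) / 2) - w / (2 * x) *
      (pilotSize K r T * w) = -(pilotSize K r T * L ^ 2 / 8) := by
    rw [div_pow, hw2]
    have : w / (2 * x) * (pilotSize K r T * w) = pilotSize K r T * w ^ 2 / (2 * x) := by ring
    rw [this, hw2]
    field_simp; ring
  rw [e, neg_le_neg_iff]
  calc Real.log T / 16 = r / K * T / 2 * (Real.log T / (r / K * T)) / 8 := by field_simp; ring
    _ ≤ pilotSize K r T * (Real.log T / (r / K * T)) / 8 := by gcongr
    _ = _ := by rw [hL2]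

/-- The union bound over the requirements on a typical run. -/
theorem experimentLaw_not_typical_le [Nonempty (Fin K)]
    (hP : ∀ a, HasGaussianMGF θ₁ θ₂ S (v a) (P a)) (hS : 0 < S)
    (hvS : ∀ a, ∀ s ∈ Set.Icc θ₁ θ₂, v a s ≤ S)
    (hQ : ∀ a, Q.map (fun y => y a) = P a (μ a)) (hK : 0 < K) (hr0 : 0 < r) (hr1 : r ≤ 1)
    (hT : 2 ≤ r / K * T) {s₀ δ η κ d ε l : ℝ} (hs₀ : 0 < s₀) (hv : ∀ c, s₀ ≤ v c (μ c))
    (hδ : 0 < δ) (hη : 0 < η) (hl0 : 0 ≤ l) (hl1 : l ≤ 1)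
    (hd : S * (widthFactor K r T * √S / (2 * s₀)) ≤ d) (hε0 : 0 < ε) (hε1 : ε ≤ 1) (hdε : d ≤ ε)
    (hδε : δ ≤ ε) (hμ : ∀ c, θ₁ + ε ≤ μ c ∧ μ c + ε ≤ θ₂)
    (hvd : ∀ c, ∀ s ∈ Set.Icc (μ c - d) (μ c + d), v c s ≤ 2 * v c (μ c)) :
    experimentLaw r T Q {z | ¬ IsTypical r δ η κ μ (fun c => v c (μ c)) z.1 z.2} ≤
      ENNReal.ofReal (K * (4 * Real.exp (-((r / K) ^ 2 * (T * δ ^ 2) / (128 * S))) +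
        T * (48 * S ^ 4 * Real.exp (1 / S) / ε ^ 4) / (pilotSize K r T * η) ^ 2 +
        2 * Real.exp (T * l ^ 2 - l * κ) + 2 * Real.exp (-(Real.log T / 16)))) := by
  have hK1 : (1 : ℝ) ≤ K := by exact_mod_cast hK
  have hρ0 : 0 < r / K := by positivity
  have hρ1 : r / K ≤ 1 := by rw [div_le_one (by positivity)]; linarith
  obtain ⟨hm, -⟩ := half_le_pilotSize hK hr0 hT
  have hm0 : (0 : ℝ) < pilotSize K r T := by linarith
  have hμ' : ∀ c, μ c ∈ Set.Icc θ₁ θ₂ := fun c => ⟨by linarith [hμ c], by linarith [hμ c]⟩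
  set p₁ := Real.exp (-((r / K) ^ 2 * (T * δ ^ 2) / (128 * S)))
  set C₄ := 48 * S ^ 4 * Real.exp (1 / S) / ε ^ 4 with hC₄
  set p₂ := T * C₄ / (pilotSize K r T * η) ^ 2
  set p₃ := Real.exp (T * l ^ 2 - l * κ)
  set p₄ := Real.exp (-(Real.log T / 16))
  have h1 : ∀ c, ∀ s : Finset (Fin T), s.card ≤ T → (Measure.pi fun _ : Fin T => Q)
      {Y | pilotSize K r T * (δ / 4) ≤ |∑ t ∈ s, (Y t c - μ c)|} ≤ ENNReal.ofReal (2 * p₁) :=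
    fun c s hs => pi_sum_subgaussian hP hvS hS hQ hρ0 hρ1 hδ hm (by linarith [hμ c])
      (by linarith [hμ c]) s hs
  set B : Fin K → Set ((Fin T → Fin K → ℝ) × (Fin T → Fin K)) := fun c =>
    ((({z | pilotSize K r T * (δ / 4) ≤ |pilotDev r μ z.1 c|} ∪
      {z | pilotSize K r T * (δ / 4) ≤ |secondDev r μ z.1 z.2 c|}) ∪
      {z | pilotSize K r T * η ≤
        |∑ t ∈ pilotRounds r T c, ((z.1 t c - μ c) ^ 2 - v c (μ c))|}) ∪
      {z | κ ≤ |((secondRounds r z.2 c).card : ℝ)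
        - secondStageSize K r T * secondStageProb r z.1 c|}) ∪
      {z | pilotSize K r T * (widthFactor K r T * √(v c (μ c) / 2)) ≤ |pilotDev r μ z.1 c|}
    with hB
  have hsub : {z : (Fin T → Fin K → ℝ) × (Fin T → Fin K) |
      ¬ IsTypical r δ η κ μ (fun c => v c (μ c)) z.1 z.2} ⊆ ⋃ c, B c := by
    intro z hz
    by_contra hcon
    simp only [hB, Set.mem_iUnion, Set.mem_union, Set.mem_ofPred_eq, not_exists, not_or,
      not_le] at hcon
    exact hz ⟨fun c => (hcon c).1.1.1.1, fun c => (hcon c).1.1.1.2, fun c => (hcon c).1.1.2,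
      fun c => (hcon c).1.2, fun c => (hcon c).2⟩
  have hBc : ∀ c, experimentLaw r T Q (B c) ≤
      ENNReal.ofReal (4 * p₁ + p₂ + 2 * p₃ + 2 * p₄) := by
    intro c
    have e : ENNReal.ofReal (4 * p₁ + p₂ + 2 * p₃ + 2 * p₄) = ENNReal.ofReal (2 * p₁) +
        ENNReal.ofReal (2 * p₁) + ENNReal.ofReal p₂ + ENNReal.ofReal (2 * p₃) +
        ENNReal.ofReal (2 * p₄) := by
      rw [← ENNReal.ofReal_add (by positivity) (by positivity),
        ← ENNReal.ofReal_add (by positivity) (by positivity),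
        ← ENNReal.ofReal_add (by positivity) (by positivity),
        ← ENNReal.ofReal_add (by positivity) (by positivity)]
      congr 1; ring
    rw [e]
    refine (measure_union_le _ _).trans (add_le_add ((measure_union_le _ _).trans (add_le_add
      ((measure_union_le _ _).trans (add_le_add ((measure_union_le _ _).trans
      (add_le_add ?_ ?_)) ?_)) ?_)) ?_)
    · exact experimentLaw_pilotDev_le (h1 c)
    · exact experimentLaw_secondDev_le (h1 c)
    · exact experimentLaw_square_le hP hQ (hμ' c) (by positivity) (by positivity)
        ((hP c).lintegral_pow_four_le (hvS c) hS hε0 hε1 (hμ c).1 (hμ c).2)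
    · exact experimentLaw_count_abs Q c hl0 hl1
    · exact experimentLaw_cover_le hP hQ hK hr0 hr1 hT hs₀ (hv c) (hvS c _ (hμ' c)) hd
        ⟨by linarith [hμ c], by linarith [hμ c]⟩ (hvd c)
  refine (measure_mono hsub).trans ((measure_iUnion_le _).trans ?_)
  rw [tsum_fintype]
  refine (Finset.sum_le_sum fun c _ => hBc c).trans (le_of_eq ?_)
  rw [Finset.sum_const, Finset.card_univ, Fintype.card_fin, nsmul_eq_mul,
    ENNReal.ofReal_mul (by positivity), ENNReal.ofReal_natCast]

end Atypical

/-! ### Wrong recommendations under near ties of two arms -/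

/-- The scale `T^{1/64}` on which the error terms are measured. -/
noncomputable def scale (T : ℕ) : ℝ := (T : ℝ) ^ (1 / 64 : ℝ)

theorem scale_pow (T : ℕ) : scale T ^ 64 = T := by
  rw [scale, ← Real.rpow_natCast, ← Real.rpow_mul T.cast_nonneg]
  norm_num

theorem tendsto_scale : Tendsto scale atTop atTop :=
  (tendsto_rpow_atTop (by norm_num)).comp tendsto_natCast_atTop_atTop

theorem exp_neg_le_two_div_sq {y : ℝ} (hy : 0 < y) : Real.exp (-y) ≤ 2 / y ^ 2 := by
  rw [Real.exp_neg, inv_le_comm₀ (Real.exp_pos _) (by positivity), inv_div]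
  linarith [Real.quadratic_le_exp_of_nonneg hy.le]

/-- The error terms of `experimentLaw_not_typical_le` on the scale `x = T^{1/64}`. -/
theorem atypical_sum_le {T : ℕ} {x ρ S C₄ m : ℝ} (h1 : 1 ≤ x) (hxT : x ^ 64 = T) (hρ0 : 0 < ρ)
    (hS : 0 < S) (hC₄0 : 0 ≤ C₄) (hmη : ρ * x ^ 56 / 2 ≤ m * (1 / x ^ 8)) :
    4 * Real.exp (-(ρ ^ 2 * (T * (1 / x ^ 31) ^ 2) / (128 * S))) +
      T * (C₄ / (1 / x ^ 8) ^ 4) / (m * (1 / x ^ 8)) ^ 2 +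
      2 * Real.exp (T * (1 / x ^ 8 / 2) ^ 2 - 1 / x ^ 8 / 2 * x ^ 56) +
      2 * Real.exp (-(Real.log T / 16)) ≤
    (4 * (2 * (128 * S) ^ 2 / ρ ^ 4) + 4 * C₄ / ρ ^ 2 + 2 * 32 + 2 * 1) / x ^ 4 := by
  have hx0 : 0 < x := by linarith
  rw [add_div, add_div, add_div]
  refine add_le_add (add_le_add (add_le_add ?_ ?_) ?_) ?_
  · calc 4 * Real.exp (-(ρ ^ 2 * (T * (1 / x ^ 31) ^ 2) / (128 * S)))
        = 4 * Real.exp (-(ρ ^ 2 * x ^ 2 / (128 * S))) := by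
          congr 4
          rw [← hxT]; field_simp
      _ ≤ 4 * (2 / (ρ ^ 2 * x ^ 2 / (128 * S)) ^ 2) := by
          gcongr; exact exp_neg_le_two_div_sq (by positivity)
      _ = 4 * (2 * (128 * S) ^ 2 / ρ ^ 4) / x ^ 4 := by field_simp
  · calc T * (C₄ / (1 / x ^ 8) ^ 4) / (m * (1 / x ^ 8)) ^ 2
        ≤ T * (C₄ / (1 / x ^ 8) ^ 4) / (ρ * x ^ 56 / 2) ^ 2 := by gcongr
      _ = 4 * C₄ / ρ ^ 2 / x ^ 16 := by rw [← hxT]; field_simp; norm_num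
      _ ≤ 4 * C₄ / ρ ^ 2 / x ^ 4 := by
          gcongr
          norm_num
  · calc 2 * Real.exp (T * (1 / x ^ 8 / 2) ^ 2 - 1 / x ^ 8 / 2 * x ^ 56)
        = 2 * Real.exp (-(x ^ 48 / 4)) := by
          congr 2
          rw [← hxT]; field_simp; ring
      _ ≤ 2 * (2 / (x ^ 48 / 4) ^ 2) := by
          gcongr; exact exp_neg_le_two_div_sq (by positivity)
      _ = 2 * 32 / x ^ 96 := by field_simp; norm_num
      _ ≤ 2 * 32 / x ^ 4 := by
          gcongr
          norm_num
  · rw [← hxT, Real.log_pow, show -(((64 : ℕ) : ℝ) * Real.log x / 16) = -((4 : ℕ) * Real.log x) by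
      push_cast; ring, Real.exp_neg, Real.exp_nat_mul, Real.exp_log hx0, mul_one, div_eq_mul_inv]

section NearTie

variable {K : ℕ} {r θ₁ θ₂ S s₀ : ℝ} {v : Fin K → ℝ → ℝ} {P : Fin K → ℝ → Measure ℝ}

theorem widthFactor_le {T : ℕ} {x : ℝ} (hx : 1 ≤ x) (hxT : x ^ 64 = T) (hK : 0 < K) (hr0 : 0 < r) :
    widthFactor K r T ≤ 8 / √(r / K) / x ^ 31 := by
  have hx0 : 0 < x := by linarith
  have hK0 : (0 : ℝ) < K := by exact_mod_cast hK
  have hρ0 : 0 < r / K := by positivity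
  refine Real.sqrt_le_iff.2 ⟨by positivity, ?_⟩
  rw [← hxT, Real.log_pow, div_pow, div_pow, Real.sq_sqrt hρ0.le]
  have hl := Real.log_le_self hx0.le
  calc K * (((64 : ℕ) : ℝ) * Real.log x) / (r * x ^ 64)
      ≤ K * (((64 : ℕ) : ℝ) * x ^ 2) / (r * x ^ 64) := by
        gcongr; nlinarith
    _ = 8 ^ 2 / (r / K) / (x ^ 31) ^ 2 := by
        push_cast; field_simp; norm_num

theorem exists_modulus (hs₀ : 0 < s₀) (hv : ∀ a, ∀ s ∈ Set.Icc θ₁ θ₂, s₀ ≤ v a s)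
    (hvc : ∀ a, ContinuousOn (v a) (Set.Icc θ₁ θ₂)) {e : ℝ} (he : 0 < e) :
    ∃ d > 0, ∀ a, ∀ x ∈ Set.Icc θ₁ θ₂, ∀ y ∈ Set.Icc θ₁ θ₂, |x - y| ≤ d →
      v a x ≤ (1 + e) * v a y := by
  have h1 : ∀ a, ∃ d > 0, ∀ x ∈ Set.Icc θ₁ θ₂, ∀ y ∈ Set.Icc θ₁ θ₂, |x - y| < d →
      |v a x - v a y| < e * s₀ := by
    intro a
    have := isCompact_Icc.uniformContinuousOn_of_continuous (hvc a)
    rw [Metric.uniformContinuousOn_iff] at this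
    obtain ⟨d, hd, h⟩ := this (e * s₀) (by positivity)
    exact ⟨d, hd, fun x hx y hy hxy => h x hx y hy hxy⟩
  choose D hD hDv using h1
  obtain ⟨d, hd, hdD⟩ : ∃ d > 0, ∀ a, d < D a := by
    rcases isEmpty_or_nonempty (Fin K) with h | h
    · exact ⟨1, one_pos, fun a => (IsEmpty.false a).elim⟩
    · obtain ⟨a, ha⟩ := Finite.exists_min D
      exact ⟨D a / 2, half_pos (hD a), fun b => (half_lt_self (hD a)).trans_le (ha b)⟩
  refine ⟨d, hd, fun a x hx y hy hxy => ?_⟩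
  have h2 := (abs_lt.1 (hDv a x hx y hy (hxy.trans_lt (hdD a)))).2
  have h3 : e * s₀ ≤ e * v a y := by gcongr; exact hv a y hy
  linarith

set_option maxHeartbeats 1000000 in
/-- If the means of `a` and `b` are very close and all other means are clearly smaller, then the
probability that the worse arm `a` is recommended has a Gaussian bound. With `T = x ^ 64`, the
bound `x⁻³¹` for the gap is large compared to the standard error `x⁻³²`, and `x⁻¹⁶` is large
compared to the width of the confidence intervals. -/
theorem eventually_recommend_le [Nonempty (Fin K)]
    (hP : ∀ a, HasGaussianMGF θ₁ θ₂ S (v a) (P a)) (hS : 0 < S)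
    (hvS : ∀ a, ∀ s ∈ Set.Icc θ₁ θ₂, v a s ≤ S) (hs₀ : 0 < s₀)
    (hv : ∀ a, ∀ s ∈ Set.Icc θ₁ θ₂, s₀ ≤ v a s)
    (hvc : ∀ a, ContinuousOn (v a) (Set.Icc θ₁ θ₂)) (hK : 2 ≤ K) (hr0 : 0 < r) (hr1 : r < 1)
    {e : ℝ} (he0 : 0 < e) (he1 : e < 1) :
    ∃ C, 0 ≤ C ∧ ∀ᶠ T : ℕ in atTop, ∀ (Q : Measure (Fin K → ℝ)) (μ : Fin K → ℝ),
      IsProbabilityMeasure Q → (∀ a, Q.map (fun y => y a) = P a (μ a)) →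
      (∀ c, θ₁ + 1 / scale T ^ 8 ≤ μ c ∧ μ c + 1 / scale T ^ 8 ≤ θ₂) → ∀ a b, μ a < μ b →
      μ b - μ a ≤ 1 / scale T ^ 31 →
      (∀ c, c ≠ a → c ≠ b → μ c + 1 / scale T ^ 16 ≤ μ b) →
      experimentLaw r T Q {z | recommend r z.1 z.2 = a} ≤ ENNReal.ofReal
        ((1 + e) * Real.exp (-((1 - e) * (T * (μ b - μ a) ^ 2 /
          (2 * (2 * (v a (μ a) + v b (μ b)) / (1 - (K - 2) * (r / K))))))) + C / scale T ^ 4) := by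
  have hK2 : (2 : ℝ) ≤ K := by exact_mod_cast hK
  have hK0 : (0 : ℝ) < K := by linarith
  obtain ⟨d₀, hd₀, hmod⟩ := exists_modulus hs₀ hv hvc (by linarith : 0 < e / 4)
  set ρ := r / K with hρdef
  have hρ0 : 0 < ρ := by positivity
  have hKρ : K * ρ < 1 := by rw [hρdef, mul_div_cancel₀ _ hK0.ne']; exact hr1
  have hρ2 : 2 * ρ < 1 := by nlinarith
  have hsρ : 0 < √ρ := Real.sqrt_pos.2 hρ0
  -- `C₁ / ρ / x ^ 8` bounds the relative error of the numbers of observations of the two arms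
  set C₁ : ℝ := 2 + K + 4 / s₀ / (1 - 2 * ρ) with hC₁
  have hC₁0 : 0 < C₁ := by
    have : 0 < 1 - 2 * ρ := by linarith
    positivity
  set C₄ : ℝ := 48 * S ^ 4 * Real.exp (1 / S) with hC₄
  have hC₄0 : 0 < C₄ := by positivity
  have hlog : 0 < Real.log (1 + e) := Real.log_pos (by linarith)
  refine ⟨K * (4 * (2 * (128 * S) ^ 2 / ρ ^ 4) + 4 * C₄ / ρ ^ 2 + 2 * 32 + 2 * 1),
    by positivity, ?_⟩
  filter_upwards [tendsto_scale.eventually_ge_atTop 1, tendsto_scale.eventually_ge_atTop (4 / ρ),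
    tendsto_scale.eventually_ge_atTop (4 * S / ρ), tendsto_scale.eventually_ge_atTop (8 / s₀),
    tendsto_scale.eventually_ge_atTop (C₁ / ρ * (4 / e)),
    tendsto_scale.eventually_ge_atTop (S / (4 * s₀ * ρ)),
    tendsto_scale.eventually_ge_atTop (S * (8 / √ρ) * √S / (2 * s₀)),
    tendsto_scale.eventually_ge_atTop (2 * ((8 / √ρ) * √(2 * S)) + 1),
    tendsto_scale.eventually_ge_atTop (1 / d₀),
    tendsto_scale.eventually_ge_atTop (C₁ / (4 * ρ * s₀) / Real.log (1 + e))]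
    with T h1 h2 h3 h4 h5 h6 h7 h8 h9 h10 Q μ hQ1 hQ hμ a b hab habδ hgap
  set x := scale T with hxdef
  have hxT : x ^ 64 = T := scale_pow T
  have hx0 : 0 < x := by linarith
  have hle : ∀ {B : ℝ} (n : ℕ), n ≠ 0 → B ≤ x → B ≤ x ^ n := fun n hn hB =>
    hB.trans (le_self_pow₀ h1 hn)
  have hμ' : ∀ c, μ c ∈ Set.Icc θ₁ θ₂ := fun c => by
    have : 0 < 1 / x ^ 8 := by positivity
    exact ⟨by linarith [hμ c], by linarith [hμ c]⟩
  have hρT : 4 ≤ ρ * T := by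
    rw [← hxT]
    have := hle 64 (by norm_num) h2
    rwa [div_le_iff₀ hρ0, mul_comm] at this
  obtain ⟨hm, -⟩ := half_le_pilotSize (by omega) hr0 (by linarith : 2 ≤ r / K * T)
  rw [← hρdef] at hm
  have hL : widthFactor K r T ≤ 8 / √ρ / x ^ 31 := widthFactor_le h1 hxT (by omega) hr0
  have h9' : 1 / x ^ 8 ≤ d₀ := by
    have := hle 8 (by norm_num) h9
    rw [div_le_iff₀ hd₀] at this
    rwa [div_le_iff₀ (by positivity), mul_comm]
  have hvd : ∀ c, ∀ s ∈ Set.Icc (μ c - 1 / x ^ 8) (μ c + 1 / x ^ 8),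
      v c s ≤ (1 + e / 4) * v c (μ c) := fun c s hs =>
    hmod c s ⟨by linarith [hμ c, hs.1], by linarith [hμ c, hs.2]⟩ _ (hμ' c)
      (abs_le.2 ⟨by linarith [hs.1], by linarith [hs.2]⟩ |>.trans h9')
  have hδε : 1 / x ^ 31 ≤ 1 / x ^ 8 := by
    gcongr
    norm_num
  have hmη : ρ * x ^ 56 / 2 ≤ pilotSize K r T * (1 / x ^ 8) := by
    calc ρ * x ^ 56 / 2 = ρ * x ^ 64 / 2 * (1 / x ^ 8) := by field_simp
      _ ≤ _ := by rw [hxT]; gcongr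
  -- typical runs
  have htyp := experimentLaw_typical_le (r := r) (T := T) (Q := Q) (δ := 1 / x ^ 31)
    (η := 1 / x ^ 8) (κ := x ^ 56) (τ := 4 / x ^ 8) (d := 1 / x ^ 8) (e₁ := C₁ / ρ / x ^ 8)
    (e₂ := e / 4) (e := e) hP hS hQ hK hr0 hr1 hs₀ (fun c => hv c _ (hμ' c))
    (fun c => hvS c _ (hμ' c)) hρT (by positivity) (by
      have a1 : S ≤ ρ * x ^ 56 / 4 := by
        have := hle 56 (by norm_num) h3
        rw [div_le_iff₀ hρ0] at this
        linarith
      have a2 : pilotSize K r T * (1 / x ^ 31 / 4) ^ 2 ≤ pilotSize K r T * (1 / x ^ 8) / 16 := by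
        have : (1 / x ^ 31 / 4) ^ 2 ≤ 1 / x ^ 8 / 16 := by
          have b1 : (1 / x ^ 31) ^ 2 ≤ 1 / x ^ 31 :=
            pow_le_of_le_one (by positivity) (by
              rw [div_le_one (by positivity)]; exact one_le_pow₀ h1) two_ne_zero
          nlinarith
        calc _ ≤ pilotSize K r T * (1 / x ^ 8 / 16) := by gcongr
          _ = _ := by ring
      have a3 : (2 : ℝ) ≤ pilotSize K r T := by linarith
      have a4 : 0 < 1 / x ^ 8 := by positivity
      have a5 : (4 : ℝ) / x ^ 8 = 4 * (1 / x ^ 8) := by ring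
      rw [a5]
      nlinarith)
    (by
      have := hle 8 (by norm_num) h4
      rw [div_le_iff₀ hs₀] at this
      rw [← mul_div_assoc, div_le_iff₀ (by positivity)]
      linarith)
    (by
      have a1 : 1 ≤ x ^ 56 := one_le_pow₀ h1
      have a2 : C₁ / ρ / x ^ 8 * (r / K * T) = C₁ * x ^ 56 := by
        rw [← hρdef, ← hxT]; field_simp
      have a3 : T * (4 / x ^ 8 / s₀ / (1 - 2 * (r / K))) = 4 / s₀ / (1 - 2 * ρ) * x ^ 56 := by
        rw [← hρdef, ← hxT]
        have : x ^ 64 = x ^ 56 * x ^ 8 := by ring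
        rw [this]
        have h0 : (1 - 2 * ρ) ≠ 0 := by linarith
        have h0' : x ^ 8 ≠ 0 := by positivity
        calc x ^ 56 * x ^ 8 * (4 / x ^ 8 / s₀ / (1 - 2 * ρ)) =
            (x ^ 8 / x ^ 8) * (4 / s₀ / (1 - 2 * ρ) * x ^ 56) := by ring
          _ = _ := by rw [div_self h0', one_mul]
      rw [a2, a3, hC₁]
      nlinarith)
    (by linarith) (by
      have a1 : C₁ / ρ / x ^ 8 ≤ e / 4 := by
        have := hle 8 (by norm_num) h5
        rw [div_le_iff₀ (by positivity)]
        calc C₁ / ρ = C₁ / ρ * (4 / e) * (e / 4) := by field_simp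
          _ ≤ x ^ 8 * (e / 4) := by gcongr
          _ = _ := by ring
      have a2 : 0 ≤ C₁ / ρ / x ^ 8 := by positivity
      nlinarith)
    (by
      have := hle 23 (by norm_num) h6
      rw [← hρdef]
      calc S * (1 / x ^ 31) / (4 * s₀ * ρ) = S / (4 * s₀ * ρ) * (1 / x ^ 31) := by ring
        _ ≤ x ^ 23 * (1 / x ^ 31) := by gcongr
        _ = 1 / x ^ 8 := by field_simp)
    hμ hvd hab habδ (by
      intro c hca hcb
      refine le_trans ?_ (hgap c hca hcb)
      have := hle 15 (by norm_num) h8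
      gcongr
      calc 2 * (widthFactor K r T * √(2 * S)) + 1 / x ^ 31
          ≤ 2 * (8 / √ρ / x ^ 31 * √(2 * S)) + 1 / x ^ 31 := by gcongr
        _ = (2 * ((8 / √ρ) * √(2 * S)) + 1) * (1 / x ^ 31) := by ring
        _ ≤ x ^ 15 * (1 / x ^ 31) := by gcongr
        _ = 1 / x ^ 16 := by field_simp) rfl
  -- atypical runs
  have hatyp := experimentLaw_not_typical_le (r := r) (T := T) (Q := Q) (δ := 1 / x ^ 31)
    (η := 1 / x ^ 8) (κ := x ^ 56) (d := 1 / x ^ 8) (ε := 1 / x ^ 8) (l := 1 / x ^ 8 / 2) hP hS hvS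
    hQ (by omega) hr0 hr1.le (by linarith : 2 ≤ ρ * T) hs₀ (fun c => hv c _ (hμ' c))
    (by positivity) (by positivity) (by positivity) (by
      have : 1 / x ^ 8 ≤ 1 := by rw [div_le_one (by positivity)]; exact one_le_pow₀ h1
      linarith)
    (by
      have := hle 23 (by norm_num) h7
      calc S * (widthFactor K r T * √S / (2 * s₀)) ≤ S * (8 / √ρ / x ^ 31 * √S / (2 * s₀)) := by
            gcongr
        _ = S * (8 / √ρ) * √S / (2 * s₀) * (1 / x ^ 31) := by ring
        _ ≤ x ^ 23 * (1 / x ^ 31) := by gcongr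
        _ = 1 / x ^ 8 := by field_simp)
    (by positivity) (by rw [div_le_one (by positivity)]; exact one_le_pow₀ h1) le_rfl hδε hμ
    (fun c s hs => (hvd c s hs).trans (by
      have := hs₀.trans_le (hv c _ (hμ' c))
      gcongr; linarith))
  have hsplit : {z : (Fin T → Fin K → ℝ) × (Fin T → Fin K) | recommend r z.1 z.2 = a} ⊆
      {z | recommend r z.1 z.2 = a ∧
        IsTypical r (1 / x ^ 31) (1 / x ^ 8) (x ^ 56) μ (fun c => v c (μ c)) z.1 z.2} ∪
      {z | ¬ IsTypical r (1 / x ^ 31) (1 / x ^ 8) (x ^ 56) μ (fun c => v c (μ c)) z.1 z.2} := by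
    intro z hz
    by_cases h : IsTypical r (1 / x ^ 31) (1 / x ^ 8) (x ^ 56) μ (fun c => v c (μ c)) z.1 z.2
    · exact Or.inl ⟨hz, h⟩
    · exact Or.inr h
  refine (measure_mono hsplit).trans ((measure_union_le _ _).trans
    ((add_le_add htyp hatyp).trans ?_))
  rw [← ENNReal.ofReal_add (by positivity) (by positivity)]
  refine ENNReal.ofReal_le_ofReal (add_le_add ?_ ?_)
  · -- the random numbers of observations change the exponent by at most `log (1 + e)`
    set V := 2 * (v a (μ a) + v b (μ b)) / (1 - (K - 2) * ρ) with hV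
    have hc0 : 0 < 1 - (K - 2) * ρ := by nlinarith
    have hV4 : 4 * s₀ ≤ V := by
      rw [hV, le_div_iff₀ hc0]
      have : 4 * s₀ * (1 - (K - 2) * ρ) ≤ 4 * s₀ * 1 := by
        gcongr
        have : 0 ≤ (K - 2) * ρ := mul_nonneg (by linarith) hρ0.le
        linarith
      linarith [hv a _ (hμ' a), hv b _ (hμ' b)]
    have hmis : C₁ / ρ / x ^ 8 * (1 / x ^ 31) * (μ b - μ a) * T / V ≤ Real.log (1 + e) := by
      have := hle 6 (by norm_num) h10
      rw [div_le_iff₀ hlog] at this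
      calc C₁ / ρ / x ^ 8 * (1 / x ^ 31) * (μ b - μ a) * T / V
          ≤ C₁ / ρ / x ^ 8 * (1 / x ^ 31) * (1 / x ^ 31) * T / (4 * s₀) := by gcongr
        _ = C₁ / (4 * ρ * s₀) / x ^ 6 := by rw [← hxT]; field_simp
        _ ≤ Real.log (1 + e) := by rw [div_le_iff₀ (by positivity)]; linarith
    rw [neg_sub, sub_eq_add_neg, Real.exp_add]
    gcongr
    calc _ ≤ Real.exp (Real.log (1 + e)) := Real.exp_le_exp.2 hmis
      _ = 1 + e := Real.exp_log (by linarith)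
  · rw [mul_div_assoc (K : ℝ)]
    exact mul_le_mul_of_nonneg_left (atypical_sum_le h1 hxT hρ0 hS hC₄0.le hmη) hK0.le

end NearTie

/-! ### Conditional densities of the prior -/

section Prior

variable {K : ℕ} {θ₁ θ₂ : ℝ} {H : Measure (Fin K → ℝ)}
  {h : (a : Fin K) → ℝ → ({b : Fin K // b ≠ a} → ℝ) → ℝ}

theorem measurable_drop (a : Fin K) : Measurable (drop a) :=
  measurable_pi_lambda _ fun b => measurable_pi_apply b.1

instance [IsProbabilityMeasure H] (a : Fin K) : IsProbabilityMeasure (marginal H a) :=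
  Measure.isProbabilityMeasure_map (measurable_drop a).aemeasurable

theorem ae_marginal_mem {s : Set ℝ} (hs : MeasurableSet s) (hH : ∀ᵐ μ ∂H, ∀ a, μ a ∈ s)
    (a : Fin K) : ∀ᵐ ν ∂(marginal H a), ∀ c, ν c ∈ s := by
  have hm : MeasurableSet {ν : {b : Fin K // b ≠ a} → ℝ | ∀ c, ν c ∈ s} := by
    rw [Set.ofPred_forall]
    exact MeasurableSet.iInter fun c => measurable_pi_apply c hs
  rw [marginal, ae_map_iff (measurable_drop a).aemeasurable hm]
  filter_upwards [hH] with μ hμ c using hμ c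

/-- Disintegration of the prior along coordinate `a`. -/
theorem HasUnifContCondDensity.lintegral_drop (hh : HasUnifContCondDensity (Set.Icc θ₁ θ₂) H h)
    (a : Fin K) {G : ({b : Fin K // b ≠ a} → ℝ) × ℝ → ℝ≥0∞} (hG : Measurable G) :
    ∫⁻ μ, G (drop a μ, μ a) ∂H =
      ∫⁻ ν, (∫⁻ y in Set.Icc θ₁ θ₂, ENNReal.ofReal (h a y ν) * G (ν, y)) ∂(marginal H a) := by
  have hm : Measurable fun p : ({b : Fin K // b ≠ a} → ℝ) × ℝ => ENNReal.ofReal (h a p.2 p.1) :=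
    (hh.measurable a).ennreal_ofReal
  rw [← lintegral_map hG ((measurable_drop a).prodMk (measurable_pi_apply a)), hh.density a,
    lintegral_withDensity_eq_lintegral_mul _ hm hG, lintegral_prod _ (hm.mul hG).aemeasurable]
  rfl

theorem HasUnifContCondDensity.lintegral_eq_one [IsProbabilityMeasure H]
    (hh : HasUnifContCondDensity (Set.Icc θ₁ θ₂) H h)
    (a : Fin K) : ∀ᵐ ν ∂(marginal H a), ∫⁻ y in Set.Icc θ₁ θ₂, ENNReal.ofReal (h a y ν) = 1 := by
  have hm : Measurable fun p : ({b : Fin K // b ≠ a} → ℝ) × ℝ => ENNReal.ofReal (h a p.2 p.1) :=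
    (hh.measurable a).ennreal_ofReal
  refine ae_eq_of_forall_setLIntegral_eq_of_sigmaFinite hm.lintegral_prod_right' measurable_const
    fun B hB _ => ?_
  have hBm : Measurable (B.indicator fun _ => (1 : ℝ≥0∞)) := measurable_const.indicator hB
  have h1 := hh.lintegral_drop a (G := fun p => B.indicator (fun _ => 1) p.1)
    (hBm.comp measurable_fst)
  have h2 : ∫⁻ μ, B.indicator (fun _ => (1 : ℝ≥0∞)) (drop a μ) ∂H = marginal H a B := by
    rw [← lintegral_map hBm (measurable_drop a), lintegral_indicator_const hB, one_mul]; rfl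
  simp only [h2] at h1
  rw [setLIntegral_const, one_mul, h1, ← lintegral_indicator hB]
  refine lintegral_congr fun ν => ?_
  by_cases hν : ν ∈ B <;> simp [hν]

/-- The conditional densities are bounded: they have integral one and a common modulus of
continuity. -/
theorem HasUnifContCondDensity.exists_bound [IsProbabilityMeasure H]
    (hh : HasUnifContCondDensity (Set.Icc θ₁ θ₂) H h)
    (hθ : θ₁ < θ₂) (hH : ∀ᵐ μ ∂H, ∀ a, μ a ∈ Set.Icc θ₁ θ₂) :
    ∃ C > 0, ∀ a, ∀ᵐ ν ∂(marginal H a), ∀ y ∈ Set.Icc θ₁ θ₂, h a y ν ≤ C := by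
  obtain ⟨d, hd, hmod⟩ := hh.unifCont 1 one_pos
  set l := min d ((θ₂ - θ₁) / 2) with hl
  have hl0 : 0 < l := lt_min hd (by linarith)
  refine ⟨1 + 1 / l, by positivity, fun a => ?_⟩
  filter_upwards [hh.lintegral_eq_one a, ae_marginal_mem measurableSet_Icc hH a] with ν h1 hν y hy
  by_contra hcon
  rw [not_le] at hcon
  have key : ∀ u, u ≤ y → y ≤ u + l → Set.Icc u (u + l) ⊆ Set.Icc θ₁ θ₂ → False := by
    intro u hu1 hu2 hsub
    have h2 : ∫⁻ _ in Set.Icc u (u + l), ENNReal.ofReal (h a y ν - 1) ≤ 1 := by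
      rw [← h1]
      refine le_trans ?_ (lintegral_mono_set hsub)
      refine setLIntegral_mono' measurableSet_Icc fun s hs => ENNReal.ofReal_le_ofReal ?_
      have := hmod a y hy s (hsub hs) (abs_le.2 ⟨by
        linarith [hs.1, hs.2, min_le_left d ((θ₂ - θ₁) / 2)], by
        linarith [hs.1, hs.2, min_le_left d ((θ₂ - θ₁) / 2)]⟩) ν hν
      linarith [(abs_le.1 this).2]
    rw [setLIntegral_const, Real.volume_Icc, add_sub_cancel_left,
      ← ENNReal.ofReal_mul (by have : 0 < 1 / l := by positivity
                               linarith), ENNReal.ofReal_le_one] at h2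
    have h3 : 1 / l < h a y ν - 1 := by linarith
    rw [div_lt_iff₀ hl0] at h3
    linarith
  have hl2 := min_le_right d ((θ₂ - θ₁) / 2)
  rcases le_total (y + l) θ₂ with h2 | h2
  · exact key y le_rfl (by linarith) fun s hs => ⟨by linarith [hs.1, hy.1], by linarith [hs.2]⟩
  · exact key (y - l) (by linarith) (by linarith) fun s hs =>
      ⟨by linarith [hs.1], by linarith [hs.2, hy.2]⟩

/-- A bound for the conditional densities turns integrals over the prior into Lebesgue
integrals in one coordinate. -/
theorem HasUnifContCondDensity.lintegral_drop_le (hh : HasUnifContCondDensity (Set.Icc θ₁ θ₂) H h)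
    {C : ℝ} {a : Fin K} (hC : ∀ᵐ ν ∂(marginal H a), ∀ y ∈ Set.Icc θ₁ θ₂, h a y ν ≤ C)
    {G : ({b : Fin K // b ≠ a} → ℝ) × ℝ → ℝ≥0∞} (hG : Measurable G) :
    ∫⁻ μ, G (drop a μ, μ a) ∂H ≤
      ENNReal.ofReal C * ∫⁻ ν, (∫⁻ y in Set.Icc θ₁ θ₂, G (ν, y)) ∂(marginal H a) := by
  rw [hh.lintegral_drop a hG, ← lintegral_const_mul _ hG.lintegral_prod_right']
  refine lintegral_mono_ae ?_
  filter_upwards [hC] with ν hν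
  rw [← lintegral_const_mul _ (f := fun y => G (ν, y)) (hG.comp measurable_prodMk_left)]
  refine setLIntegral_mono' measurableSet_Icc fun y hy => ?_
  gcongr
  exact hν y hy

/-- The same for an integrand that factorizes into a function of the other coordinates and a
function of the difference to one of them. -/
theorem HasUnifContCondDensity.lintegral_mul_le (hh : HasUnifContCondDensity (Set.Icc θ₁ θ₂) H h)
    {C : ℝ} {a : Fin K} (hC : ∀ᵐ ν ∂(marginal H a), ∀ y ∈ Set.Icc θ₁ θ₂, h a y ν ≤ C)
    {g : ({b : Fin K // b ≠ a} → ℝ) → ℝ≥0∞} (hg : Measurable g) {φ : ℝ → ℝ≥0∞} (hφ : Measurable φ)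
    {ξ : ({b : Fin K // b ≠ a} → ℝ) → ℝ} (hξ : Measurable ξ) :
    ∫⁻ μ, g (drop a μ) * φ (ξ (drop a μ) - μ a) ∂H ≤
      ENNReal.ofReal C * ((∫⁻ μ, g (drop a μ) ∂H) * ∫⁻ u, φ u) := by
  have hG : Measurable fun p : ({b : Fin K // b ≠ a} → ℝ) × ℝ => g p.1 * φ (ξ p.1 - p.2) :=
    (hg.comp measurable_fst).mul (hφ.comp ((hξ.comp measurable_fst).sub measurable_snd))
  refine (hh.lintegral_drop_le hC hG).trans ?_
  gcongr
  rw [← lintegral_map hg (measurable_drop a), ← lintegral_mul_const _ hg]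
  refine lintegral_mono fun ν => ?_
  simp only
  rw [lintegral_const_mul _ (f := fun y => φ (ξ ν - y))
    (hφ.comp (measurable_const.sub measurable_id))]
  refine mul_le_mul_right ((setLIntegral_le_lintegral _ _).trans (le_of_eq ?_)) _
  exact lintegral_sub_left_eq_self φ (ξ ν)

variable [IsProbabilityMeasure H]

theorem HasUnifContCondDensity.measure_coord_mem_le
    (hh : HasUnifContCondDensity (Set.Icc θ₁ θ₂) H h) {C : ℝ} {a : Fin K}
    (hC : ∀ᵐ ν ∂(marginal H a), ∀ y ∈ Set.Icc θ₁ θ₂, h a y ν ≤ C) {B : Set ℝ}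
    (hB : MeasurableSet B) : H {μ | μ a ∈ B} ≤ ENNReal.ofReal C * volume B := by
  have hm : Measurable fun p : ({b : Fin K // b ≠ a} → ℝ) × ℝ =>
      B.indicator (fun _ => (1 : ℝ≥0∞)) p.2 := (measurable_const.indicator hB).comp measurable_snd
  have h1 := hh.lintegral_drop_le hC hm
  have h2 : ∫⁻ μ, B.indicator (fun _ => (1 : ℝ≥0∞)) (μ a) ∂H = H {μ | μ a ∈ B} :=
    (lintegral_indicator_const (measurable_pi_apply a hB) 1).trans (one_mul _)
  simp only [h2] at h1
  refine h1.trans ?_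
  gcongr
  rw [lintegral_const, measure_univ, mul_one]
  refine (setLIntegral_le_lintegral _ _).trans (le_of_eq ?_)
  rw [lintegral_indicator_const hB, one_mul]

/-- Near ties of two given arms: the conditional density of arm `a` given the others,
among them `b`, is bounded. -/
theorem HasUnifContCondDensity.measure_abs_sub_le
    (hh : HasUnifContCondDensity (Set.Icc θ₁ θ₂) H h) {C : ℝ} {a b : Fin K} (hab : b ≠ a)
    (hC : ∀ᵐ ν ∂(marginal H a), ∀ y ∈ Set.Icc θ₁ θ₂, h a y ν ≤ C) {g : ℝ} (hg : 0 ≤ g) :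
    H {μ | |μ a - μ b| ≤ g} ≤ ENNReal.ofReal (C * (2 * g)) := by
  have hB : MeasurableSet (Set.Icc (-g) g) := measurableSet_Icc
  have h1 := hh.lintegral_mul_le hC (g := fun _ => 1) measurable_const
    (φ := (Set.Icc (-g) g).indicator fun _ => 1) (measurable_const.indicator hB)
    (ξ := fun ν => ν ⟨b, hab⟩) (measurable_pi_apply _)
  have h2 : ∫⁻ u, (Set.Icc (-g) g).indicator (fun _ => (1 : ℝ≥0∞)) u = ENNReal.ofReal (2 * g) := by
    rw [lintegral_indicator_const hB, one_mul, Real.volume_Icc]; congr 1; ring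
  have h3 : ∫⁻ μ, 1 *
      (Set.Icc (-g) g).indicator (fun _ => (1 : ℝ≥0∞)) (drop a μ ⟨b, hab⟩ - μ a) ∂H =
      H {μ | |μ a - μ b| ≤ g} := by
    have e : {μ : Fin K → ℝ | |μ a - μ b| ≤ g} = (fun μ => μ b - μ a) ⁻¹' Set.Icc (-g) g := by
      ext μ
      rw [Set.mem_ofPred_eq, abs_le, Set.mem_preimage, Set.mem_Icc]
      constructor <;> rintro ⟨h1, h2⟩ <;> constructor <;> linarith
    have hm : Measurable fun μ : Fin K → ℝ => μ b - μ a :=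
      (measurable_pi_apply b).sub (measurable_pi_apply a)
    rw [e, ← one_mul (H _), ← lintegral_indicator_const (hm hB)]
    refine lintegral_congr fun μ => ?_
    rw [one_mul]; rfl
  simp only [lintegral_const, measure_univ, one_mul, h2] at h1 
  simp only [one_mul] at h3
  rw [h3] at h1
  exact h1.trans (ENNReal.ofReal_mul' (by positivity)).ge

end Prior

/-! ### The best of the other arms -/

section BestOther

variable {K : ℕ}

/-- The best arm other than `a`. -/
noncomputable def bestArm (hK : 2 ≤ K) (a : Fin K) (ν : {b : Fin K // b ≠ a} → ℝ) :
    {b : Fin K // b ≠ a} :=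
  haveI := nonempty_others hK a
  argmax ν

/-- The mean of the best arm other than `a`. -/
noncomputable def bestMean (hK : 2 ≤ K) (a : Fin K) (ν : {b : Fin K // b ≠ a} → ℝ) : ℝ :=
  ν (bestArm hK a ν)

theorem le_bestMean (hK : 2 ≤ K) (a : Fin K) (ν : {b : Fin K // b ≠ a} → ℝ)
    (c : {b : Fin K // b ≠ a}) : ν c ≤ bestMean hK a ν := by
  have := nonempty_others hK a
  exact argmax_spec ν c

theorem measurable_bestArm_apply {β : Type*} [MeasurableSpace β] (hK : 2 ≤ K) (a : Fin K)
    {F : {b : Fin K // b ≠ a} → ({b : Fin K // b ≠ a} → ℝ) → β} (hF : ∀ c, Measurable (F c)) :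
    Measurable fun ν => F (bestArm hK a ν) ν := by
  have := nonempty_others hK a
  have h : Measurable fun p : ({b : Fin K // b ≠ a} → ℝ) × {b : Fin K // b ≠ a} => F p.2 p.1 :=
    measurable_from_prod_countable_left hF
  exact h.comp (measurable_id.prodMk measurable_argmax)

theorem measurable_bestMean (hK : 2 ≤ K) (a : Fin K) : Measurable (bestMean hK a) :=
  measurable_bestArm_apply hK a fun c => measurable_pi_apply c

/-- The regret of recommending `a` is the positive part of the gap to the best other arm. -/
theorem gap_eq_max [Nonempty (Fin K)] (hK : 2 ≤ K) (μ : Fin K → ℝ) (a : Fin K) :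
    μ (argmax μ) - μ a = max (bestMean hK a (drop a μ) - μ a) 0 := by
  have h1 := argmax_spec μ
  rcases eq_or_ne (argmax μ) a with h | h
  · rw [h, sub_self, max_eq_right]
    have := h1 (bestArm hK a (drop a μ)).1
    rw [h] at this
    exact sub_nonpos.2 this
  · have h2 : bestMean hK a (drop a μ) = μ (argmax μ) :=
      le_antisymm (h1 _) (le_bestMean hK a (drop a μ) ⟨argmax μ, h⟩)
    rw [h2, max_eq_left]
    exact sub_nonneg.2 (h1 a)

end BestOther

/-! ### Error terms under the prior -/

section Errors

variable {K : ℕ} {θ₁ θ₂ : ℝ} {H : Measure (Fin K → ℝ)}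
  {h : (a : Fin K) → ℝ → ({b : Fin K // b ≠ a} → ℝ) → ℝ}

/-- The points of `[θ₁, θ₂]` at distance at most `ε` from the endpoints. -/
def layer (θ₁ θ₂ ε : ℝ) : Set ℝ := Set.Icc θ₁ (θ₁ + ε) ∪ Set.Icc (θ₂ - ε) θ₂

theorem measurableSet_layer (ε : ℝ) : MeasurableSet (layer θ₁ θ₂ ε) :=
  measurableSet_Icc.union measurableSet_Icc

theorem volume_layer_le {ε : ℝ} (hε : 0 ≤ ε) :
    volume (layer θ₁ θ₂ ε) ≤ ENNReal.ofReal (2 * ε) := by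
  refine (measure_union_le _ _).trans ?_
  rw [Real.volume_Icc, Real.volume_Icc, ← ENNReal.ofReal_add (by linarith) (by linarith)]
  exact ENNReal.ofReal_le_ofReal (by linarith)

/-- The parameters of the other arms for which an arm is close to an endpoint or two arms are
close to each other. -/
def nearTies (θ₁ θ₂ ε g : ℝ) (a : Fin K) : Set ({b : Fin K // b ≠ a} → ℝ) :=
  (⋃ c, {ν | ν c ∈ layer θ₁ θ₂ ε}) ∪ ⋃ c, ⋃ c', {ν | c ≠ c' ∧ |ν c - ν c'| ≤ g}

theorem measurableSet_nearTies (ε g : ℝ) (a : Fin K) :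
    MeasurableSet (nearTies θ₁ θ₂ ε g a) := by
  refine (MeasurableSet.iUnion fun c => measurable_pi_apply c (measurableSet_layer ε)).union
    (MeasurableSet.iUnion fun c => MeasurableSet.iUnion fun c' => ?_)
  exact (MeasurableSet.const _).inter
    (measurableSet_le ((measurable_pi_apply c).sub (measurable_pi_apply c')).abs measurable_const)

variable [IsProbabilityMeasure H]

theorem measure_layer_le (hh : HasUnifContCondDensity (Set.Icc θ₁ θ₂) H h) {C : ℝ} (hC0 : 0 ≤ C)
    (hC : ∀ a, ∀ᵐ ν ∂(marginal H a), ∀ y ∈ Set.Icc θ₁ θ₂, h a y ν ≤ C) {ε : ℝ} (hε : 0 ≤ ε)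
    (c : Fin K) : H {μ | μ c ∈ layer θ₁ θ₂ ε} ≤ ENNReal.ofReal (C * (2 * ε)) := by
  refine (hh.measure_coord_mem_le (hC c) (measurableSet_layer ε)).trans ?_
  rw [ENNReal.ofReal_mul hC0]
  gcongr
  exact volume_layer_le hε

theorem measure_nearTies_le (hh : HasUnifContCondDensity (Set.Icc θ₁ θ₂) H h) {C : ℝ} (hC0 : 0 ≤ C)
    (hC : ∀ a, ∀ᵐ ν ∂(marginal H a), ∀ y ∈ Set.Icc θ₁ θ₂, h a y ν ≤ C) {ε g : ℝ} (hε : 0 ≤ ε)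
    (hg : 0 ≤ g) (a : Fin K) :
    H {μ | drop a μ ∈ nearTies θ₁ θ₂ ε g a} ≤
      ENNReal.ofReal (K * (C * (2 * ε)) + K * (K * (C * (2 * g)))) := by
  have hsub : {μ : Fin K → ℝ | drop a μ ∈ nearTies θ₁ θ₂ ε g a} ⊆
      (⋃ c, {μ | μ c ∈ layer θ₁ θ₂ ε}) ∪
        ⋃ c, ⋃ c', {μ : Fin K → ℝ | c' ≠ c ∧ |μ c - μ c'| ≤ g} := by
    intro μ hμ
    simp only [nearTies, Set.mem_ofPred_eq, Set.mem_union, Set.mem_iUnion] at hμ ⊢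
    rcases hμ with ⟨c, hc⟩ | ⟨c, c', hcc, hc⟩
    · exact Or.inl ⟨c.1, hc⟩
    · exact Or.inr ⟨c.1, c'.1, fun h => hcc (Subtype.ext h.symm), hc⟩
  refine (measure_mono hsub).trans ((measure_union_le _ _).trans ?_)
  rw [ENNReal.ofReal_add (by positivity) (by positivity)]
  have hsum : ∀ (f : Fin K → Set (Fin K → ℝ)) (B : ℝ), 0 ≤ B → (∀ c, H (f c) ≤ ENNReal.ofReal B) →
      H (⋃ c, f c) ≤ ENNReal.ofReal (K * B) := by
    intro f B hB hf
    refine (measure_iUnion_le _).trans ?_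
    rw [tsum_fintype]
    refine (Finset.sum_le_sum fun c _ => hf c).trans (le_of_eq ?_)
    rw [Finset.sum_const, Finset.card_univ, Fintype.card_fin, nsmul_eq_mul,
      ENNReal.ofReal_mul (by positivity), ENNReal.ofReal_natCast]
  refine add_le_add (hsum _ _ (by positivity) fun c => measure_layer_le hh hC0 hC hε c)
    (hsum _ _ (by positivity) fun c => hsum _ _ (by positivity) fun c' => ?_)
  by_cases hcc : c' = c
  · simp [hcc]
  · refine (measure_mono fun μ hμ => ?_).trans (hh.measure_abs_sub_le hcc (hC c) hg)
    exact hμ.2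

/-- The bound `C / u` for the contribution of a gap `u` to `T` times the regret, for gaps between
`δ` and `L`. -/
noncomputable def gapWeight (C δ L : ℝ) (u : ℝ) : ℝ≥0∞ :=
  (Set.Icc δ L).indicator (fun u => ENNReal.ofReal (C / u)) u

theorem measurable_gapWeight (C δ L : ℝ) : Measurable (gapWeight C δ L) :=
  (measurable_const.div measurable_id).ennreal_ofReal.indicator measurableSet_Icc

theorem lintegral_gapWeight {C δ L : ℝ} (hC : 0 ≤ C) (hδ : 0 < δ) (hδL : δ ≤ L) :
    ∫⁻ u, gapWeight C δ L u = ENNReal.ofReal (C * Real.log (L / δ)) := by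
  have h0 : ∀ u ∈ Set.uIcc δ L, u ≠ 0 := fun u hu => by
    rw [Set.uIcc_of_le hδL] at hu
    exact (hδ.trans_le hu.1).ne'
  have hint : IntervalIntegrable (fun u : ℝ => C * u⁻¹) volume δ L :=
    (intervalIntegral.intervalIntegrable_inv (f := fun u => u) h0 continuousOn_id).const_mul C
  have hint' : IntegrableOn (fun u : ℝ => C / u) (Set.Icc δ L) := by
    rw [integrableOn_Icc_iff_integrableOn_Ioc]
    exact (intervalIntegrable_iff_integrableOn_Ioc_of_le hδL).1 hint
  have e : ∫⁻ u, gapWeight C δ L u = ∫⁻ u in Set.Icc δ L, ENNReal.ofReal (C / u) :=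
    lintegral_indicator measurableSet_Icc _
  rw [e, ← ofReal_integral_eq_lintegral_ofReal hint' ?_, integral_Icc_eq_integral_Ioc,
    ← intervalIntegral.integral_of_le hδL]
  · simp only [div_eq_mul_inv, intervalIntegral.integral_const_mul]
    rw [integral_inv_of_pos hδ (hδ.trans_le hδL), div_eq_mul_inv]
  · filter_upwards [ae_restrict_mem measurableSet_Icc] with u hu
    exact div_nonneg hC (hδ.le.trans hu.1)

/-- The error terms in the bound for `T` times the contribution of arm `a` to the regret, on the
scale `x = T^{1/64}`: atypical runs for gaps of at most `x⁻³¹`, exceptional parameters of the other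
arms, gaps larger than `x⁻³¹`, and the same close to the endpoints. -/
noncomputable def errorTerm (hK : 2 ≤ K) (θ₁ θ₂ C k x : ℝ) (a : Fin K) (μ : Fin K → ℝ) : ℝ≥0∞ :=
  ENNReal.ofReal (C * x ^ 29) *
      (Set.Icc 0 (1 / x ^ 31)).indicator (fun _ => 1) (bestMean hK a (drop a μ) - μ a) +
    ENNReal.ofReal (x ^ 33) *
      ((nearTies θ₁ θ₂ (2 / x ^ 8) (1 / x ^ 16) a).indicator (fun _ => 1) (drop a μ) *
        (Set.Icc 0 (1 / x ^ 31)).indicator (fun _ => 1) (bestMean hK a (drop a μ) - μ a)) +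
    ENNReal.ofReal (x ^ 64 * (θ₂ - θ₁) * (8 * Real.exp (-(k * x ^ 2)))) +
    ((layer θ₁ θ₂ (1 / x ^ 8)).indicator (fun _ => 1) (bestMean hK a (drop a μ)) *
        gapWeight C (1 / x ^ 31) (θ₂ - θ₁) (bestMean hK a (drop a μ) - μ a) +
      (layer θ₁ θ₂ (1 / x ^ 8)).indicator (fun _ => 1) (μ a) *
        gapWeight C (1 / x ^ 31) (θ₂ - θ₁) (bestMean hK a (drop a μ) - μ a))

/-- Parameters close to an endpoint: both for the best other arm and for arm `a` itself, the gap and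
the position are controlled by the densities of two different coordinates. Here each arm takes the
role of the best other arm in turn, which accounts for the factor `K`. -/
theorem lintegral_layer_gapWeight_le (hh : HasUnifContCondDensity (Set.Icc θ₁ θ₂) H h) {C : ℝ}
    (hC0 : 0 ≤ C) (hC : ∀ a, ∀ᵐ ν ∂(marginal H a), ∀ y ∈ Set.Icc θ₁ θ₂, h a y ν ≤ C) (hK : 2 ≤ K)
    (a : Fin K) {ε : ℝ} (hε : 0 ≤ ε) {w : ℝ → ℝ≥0∞} (hw : Measurable w) :
    ∫⁻ μ, (layer θ₁ θ₂ ε).indicator (fun _ => 1) (bestMean hK a (drop a μ)) *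
        w (bestMean hK a (drop a μ) - μ a) ∂H ≤
      K * (ENNReal.ofReal C * (ENNReal.ofReal (C * (2 * ε)) * ∫⁻ u, w u)) ∧
    ∫⁻ μ, (layer θ₁ θ₂ ε).indicator (fun _ => 1) (μ a) *
        w (bestMean hK a (drop a μ) - μ a) ∂H ≤
      K * (ENNReal.ofReal C * (ENNReal.ofReal (C * (2 * ε)) * ∫⁻ u, w u)) := by
  have hi : Measurable ((layer θ₁ θ₂ ε).indicator fun _ => (1 : ℝ≥0∞)) :=
    measurable_const.indicator (measurableSet_layer ε)
  have hcard : (Fintype.card {b : Fin K // b ≠ a} : ℝ≥0∞) ≤ K := by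
    have := Fintype.card_subtype_le fun b : Fin K => b ≠ a
    rw [Fintype.card_fin] at this
    exact_mod_cast this
  have hlayer : ∀ c : Fin K, ∫⁻ μ, (layer θ₁ θ₂ ε).indicator (fun _ => (1 : ℝ≥0∞)) (μ c) ∂H ≤
      ENNReal.ofReal (C * (2 * ε)) := fun c =>
    ((lintegral_indicator_const (measurable_pi_apply c (measurableSet_layer ε)) 1).trans
      (one_mul _)).le.trans (measure_layer_le hh hC0 hC hε c)
  constructor
  · have hb := measurable_bestMean hK a
    refine (hh.lintegral_mul_le (hC a) (hi.comp hb) hw hb).trans ?_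
    calc _ ≤ ENNReal.ofReal C * ((K * ENNReal.ofReal (C * (2 * ε))) * ∫⁻ u, w u) := by
          gcongr
          calc ∫⁻ μ, (layer θ₁ θ₂ ε).indicator (fun _ => (1 : ℝ≥0∞)) (bestMean hK a (drop a μ)) ∂H
              ≤ ∫⁻ μ, ∑ c : {b : Fin K // b ≠ a},
                  (layer θ₁ θ₂ ε).indicator (fun _ => (1 : ℝ≥0∞)) (μ c.1) ∂H :=
                lintegral_mono fun μ => Finset.single_le_sum
                  (f := fun c : {b : Fin K // b ≠ a} =>
                    (layer θ₁ θ₂ ε).indicator (fun _ => (1 : ℝ≥0∞)) (μ c.1))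
                  (fun _ _ => zero_le) (Finset.mem_univ (bestArm hK a (drop a μ)))
            _ = ∑ c : {b : Fin K // b ≠ a},
                  ∫⁻ μ, (layer θ₁ θ₂ ε).indicator (fun _ => (1 : ℝ≥0∞)) (μ c.1) ∂H :=
                lintegral_finsetSum _ fun c _ => hi.comp (measurable_pi_apply c.1)
            _ ≤ ∑ _c : {b : Fin K // b ≠ a}, ENNReal.ofReal (C * (2 * ε)) :=
                Finset.sum_le_sum fun c _ => hlayer c.1
            _ ≤ K * ENNReal.ofReal (C * (2 * ε)) := by
                rw [Finset.sum_const, Finset.card_univ, nsmul_eq_mul]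
                gcongr
      _ = _ := by ring
  · have hterm : ∀ c : {b : Fin K // b ≠ a}, ∫⁻ μ, (layer θ₁ θ₂ ε).indicator (fun _ => 1) (μ a) *
        w (μ c.1 - μ a) ∂H ≤
        ENNReal.ofReal C * (ENNReal.ofReal (C * (2 * ε)) * ∫⁻ u, w u) := by
      intro c
      have h1 := hh.lintegral_mul_le (hC c.1)
        (g := fun ν => (layer θ₁ θ₂ ε).indicator (fun _ => 1) (ν ⟨a, c.2.symm⟩))
        (hi.comp (measurable_pi_apply _)) (φ := fun u => w (-u)) (hw.comp measurable_neg)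
        (ξ := fun ν => ν ⟨a, c.2.symm⟩) (measurable_pi_apply _)
      simp only [drop, neg_sub] at h1
      refine h1.trans ?_
      rw [lintegral_neg_eq_self w]
      gcongr
      exact hlayer a
    calc ∫⁻ μ, (layer θ₁ θ₂ ε).indicator (fun _ => 1) (μ a) *
          w (bestMean hK a (drop a μ) - μ a) ∂H
        ≤ ∫⁻ μ, ∑ c : {b : Fin K // b ≠ a}, (layer θ₁ θ₂ ε).indicator (fun _ => 1) (μ a) *
            w (μ c.1 - μ a) ∂H :=
          lintegral_mono fun μ => Finset.single_le_sum
            (f := fun c : {b : Fin K // b ≠ a} =>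
              (layer θ₁ θ₂ ε).indicator (fun _ => (1 : ℝ≥0∞)) (μ a) * w (μ c.1 - μ a))
            (fun _ _ => zero_le) (Finset.mem_univ (bestArm hK a (drop a μ)))
      _ = ∑ c : {b : Fin K // b ≠ a}, ∫⁻ μ, (layer θ₁ θ₂ ε).indicator (fun _ => 1) (μ a) *
            w (μ c.1 - μ a) ∂H :=
          lintegral_finsetSum _ fun c _ => (hi.comp (measurable_pi_apply a)).mul
            (hw.comp ((measurable_pi_apply c.1).sub (measurable_pi_apply a)))
      _ ≤ ∑ _c : {b : Fin K // b ≠ a},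
            ENNReal.ofReal C * (ENNReal.ofReal (C * (2 * ε)) * ∫⁻ u, w u) :=
          Finset.sum_le_sum fun c _ => hterm c
      _ ≤ _ := by
          rw [Finset.sum_const, Finset.card_univ, nsmul_eq_mul]
          gcongr

theorem lintegral_errorTerm_le (hh : HasUnifContCondDensity (Set.Icc θ₁ θ₂) H h) {D : ℝ}
    (hD0 : 0 ≤ D) (hD : ∀ a, ∀ᵐ ν ∂(marginal H a), ∀ y ∈ Set.Icc θ₁ θ₂, h a y ν ≤ D) (hK : 2 ≤ K)
    {C k x : ℝ} (hC : 0 ≤ C) (hx : 0 < x) (hθ : θ₁ < θ₂) (hxL : 1 / x ^ 31 ≤ θ₂ - θ₁) (a : Fin K) :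
    ∫⁻ μ, errorTerm hK θ₁ θ₂ C k x a μ ∂H ≤ ENNReal.ofReal
      (C * x ^ 29 * (D * (1 / x ^ 31)) +
        x ^ 33 * (D * ((K * (D * (2 * (2 / x ^ 8))) + K * (K * (D * (2 * (1 / x ^ 16))))) *
          (1 / x ^ 31))) + x ^ 64 * (θ₂ - θ₁) * (8 * Real.exp (-(k * x ^ 2))) +
        2 * (K * (D * (D * (2 * (1 / x ^ 8)) *
          (C * Real.log ((θ₂ - θ₁) / (1 / x ^ 31))))))) := by
  have hb := measurable_bestMean hK a
  have hδ : (0 : ℝ) < 1 / x ^ 31 := by positivity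
  have hL : 0 ≤ θ₂ - θ₁ := by linarith
  have hn : Measurable ((Set.Icc (0 : ℝ) (1 / x ^ 31)).indicator fun _ => (1 : ℝ≥0∞)) :=
    measurable_const.indicator measurableSet_Icc
  have hnint : ∫⁻ u, (Set.Icc (0 : ℝ) (1 / x ^ 31)).indicator (fun _ => (1 : ℝ≥0∞)) u =
      ENNReal.ofReal (1 / x ^ 31) := by
    rw [lintegral_indicator_const measurableSet_Icc, one_mul, Real.volume_Icc, sub_zero]
  have hΔ : Measurable fun μ : Fin K → ℝ => bestMean hK a (drop a μ) - μ a :=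
    (hb.comp (measurable_drop a)).sub (measurable_pi_apply a)
  have hnt : Measurable ((nearTies θ₁ θ₂ (2 / x ^ 8) (1 / x ^ 16) a).indicator
      fun _ => (1 : ℝ≥0∞)) := measurable_const.indicator (measurableSet_nearTies _ _ a)
  have hly : Measurable ((layer θ₁ θ₂ (1 / x ^ 8)).indicator fun _ => (1 : ℝ≥0∞)) :=
    measurable_const.indicator (measurableSet_layer _)
  have hw := measurable_gapWeight C (1 / x ^ 31) (θ₂ - θ₁)
  have hwint := lintegral_gapWeight hC hδ hxL
  have hlog : 0 ≤ Real.log ((θ₂ - θ₁) / (1 / x ^ 31)) :=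
    Real.log_nonneg ((one_le_div hδ).2 hxL)
  obtain ⟨hl1, hl2⟩ := lintegral_layer_gapWeight_le hh hD0 hD hK a (ε := 1 / x ^ 8) (by positivity)
    hw
  simp only [errorTerm]
  have m1 : Measurable fun μ : Fin K → ℝ => (Set.Icc (0 : ℝ) (1 / x ^ 31)).indicator
      (fun _ => (1 : ℝ≥0∞)) (bestMean hK a (drop a μ) - μ a) := hn.comp hΔ
  have m2 : Measurable fun μ : Fin K → ℝ => (nearTies θ₁ θ₂ (2 / x ^ 8) (1 / x ^ 16) a).indicator
      (fun _ => (1 : ℝ≥0∞)) (drop a μ) * (Set.Icc (0 : ℝ) (1 / x ^ 31)).indicator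
      (fun _ => (1 : ℝ≥0∞)) (bestMean hK a (drop a μ) - μ a) :=
    (hnt.comp (measurable_drop a)).mul m1
  have m3 : Measurable fun μ : Fin K → ℝ => (layer θ₁ θ₂ (1 / x ^ 8)).indicator
      (fun _ => (1 : ℝ≥0∞)) (bestMean hK a (drop a μ)) *
      gapWeight C (1 / x ^ 31) (θ₂ - θ₁) (bestMean hK a (drop a μ) - μ a) :=
    (hly.comp (hb.comp (measurable_drop a))).mul (hw.comp hΔ)
  have m4 := m1.const_mul (ENNReal.ofReal (C * x ^ 29))
  have m5 := m2.const_mul (ENNReal.ofReal (x ^ 33))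
  rw [lintegral_add_left ((m4.fun_add m5).fun_add measurable_const),
    lintegral_add_left (m4.fun_add m5),
    lintegral_add_left m4, lintegral_add_left m3, lintegral_const_mul _ m1,
    lintegral_const_mul _ m2, lintegral_const, measure_univ, mul_one]
  rw [ENNReal.ofReal_add (by positivity) (by positivity), ENNReal.ofReal_add (by positivity)
    (by positivity), ENNReal.ofReal_add (by positivity) (by positivity)]
  refine add_le_add (add_le_add (add_le_add ?_ ?_) le_rfl) ?_
  · rw [ENNReal.ofReal_mul (p := C * x ^ 29) (by positivity)]
    refine mul_le_mul_right ?_ _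
    have h1 := hh.lintegral_mul_le (hD a) (g := fun _ => 1) measurable_const hn hb
    simp only [one_mul, lintegral_const, measure_univ, mul_one, hnint] at h1
    exact h1.trans (ENNReal.ofReal_mul hD0).ge
  · rw [ENNReal.ofReal_mul (p := x ^ 33) (by positivity)]
    refine mul_le_mul_right ?_ _
    refine (hh.lintegral_mul_le (hD a) hnt hn hb).trans ?_
    rw [hnint, ENNReal.ofReal_mul hD0, ENNReal.ofReal_mul (by positivity)]
    gcongr
    refine le_trans (le_of_eq ?_) (measure_nearTies_le hh hD0 hD (by positivity) (by positivity) a)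
    exact (lintegral_indicator_const (measurable_drop a (measurableSet_nearTies _ _ a)) 1).trans
      (one_mul _)
  · refine (add_le_add hl1 hl2).trans (le_of_eq ?_)
    rw [hwint, ENNReal.ofReal_mul zero_le_two, ENNReal.ofReal_mul (p := (K : ℝ)) (by positivity),
      ENNReal.ofReal_mul (q := D * (2 * (1 / x ^ 8)) * _) hD0,
      ENNReal.ofReal_mul (p := D * (2 * (1 / x ^ 8))) (by positivity),
      ENNReal.ofReal_natCast, ENNReal.ofReal_ofNat]
    ring

/-- The large gaps cost a logarithm of `T`, but only for parameters within `x⁻⁸` of the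
endpoints. -/
theorem tendsto_errorTerm (hh : HasUnifContCondDensity (Set.Icc θ₁ θ₂) H h) (hθ : θ₁ < θ₂)
    (hH : ∀ᵐ μ ∂H, ∀ a, μ a ∈ Set.Icc θ₁ θ₂) (hK : 2 ≤ K) {C k : ℝ} (hC : 0 ≤ C) (hk : 0 < k)
    (a : Fin K) :
    Tendsto (fun T : ℕ => ∫⁻ μ, errorTerm hK θ₁ θ₂ C k (scale T) a μ ∂H) atTop (𝓝 0) := by
  obtain ⟨D, hD0, hD⟩ := hh.exists_bound hθ hH
  set L := θ₂ - θ₁ with hL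
  have hL0 : 0 < L := by linarith
  have key : Tendsto (fun x : ℝ => (C * D + 2 * K * D * D * C * (2 * (|Real.log L| + 31)) +
      D * (4 * K * D + 2 * K * K * D)) * x⁻¹ +
      8 * L * k⁻¹ ^ 32 * ((k * x ^ 2) ^ 32 * Real.exp (-(k * x ^ 2)))) atTop (𝓝 0) := by
    have h1 : Tendsto (fun x : ℝ => k * x ^ 2) atTop atTop :=
      (tendsto_pow_atTop two_ne_zero).const_mul_atTop hk
    have h2 := (Real.tendsto_pow_mul_exp_neg_atTop_nhds_zero 32).comp h1
    have h3 := ((tendsto_inv_atTop_zero (𝕜 := ℝ)).const_mul (C * D + 2 * K * D * D * C *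
      (2 * (|Real.log L| + 31)) + D * (4 * K * D + 2 * K * K * D))).add
      (h2.const_mul (8 * L * k⁻¹ ^ 32))
    rw [mul_zero, mul_zero, add_zero] at h3
    exact h3
  have key' := ENNReal.tendsto_ofReal (key.comp tendsto_scale)
  rw [ENNReal.ofReal_zero] at key'
  refine tendsto_of_tendsto_of_tendsto_of_le_of_le' tendsto_const_nhds key'
    (Eventually.of_forall fun _ => zero_le) ?_
  filter_upwards [tendsto_scale.eventually_ge_atTop 1, tendsto_scale.eventually_ge_atTop (1 / L)]
    with T h1 h2
  set x := scale T
  have hx0 : 0 < x := by linarith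
  have hle : ∀ n : ℕ, n ≠ 0 → x ≤ x ^ n := fun n hn => le_self_pow₀ h1 hn
  have hxL : 1 / x ^ 31 ≤ L := by
    rw [div_le_iff₀ (by positivity)]
    rw [div_le_iff₀ hL0] at h2
    nlinarith [hle 31 (by norm_num)]
  refine (lintegral_errorTerm_le hh hD0.le hD hK hC hx0 hθ hxL a).trans
    (ENNReal.ofReal_le_ofReal ?_)
  have hlog : Real.log (L / (1 / x ^ 31)) ≤ (|Real.log L| + 31) * x := by
    rw [div_div_eq_mul_div, div_one, Real.log_mul hL0.ne' (by positivity), Real.log_pow]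
    have h3 := Real.log_le_self hx0.le
    have h4 := le_abs_self (Real.log L)
    push_cast
    nlinarith [abs_nonneg (Real.log L)]
  have hinv : ∀ n : ℕ, n ≠ 0 → 1 / x ^ n ≤ x⁻¹ := fun n hn => by
    rw [one_div]; exact inv_anti₀ hx0 (hle n hn)
  have t1 : C * x ^ 29 * (D * (1 / x ^ 31)) ≤ C * D * x⁻¹ := by
    calc _ = C * D * (1 / x ^ 2) := by field_simp
      _ ≤ _ := by gcongr; exact hinv 2 two_ne_zero
  have t2 : x ^ 33 * (D * ((K * (D * (2 * (2 / x ^ 8))) + K * (K * (D * (2 * (1 / x ^ 16))))) *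
      (1 / x ^ 31))) ≤ D * (4 * K * D + 2 * K * K * D) * x⁻¹ := by
    calc _ = D * (4 * K * D) * (1 / x ^ 6) + D * (2 * K * K * D) * (1 / x ^ 14) := by
          field_simp; ring
      _ ≤ D * (4 * K * D) * x⁻¹ + D * (2 * K * K * D) * x⁻¹ := by
          gcongr
          · exact hinv 6 (by norm_num)
          · exact hinv 14 (by norm_num)
      _ = _ := by ring
  have t3 : x ^ 64 * L * (8 * Real.exp (-(k * x ^ 2))) =
      8 * L * k⁻¹ ^ 32 * ((k * x ^ 2) ^ 32 * Real.exp (-(k * x ^ 2))) := by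
    have : k⁻¹ ^ 32 * (k * x ^ 2) ^ 32 = x ^ 64 := by
      rw [← mul_pow, inv_mul_cancel_left₀ hk.ne', ← pow_mul]
    calc _ = x ^ 64 * (8 * L * Real.exp (-(k * x ^ 2))) := by ring
      _ = _ := by rw [← this]; ring
  have t4 : 2 * (K * (D * (D * (2 * (1 / x ^ 8)) * (C * Real.log (L / (1 / x ^ 31)))))) ≤
      2 * K * D * D * C * (2 * (|Real.log L| + 31)) * x⁻¹ := by
    calc _ ≤ 2 * (K * (D * (D * (2 * (1 / x ^ 8)) * (C * ((|Real.log L| + 31) * x))))) := by gcongr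
      _ = 2 * K * D * D * C * (2 * (|Real.log L| + 31)) * (1 / x ^ 7) := by field_simp
      _ ≤ _ := by gcongr; exact hinv 7 (by norm_num)
  simp only [Function.comp]
  rw [t3]
  linarith

end Errors

/-! ### The contribution of one arm to the regret -/

section Arm

variable {K : ℕ} {r θ₁ θ₂ S s₀ : ℝ} {v : Fin K → ℝ → ℝ} {P : Fin K → ℝ → Measure ℝ}

/-- The variance proxy for a near tie of arm `a` with the best other arm: the limit of `T` times the
variance of the difference of the two final sample means is at most this. -/
noncomputable def pairVar (hK : 2 ≤ K) (r : ℝ) (v : Fin K → ℝ → ℝ) (a : Fin K)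
    (ν : {b : Fin K // b ≠ a} → ℝ) : ℝ :=
  2 * (v a (bestMean hK a ν) + v (bestArm hK a ν).1 (bestMean hK a ν)) / (1 - (K - 2) * (r / K))

/-- The Gaussian bound for `T` times a gap `u ≤ x⁻³¹` times the probability of a recommendation
with this gap, for the variance proxy `s`; here `x = T^{1/64}`. -/
noncomputable def mainTerm (e s : ℝ) (T : ℕ) (u : ℝ) : ℝ≥0∞ :=
  (Set.Icc 0 (1 / scale T ^ 31)).indicator (fun u => ENNReal.ofReal
    (T * u * ((1 + e) * Real.exp (-((1 - e) * (T * u ^ 2 / (2 * ((1 + e) * s)))))))) u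

/-- The Rayleigh density has mass one; integrated over the gap, the Gaussian tail bound for a near
tie thus becomes the variance of the difference of the sample means. -/
theorem lintegral_mul_exp_le_one {b L : ℝ} (hb : 0 ≤ b) (hL : 0 ≤ L) :
    ∫⁻ u in Set.Icc 0 L, ENNReal.ofReal (b * u * Real.exp (-(b * u ^ 2 / 2))) ≤ 1 := by
  have hderiv : ∀ u ∈ Set.uIcc 0 L, HasDerivAt (fun u => -Real.exp (-(b * u ^ 2 / 2)))
      (b * u * Real.exp (-(b * u ^ 2 / 2))) u := by
    intro u _
    have h1 : HasDerivAt (fun u : ℝ => -(b * u ^ 2 / 2)) (-(b * u)) u := by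
      have := (((hasDerivAt_pow 2 u).const_mul b).div_const 2).neg
      refine this.congr_deriv ?_
      push_cast
      ring
    exact h1.exp.neg.congr_deriv (by ring)
  have hcont : Continuous fun u : ℝ => b * u * Real.exp (-(b * u ^ 2 / 2)) := by fun_prop
  have hint := intervalIntegral.integral_eq_sub_of_hasDerivAt hderiv (hcont.intervalIntegrable 0 L)
  rw [← ofReal_integral_eq_lintegral_ofReal (hcont.integrableOn_Icc) ?_,
    integral_Icc_eq_integral_Ioc, ← intervalIntegral.integral_of_le hL, hint, ENNReal.ofReal_le_one]
  · have := Real.exp_pos (-(b * L ^ 2 / 2))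
    simp
    linarith
  · filter_upwards [ae_restrict_mem measurableSet_Icc] with u hu
    have := hu.1
    positivity

theorem lintegral_mainTerm_le {e s : ℝ} (he0 : 0 < e) (he1 : e < 1) (hs : 0 < s) (T : ℕ) :
    ∫⁻ u, mainTerm e s T u ≤ ENNReal.ofReal ((1 + e) ^ 2 / (1 - e) * s) := by
  have h1 : 0 < 1 - e := by linarith
  have hL : 0 ≤ 1 / scale T ^ 31 := by
    have : 0 ≤ scale T := Real.rpow_nonneg T.cast_nonneg _
    positivity
  set b := (1 - e) * T / ((1 + e) * s) with hb
  have hb0 : 0 ≤ b := by positivity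
  have e1 : ∀ u : ℝ, ENNReal.ofReal
      (T * u * ((1 + e) * Real.exp (-((1 - e) * (T * u ^ 2 / (2 * ((1 + e) * s))))))) =
      ENNReal.ofReal ((1 + e) ^ 2 / (1 - e) * s) *
        ENNReal.ofReal (b * u * Real.exp (-(b * u ^ 2 / 2))) := by
    intro u
    rw [← ENNReal.ofReal_mul (by positivity)]
    congr 1
    have e2 : (1 - e) * (T * u ^ 2 / (2 * ((1 + e) * s))) = b * u ^ 2 / 2 := by
      rw [hb]; field_simp
    have e3 : (1 + e) ^ 2 / (1 - e) * s * b = T * (1 + e) := by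
      rw [hb]; field_simp
    rw [e2, ← mul_assoc, ← mul_assoc, ← mul_assoc, e3]
    ring
  have e4 : ∫⁻ u, mainTerm e s T u = ∫⁻ u in Set.Icc 0 (1 / scale T ^ 31), ENNReal.ofReal
      (T * u * ((1 + e) * Real.exp (-((1 - e) * (T * u ^ 2 / (2 * ((1 + e) * s))))))) :=
    lintegral_indicator measurableSet_Icc _
  rw [e4, lintegral_congr e1, lintegral_const_mul _ (by fun_prop)]
  calc _ ≤ ENNReal.ofReal ((1 + e) ^ 2 / (1 - e) * s) * 1 := by
        gcongr; exact lintegral_mul_exp_le_one hb0 hL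
    _ = _ := mul_one _

theorem pairVar_pos (hK : 2 ≤ K) (hr0 : 0 < r) (hr1 : r < 1) (hv0 : ∀ a x, 0 < v a x) (a : Fin K)
    (ν : {b : Fin K // b ≠ a} → ℝ) : 0 < pairVar hK r v a ν := by
  have hK2 : (2 : ℝ) ≤ K := by exact_mod_cast hK
  have hK0 : (0 : ℝ) < K := by linarith
  have : 0 < 1 - (K - 2) * (r / K) := by
    have h1 : K * (r / K) = r := mul_div_cancel₀ _ hK0.ne'
    have h2 : 0 < r / K := by positivity
    linarith
  have h1 := hv0 a (bestMean hK a ν)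
  have h2 := hv0 (bestArm hK a ν).1 (bestMean hK a ν)
  unfold pairVar
  positivity

/-- Pointwise bound for the contribution of an arm to `T` times the regret. -/
theorem eventually_mul_recommend_le [Nonempty (Fin K)]
    (hP : ∀ a, HasGaussianMGF θ₁ θ₂ S (v a) (P a)) (hS : 0 < S)
    (hvS : ∀ a, ∀ s ∈ Set.Icc θ₁ θ₂, v a s ≤ S) (hs₀ : 0 < s₀)
    (hv : ∀ a, ∀ s ∈ Set.Icc θ₁ θ₂, s₀ ≤ v a s)
    (hvc : ∀ a, ContinuousOn (v a) (Set.Icc θ₁ θ₂)) (hK : 2 ≤ K) (hr0 : 0 < r) (hr1 : r < 1)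
    {e : ℝ} (he0 : 0 < e) (he1 : e < 1) :
    ∃ C k, 0 ≤ C ∧ 0 < k ∧ ∀ᶠ T : ℕ in atTop, ∀ (Q : Measure (Fin K → ℝ)) (μ : Fin K → ℝ),
      IsProbabilityMeasure Q → (∀ a, Q.map (fun y => y a) = P a (μ a)) →
      (∀ c, μ c ∈ Set.Icc θ₁ θ₂) → ∀ a,
      ENNReal.ofReal (T * (bestMean hK a (drop a μ) - μ a)) *
        experimentLaw r T Q {z | recommend r z.1 z.2 = a} ≤
      mainTerm e (pairVar hK r v a (drop a μ)) T (bestMean hK a (drop a μ) - μ a) +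
        errorTerm hK θ₁ θ₂ C k (scale T) a μ := by
  have hK2 : (2 : ℝ) ≤ K := by exact_mod_cast hK
  have hK0 : (0 : ℝ) < K := by linarith
  have hρ0 : 0 < r / K := by positivity
  have hc0 : 0 < 1 - (K - 2) * (r / K) := by
    have h1 : K * (r / K) = r := mul_div_cancel₀ _ hK0.ne'
    linarith
  obtain ⟨C₀, hC₀, hnear⟩ := eventually_recommend_le hP hS hvS hs₀ hv hvc hK hr0 hr1 he0 he1
  obtain ⟨d₀, hd₀, hmod⟩ := exists_modulus hs₀ hv hvc he0
  set C := C₀ + 256 * S / (r / K) ^ 2 with hC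
  have hC1 : 0 ≤ 256 * S / (r / K) ^ 2 := by positivity
  refine ⟨C, (r / K) ^ 2 / (128 * S), by positivity, by positivity, ?_⟩
  filter_upwards [hnear, tendsto_scale.eventually_ge_atTop 1,
    tendsto_scale.eventually_ge_atTop (2 / (r / K)), tendsto_scale.eventually_ge_atTop (1 / d₀)]
    with T hT h1 h2 h3 Q μ hQ1 hQ hμ a
  set x := scale T with hx
  have hxT : x ^ 64 = T := scale_pow T
  have hx0 : 0 < x := by linarith
  have hle : ∀ {B : ℝ} (n : ℕ), n ≠ 0 → B ≤ x → B ≤ x ^ n := fun n hn hB =>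
    hB.trans (le_self_pow₀ h1 hn)
  have hρT : 2 ≤ r / K * T := by
    have := hle 64 (by norm_num) h2
    rwa [div_le_iff₀ hρ0, mul_comm, hxT] at this
  have hδd : 1 / x ^ 31 ≤ d₀ := by
    have := hle 31 (by norm_num) h3
    rw [div_le_iff₀ hd₀] at this
    rwa [div_le_iff₀ (by positivity), mul_comm]
  have hδε : 1 / x ^ 31 ≤ 1 / x ^ 8 := by
    gcongr
    norm_num
  have hT0 : (0 : ℝ) < T := by rw [← hxT]; positivity
  set b := (bestArm hK a (drop a μ)).1 with hb
  have hba : b ≠ a := (bestArm hK a (drop a μ)).2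
  have hbest : bestMean hK a (drop a μ) = μ b := rfl
  have hmax : ∀ c, c ≠ a → μ c ≤ μ b := fun c hc => le_bestMean hK a (drop a μ) ⟨c, hc⟩
  set p := experimentLaw r T Q {z | recommend r z.1 z.2 = a}
  have hp1 : p ≤ 1 := prob_le_one
  rw [hbest]
  rcases le_or_gt (μ b - μ a) 0 with h0 | h0
  · rw [ENNReal.ofReal_of_nonpos (mul_nonpos_of_nonneg_of_nonpos hT0.le h0), zero_mul]
    exact zero_le
  have hab : μ a < μ b := by linarith
  set Δ := μ b - μ a with hΔ
  rcases le_or_gt Δ (1 / x ^ 31) with hδ | hδ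
  · have hmem : Δ ∈ Set.Icc (0 : ℝ) (1 / x ^ 31) := ⟨h0.le, hδ⟩
    by_cases hgood : (∀ c, θ₁ + 1 / x ^ 8 ≤ μ c ∧ μ c + 1 / x ^ 8 ≤ θ₂) ∧
        ∀ c, c ≠ a → c ≠ b → μ c + 1 / x ^ 16 ≤ μ b
    · -- a near tie of two arms only
      have hrec := hT Q μ hQ1 hQ hgood.1 a b hab hδ hgood.2
      set V := 2 * (v a (μ a) + v b (μ b)) / (1 - (K - 2) * (r / K)) with hV
      have hva := hs₀.trans_le (hv a _ (hμ a))
      have hvb := hs₀.trans_le (hv b _ (hμ b))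
      have hV0 : 0 < V := by positivity
      -- `pairVar` evaluates the variance of `a` at the tie, not at the mean of `a`
      have hVle : V ≤ (1 + e) * pairVar hK r v a (drop a μ) := by
        have m1 := hmod a _ (hμ a) _ (hμ b)
          (by rw [abs_sub_comm, abs_of_pos h0]; exact hδ.trans hδd)
        have m2 : v b (μ b) ≤ (1 + e) * v b (μ b) := by nlinarith
        rw [pairVar, hbest, ← hb, hV, ← mul_div_assoc (1 + e)]
        refine div_le_div_of_nonneg_right ?_ hc0.le
        linarith
      have hmain : ENNReal.ofReal (T * Δ) * p ≤
          mainTerm e (pairVar hK r v a (drop a μ)) T Δ + ENNReal.ofReal (C * x ^ 29) := by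
        rw [mainTerm, Set.indicator_of_mem hmem, ← ENNReal.ofReal_add (by positivity)
          (by positivity)]
        refine (mul_le_mul_right hrec _).trans ?_
        rw [← ENNReal.ofReal_mul (by positivity)]
        refine ENNReal.ofReal_le_ofReal ?_
        rw [mul_add]
        refine add_le_add ?_ ?_
        · gcongr
        · calc T * Δ * (C₀ / x ^ 4) ≤ T * (1 / x ^ 31) * (C / x ^ 4) := by
                gcongr; linarith
            _ = C * x ^ 29 := by rw [← hxT]; field_simp
      refine hmain.trans ?_
      gcongr
      rw [errorTerm, hbest, Set.indicator_of_mem hmem, mul_one, add_assoc, add_assoc]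
      exact le_self_add
    · -- exceptional parameters of the other arms
      have hbad : drop a μ ∈ nearTies θ₁ θ₂ (2 / x ^ 8) (1 / x ^ 16) a := by
        have e2 : 2 / x ^ 8 = 1 / x ^ 8 + 1 / x ^ 8 := by ring
        have hpos : 0 < 1 / x ^ 8 := by positivity
        by_cases hint : ∀ c, θ₁ + 1 / x ^ 8 ≤ μ c ∧ μ c + 1 / x ^ 8 ≤ θ₂
        · have hgap : ∃ c, c ≠ a ∧ c ≠ b ∧ μ b < μ c + 1 / x ^ 16 := by
            by_contra! hcon
            exact hgood ⟨hint, fun c h1 h2 => hcon c h1 h2⟩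
          obtain ⟨c, hca, hcb, hc⟩ := hgap
          refine Or.inr ?_
          simp only [Set.mem_iUnion]
          refine ⟨⟨c, hca⟩, ⟨b, hba⟩, fun h => hcb (congrArg Subtype.val h), ?_⟩
          rw [abs_le]
          constructor
          · simp only [drop]; linarith
          · simp only [drop]
            have := hmax c hca
            have : 0 < 1 / x ^ 16 := by positivity
            linarith
        · refine Or.inl ?_
          simp only [Set.mem_iUnion]
          simp only [not_forall] at hint
          obtain ⟨c, hc⟩ := hint
          have hc' : μ c < θ₁ + 1 / x ^ 8 ∨ θ₂ - 1 / x ^ 8 < μ c := by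
            by_contra hcon
            rw [not_or, not_lt, not_lt] at hcon
            exact hc ⟨hcon.1, by linarith [hcon.2]⟩
          by_cases hca : c = a
          · refine ⟨⟨b, hba⟩, ?_⟩
            rw [hca] at hc'
            rcases hc' with h | h
            · exact Or.inl ⟨(hμ b).1, by simp only [drop]; linarith⟩
            · exact Or.inr ⟨by simp only [drop]; linarith, (hμ b).2⟩
          · refine ⟨⟨c, hca⟩, ?_⟩
            rcases hc' with h | h
            · exact Or.inl ⟨(hμ c).1, by simp only [drop]; linarith⟩
            · exact Or.inr ⟨by simp only [drop]; linarith, (hμ c).2⟩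
      have hmain : ENNReal.ofReal (T * Δ) * p ≤ ENNReal.ofReal (x ^ 33) := by
        calc _ ≤ ENNReal.ofReal (T * Δ) * 1 := by gcongr
          _ ≤ ENNReal.ofReal (x ^ 33) := by
            rw [mul_one]
            refine ENNReal.ofReal_le_ofReal ?_
            calc T * Δ ≤ T * (1 / x ^ 31) := by gcongr
              _ = x ^ 33 := by rw [← hxT]; field_simp
      refine hmain.trans (le_add_left ?_)
      rw [errorTerm, hbest, Set.indicator_of_mem hmem, Set.indicator_of_mem hbad, mul_one, mul_one,
        mul_one]
      exact le_add_right (le_add_right le_add_self)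
  · refine le_add_left ?_
    have hΔL : Δ ≤ θ₂ - θ₁ := by linarith [(hμ b).2, (hμ a).1]
    by_cases hint : ∀ c, c = a ∨ c = b → θ₁ + 1 / x ^ 8 ≤ μ c ∧ μ c + 1 / x ^ 8 ≤ θ₂
    · -- a large gap between arms away from the endpoints
      have hrec := recommend_le_subgaussian hP hvS hS hQ (by omega) hr0 hr1.le hρT
        (by positivity : 0 < 1 / x ^ 31) hδ.le fun c hc =>
          ⟨by linarith [hint c hc], by linarith [hint c hc]⟩
      have hmain : ENNReal.ofReal (T * Δ) * p ≤ ENNReal.ofReal (x ^ 64 * (θ₂ - θ₁) *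
          (8 * Real.exp (-((r / K) ^ 2 / (128 * S) * x ^ 2)))) := by
        refine (mul_le_mul_right hrec _).trans ?_
        rw [← ENNReal.ofReal_mul (by positivity)]
        refine ENNReal.ofReal_le_ofReal ?_
        have e1 : (r / K) ^ 2 * (T * (1 / x ^ 31) ^ 2) / (128 * S) =
            (r / K) ^ 2 / (128 * S) * x ^ 2 := by
          rw [← hxT]; field_simp
        rw [e1, hxT]
        gcongr
      refine hmain.trans ?_
      rw [errorTerm]
      exact le_add_right le_add_self
    · -- a large gap, with one of the two arms close to an endpoint
      have hrec := recommend_le_chebyshev hP hvS hS hQ hμ (by omega) hr0 hr1.le hρT hab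
      have hgw : ENNReal.ofReal (T * Δ) * p ≤ gapWeight C (1 / x ^ 31) (θ₂ - θ₁) Δ := by
        refine (mul_le_mul_right hrec _).trans ?_
        rw [← ENNReal.ofReal_mul (by positivity), gapWeight,
          Set.indicator_of_mem (show Δ ∈ Set.Icc (1 / x ^ 31) (θ₂ - θ₁) from ⟨hδ.le, hΔL⟩)]
        refine ENNReal.ofReal_le_ofReal ?_
        calc T * Δ * (256 * S / (r / K) ^ 2 / (T * (μ b - μ a) ^ 2))
            = 256 * S / (r / K) ^ 2 / Δ := by rw [← hΔ]; field_simp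
          _ ≤ C / Δ := by gcongr; linarith
      have hlay : μ b ∈ layer θ₁ θ₂ (1 / x ^ 8) ∨ μ a ∈ layer θ₁ θ₂ (1 / x ^ 8) := by
        simp only [not_forall] at hint
        obtain ⟨c, hc1, hc2⟩ := hint
        have : μ c ∈ layer θ₁ θ₂ (1 / x ^ 8) := by
          by_contra hcon
          simp only [layer, Set.mem_union, Set.mem_Icc, not_or, not_and, not_le] at hcon
          have g1 := hcon.1 (hμ c).1
          refine hc2 ⟨g1.le, ?_⟩
          by_contra hh
          exact absurd (hcon.2 (by linarith)) (not_lt.2 (hμ c).2)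
        rcases hc1 with rfl | rfl
        · exact Or.inr this
        · exact Or.inl this
      refine hgw.trans ?_
      rw [errorTerm, hbest]
      refine le_add_left ?_
      rcases hlay with h | h
      · rw [Set.indicator_of_mem h, one_mul]; exact le_self_add
      · rw [Set.indicator_of_mem (a := μ a) h, one_mul]; exact le_add_self

end Arm

/-! ### Averaging the contribution of one arm over the prior -/

section Average

variable {K : ℕ} {r θ₁ θ₂ S s₀ : ℝ} {v : Fin K → ℝ → ℝ} {P : Fin K → ℝ → Measure ℝ}
  {H : Measure (Fin K → ℝ)} {h : (a : Fin K) → ℝ → ({b : Fin K // b ≠ a} → ℝ) → ℝ}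

theorem bestMean_mem (hK : 2 ≤ K) {a : Fin K} {s : Set ℝ} {ν : {b : Fin K // b ≠ a} → ℝ}
    (hν : ∀ c, ν c ∈ s) : bestMean hK a ν ∈ s := hν _

theorem measurable_bestVar (hK : 2 ≤ K) (hvm : ∀ a, Measurable (v a)) (a : Fin K) :
    Measurable fun ν => v (bestArm hK a ν).1 (bestMean hK a ν) :=
  measurable_bestArm_apply hK a fun c => (hvm c.1).comp (measurable_pi_apply c)

theorem measurable_pairVar (hK : 2 ≤ K) (r : ℝ) (hvm : ∀ a, Measurable (v a)) (a : Fin K) :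
    Measurable (pairVar hK r v a) :=
  ((((hvm a).comp (measurable_bestMean hK a)).add (measurable_bestVar hK hvm a)).const_mul
    2).div_const _

theorem HasUnifContCondDensity.measurable_bestMean
    (hh : HasUnifContCondDensity (Set.Icc θ₁ θ₂) H h) (hK : 2 ≤ K) (a : Fin K) :
    Measurable fun ν => h a (bestMean hK a ν) ν :=
  (hh.measurable a).comp (measurable_id.prodMk (TSEBA.measurable_bestMean hK a))

theorem measurable_mainTerm {X : Type*} [MeasurableSpace X] (e : ℝ) (T : ℕ) {s u : X → ℝ}
    (hs : Measurable s) (hu : Measurable u) : Measurable fun x => mainTerm e (s x) T (u x) := by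
  have h1 : Measurable fun x => ENNReal.ofReal (T * u x * ((1 + e) *
      Real.exp (-((1 - e) * (T * u x ^ 2 / (2 * ((1 + e) * s x))))))) := by fun_prop
  exact Measurable.ite (hu measurableSet_Icc) h1 measurable_const

/-- The main term charges gaps of vanishing size only, where the conditional density is close to its
value at the tie by uniform continuity. -/
theorem eventually_lintegral_mainTerm_le (hh : HasUnifContCondDensity (Set.Icc θ₁ θ₂) H h)
    (hH : ∀ᵐ μ ∂H, ∀ a, μ a ∈ Set.Icc θ₁ θ₂) (hK : 2 ≤ K) (hr0 : 0 < r) (hr1 : r < 1)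
    (hv0 : ∀ a x, 0 < v a x) (hvm : ∀ a, Measurable (v a)) {e : ℝ} (he0 : 0 < e) (he1 : e < 1) :
    ∀ᶠ T : ℕ in atTop, ∀ a,
      ∫⁻ μ, mainTerm e (pairVar hK r v a (drop a μ)) T (bestMean hK a (drop a μ) - μ a) ∂H ≤
        ∫⁻ ν, ENNReal.ofReal ((h a (bestMean hK a ν) ν + e) *
          ((1 + e) ^ 2 / (1 - e) * pairVar hK r v a ν)) ∂(marginal H a) := by
  obtain ⟨d, hd, hmod⟩ := hh.unifCont e he0
  filter_upwards [tendsto_scale.eventually_ge_atTop 1, tendsto_scale.eventually_ge_atTop (1 / d)]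
    with T h1 h2 a
  have hx0 : 0 < scale T := by linarith
  have hδd : 1 / scale T ^ 31 ≤ d := by
    have : 1 / d ≤ scale T ^ 31 := h2.trans (le_self_pow₀ h1 (by norm_num))
    rw [div_le_iff₀ hd] at this
    rwa [div_le_iff₀ (by positivity), mul_comm]
  have hbm := measurable_bestMean hK a
  have hG : Measurable fun p : ({b : Fin K // b ≠ a} → ℝ) × ℝ =>
      mainTerm e (pairVar hK r v a p.1) T (bestMean hK a p.1 - p.2) :=
    measurable_mainTerm e T ((measurable_pairVar hK r hvm a).comp measurable_fst)
      ((hbm.comp measurable_fst).sub measurable_snd)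
  have hdis := hh.lintegral_drop a hG
  simp only at hdis
  rw [hdis]
  refine lintegral_mono_ae ?_
  filter_upwards [ae_marginal_mem measurableSet_Icc hH a] with ν hν
  have hξ := bestMean_mem hK hν
  have hs := pairVar_pos hK hr0 hr1 hv0 a ν
  have hm : Measurable fun y => mainTerm e (pairVar hK r v a ν) T (bestMean hK a ν - y) :=
    measurable_mainTerm e T measurable_const (measurable_const.sub measurable_id)
  calc ∫⁻ y in Set.Icc θ₁ θ₂, ENNReal.ofReal (h a y ν) *
        mainTerm e (pairVar hK r v a ν) T (bestMean hK a ν - y)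
      ≤ ∫⁻ y in Set.Icc θ₁ θ₂, ENNReal.ofReal (h a (bestMean hK a ν) ν + e) *
          mainTerm e (pairVar hK r v a ν) T (bestMean hK a ν - y) := by
        refine setLIntegral_mono' measurableSet_Icc fun y hy => ?_
        by_cases hu : bestMean hK a ν - y ∈ Set.Icc 0 (1 / scale T ^ 31)
        · refine mul_le_mul_left (ENNReal.ofReal_le_ofReal ?_) _
          have := hmod a y hy _ hξ (abs_le.2 ⟨by linarith [hu.2], by linarith [hu.1]⟩) ν hν
          linarith [(abs_le.1 this).2]
        · rw [mainTerm, Set.indicator_of_notMem hu, mul_zero, mul_zero]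
    _ ≤ ENNReal.ofReal (h a (bestMean hK a ν) ν + e) *
          ∫⁻ u, mainTerm e (pairVar hK r v a ν) T u := by
        rw [lintegral_const_mul _ hm]
        refine mul_le_mul_right ((setLIntegral_le_lintegral _ _).trans (le_of_eq ?_)) _
        exact lintegral_sub_left_eq_self (mainTerm e (pairVar hK r v a ν) T) (bestMean hK a ν)
    _ ≤ _ := by
        rw [ENNReal.ofReal_mul (by have := hh.nonneg a _ hξ ν hν; linarith)]
        exact mul_le_mul_right (lintegral_mainTerm_le he0 he1 hs T) _

/-- Upper bound for `T` times the contribution of each arm to the average regret. -/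
theorem eventually_lintegral_recommend_le [IsProbabilityMeasure H] [Nonempty (Fin K)]
    (hP : ∀ a, HasGaussianMGF θ₁ θ₂ S (v a) (P a)) (hS : 0 < S)
    (hvS : ∀ a, ∀ s ∈ Set.Icc θ₁ θ₂, v a s ≤ S) (hs₀ : 0 < s₀)
    (hv : ∀ a, ∀ s ∈ Set.Icc θ₁ θ₂, s₀ ≤ v a s)
    (hvc : ∀ a, ContinuousOn (v a) (Set.Icc θ₁ θ₂)) (hv0 : ∀ a x, 0 < v a x)
    (hvm : ∀ a, Measurable (v a)) (hh : HasUnifContCondDensity (Set.Icc θ₁ θ₂) H h) (hθ : θ₁ < θ₂)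
    (hH : ∀ᵐ μ ∂H, ∀ a, μ a ∈ Set.Icc θ₁ θ₂) (hK : 2 ≤ K) (hr0 : 0 < r) (hr1 : r < 1)
    {Q : (Fin K → ℝ) → Measure (Fin K → ℝ)}
    (hQ1 : ∀ μ : Fin K → ℝ, (∀ a, μ a ∈ Set.Icc θ₁ θ₂) → IsProbabilityMeasure (Q μ))
    (hQ : ∀ μ : Fin K → ℝ, (∀ a, μ a ∈ Set.Icc θ₁ θ₂) →
      ∀ a, (Q μ).map (fun y => y a) = P a (μ a)) {e : ℝ} (he0 : 0 < e) (he1 : e < 1) :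
    ∀ᶠ T : ℕ in atTop, ∀ a,
      ∫⁻ μ, ENNReal.ofReal (T * (bestMean hK a (drop a μ) - μ a)) *
        experimentLaw r T (Q μ) {z | recommend r z.1 z.2 = a} ∂H ≤
      ∫⁻ ν, ENNReal.ofReal ((h a (bestMean hK a ν) ν + e) *
          ((1 + e) ^ 2 / (1 - e) * pairVar hK r v a ν)) ∂(marginal H a) + ENNReal.ofReal e := by
  obtain ⟨C, k, hC, hk, hpt⟩ := eventually_mul_recommend_le hP hS hvS hs₀ hv hvc hK hr0 hr1 he0 he1
  have herr : ∀ᶠ T : ℕ in atTop, ∀ a,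
      ∫⁻ μ, errorTerm hK θ₁ θ₂ C k (scale T) a μ ∂H ≤ ENNReal.ofReal e :=
    eventually_all.2 fun a => (tendsto_errorTerm hh hθ hH hK hC hk a).eventually_le_const
      (ENNReal.ofReal_pos.2 he0)
  filter_upwards [hpt, herr, eventually_lintegral_mainTerm_le hh hH hK hr0 hr1 hv0 hvm he0 he1]
    with T h1 h2 h3 a
  have hm : Measurable fun μ : Fin K → ℝ =>
      mainTerm e (pairVar hK r v a (drop a μ)) T (bestMean hK a (drop a μ) - μ a) :=
    measurable_mainTerm e T ((measurable_pairVar hK r hvm a).comp (measurable_drop a))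
      (((measurable_bestMean hK a).comp (measurable_drop a)).sub (measurable_pi_apply a))
  calc _ ≤ ∫⁻ μ, (mainTerm e (pairVar hK r v a (drop a μ)) T (bestMean hK a (drop a μ) - μ a) +
        errorTerm hK θ₁ θ₂ C k (scale T) a μ) ∂H := by
        refine lintegral_mono_ae ?_
        filter_upwards [hH] with μ hμ using h1 (Q μ) μ (hQ1 μ hμ) (hQ μ hμ) hμ a
    _ ≤ _ := by
        rw [lintegral_add_left hm]
        exact add_le_add (h3 a) (h2 a)

end Average

/-! ### Comparing the variances of the two best arms at ties -/

section Symmetry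

variable {K : ℕ} {θ₁ θ₂ S D : ℝ} {v : Fin K → ℝ → ℝ} {H : Measure (Fin K → ℝ)}
  {h : (a : Fin K) → ℝ → ({b : Fin K // b ≠ a} → ℝ) → ℝ}

/-- The density of ties of `a` with the best other arm is controlled by the parameters for which `a`
is better than all other arms by at most `ε`. If the best other mean is within `ε` of the right
endpoint there is no room above it; this has probability of order `ε`. -/
theorem mul_lintegral_le_of_above [IsProbabilityMeasure H]
    (hh : HasUnifContCondDensity (Set.Icc θ₁ θ₂) H h) (hD0 : 0 ≤ D)
    (hH : ∀ᵐ μ ∂H, ∀ a, μ a ∈ Set.Icc θ₁ θ₂)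
    (hD : ∀ a, ∀ᵐ ν ∂(marginal H a), ∀ y ∈ Set.Icc θ₁ θ₂, h a y ν ≤ D) (hK : 2 ≤ K)
    (hS : 0 ≤ S) (hvS : ∀ a x, v a x ≤ S) (hv0 : ∀ a x, 0 < v a x) (hvm : ∀ a, Measurable (v a))
    {e ε : ℝ} (he : 0 ≤ e) (hε : 0 < ε) (a : Fin K)
    (hmodv : ∀ x ∈ Set.Icc θ₁ θ₂, ∀ y ∈ Set.Icc θ₁ θ₂, |x - y| ≤ ε → v a x ≤ (1 + e) * v a y)
    (hmodh : ∀ x ∈ Set.Icc θ₁ θ₂, ∀ y ∈ Set.Icc θ₁ θ₂, |x - y| ≤ ε →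
      ∀ ν, (∀ c, ν c ∈ Set.Icc θ₁ θ₂) → |h a x ν - h a y ν| ≤ e) :
    ENNReal.ofReal ε * ∫⁻ ν, ENNReal.ofReal
        (v a (bestMean hK a ν) * h a (bestMean hK a ν) ν) ∂(marginal H a) ≤
      ENNReal.ofReal (1 + e) * ∫⁻ μ, ENNReal.ofReal (v a (μ a)) *
          (Set.Ioc 0 ε).indicator (fun _ => 1) (μ a - bestMean hK a (drop a μ)) ∂H +
        ENNReal.ofReal (ε * (S * e)) + ENNReal.ofReal (ε * (S * D * (K * (D * (2 * ε))))) := by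
  have hbm := measurable_bestMean hK a
  have hind : Measurable ((Set.Ioc (0 : ℝ) ε).indicator fun _ => (1 : ℝ≥0∞)) :=
    measurable_const.indicator measurableSet_Ioc
  have hlay : Measurable ((layer θ₁ θ₂ ε).indicator fun _ => (1 : ℝ≥0∞)) :=
    measurable_const.indicator (measurableSet_layer ε)
  have hlb : Measurable fun ν =>
      (layer θ₁ θ₂ ε).indicator (fun _ => (1 : ℝ≥0∞)) (bestMean hK a ν) := hlay.comp hbm
  have hG : Measurable fun p : ({b : Fin K // b ≠ a} → ℝ) × ℝ => ENNReal.ofReal (v a p.2) *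
      (Set.Ioc 0 ε).indicator (fun _ => 1) (p.2 - bestMean hK a p.1) :=
    ((hvm a).comp measurable_snd).ennreal_ofReal.mul
      (hind.comp (measurable_snd.sub (hbm.comp measurable_fst)))
  have hF : Measurable fun ν => ENNReal.ofReal (v a (bestMean hK a ν) * h a (bestMean hK a ν) ν) :=
    (((hvm a).comp hbm).mul (hh.measurable_bestMean hK a)).ennreal_ofReal
  have hdis := hh.lintegral_drop a hG
  simp only at hdis
  have hI : Measurable fun ν => ∫⁻ y in Set.Icc θ₁ θ₂, ENNReal.ofReal (h a y ν) *
      (ENNReal.ofReal (v a y) * (Set.Ioc 0 ε).indicator (fun _ => 1) (y - bestMean hK a ν)) :=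
    ((hh.measurable a).ennreal_ofReal.mul hG).lintegral_prod_right'
  have hpt : ∀ᵐ ν ∂(marginal H a), ENNReal.ofReal ε *
      ENNReal.ofReal (v a (bestMean hK a ν) * h a (bestMean hK a ν) ν) ≤
      ENNReal.ofReal (1 + e) * (∫⁻ y in Set.Icc θ₁ θ₂, ENNReal.ofReal (h a y ν) *
        (ENNReal.ofReal (v a y) * (Set.Ioc 0 ε).indicator (fun _ => 1) (y - bestMean hK a ν))) +
      ENNReal.ofReal (ε * (S * e)) + ENNReal.ofReal (ε * (S * D)) *
        (layer θ₁ θ₂ ε).indicator (fun _ => 1) (bestMean hK a ν) := by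
    filter_upwards [ae_marginal_mem measurableSet_Icc hH a, hD a] with ν hν hDν
    set ξ := bestMean hK a ν with hξdef
    have hξ : ξ ∈ Set.Icc θ₁ θ₂ := bestMean_mem hK hν
    rcases le_or_gt (ξ + ε) θ₂ with h1 | h1
    · refine le_add_right ?_
      have hsub : Set.Ioc ξ (ξ + ε) ⊆ Set.Icc θ₁ θ₂ := fun y hy =>
        ⟨hξ.1.trans hy.1.le, hy.2.trans h1⟩
      have hvol : volume (Set.Ioc ξ (ξ + ε)) = ENNReal.ofReal ε := by
        rw [Real.volume_Ioc, add_sub_cancel_left]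
      have hmeas : Measurable fun y => ENNReal.ofReal (h a y ν) * (ENNReal.ofReal (v a y) *
          (Set.Ioc 0 ε).indicator (fun _ => 1) (y - ξ)) :=
        (((hh.measurable a).comp measurable_prodMk_left).ennreal_ofReal).mul
          ((hvm a).ennreal_ofReal.mul (hind.comp (measurable_id.sub_const ξ)))
      calc ENNReal.ofReal ε * ENNReal.ofReal (v a ξ * h a ξ ν)
          = ∫⁻ _ in Set.Ioc ξ (ξ + ε), ENNReal.ofReal (v a ξ * h a ξ ν) := by
            rw [setLIntegral_const, hvol, mul_comm]
        _ ≤ ∫⁻ y in Set.Ioc ξ (ξ + ε), (ENNReal.ofReal (1 + e) * (ENNReal.ofReal (h a y ν) *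
              (ENNReal.ofReal (v a y) * (Set.Ioc 0 ε).indicator (fun _ => 1) (y - ξ))) +
              ENNReal.ofReal (S * e)) := by
            refine setLIntegral_mono' measurableSet_Ioc fun y hy => ?_
            have hyΘ := hsub hy
            have hmem : y - ξ ∈ Set.Ioc 0 ε := ⟨by linarith [hy.1], by linarith [hy.2]⟩
            have habs : |ξ - y| ≤ ε := abs_le.2 ⟨by linarith [hy.2], by linarith [hy.1]⟩
            have hy0 := hh.nonneg a y hyΘ ν hν
            have hv' := hv0 a y
            rw [Set.indicator_of_mem hmem, mul_one, ← ENNReal.ofReal_mul hy0,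
              ← ENNReal.ofReal_mul (by linarith), ← ENNReal.ofReal_add (by positivity)
              (by positivity)]
            refine ENNReal.ofReal_le_ofReal ?_
            have g1 := (abs_le.1 (hmodh ξ hξ y hyΘ habs ν hν)).2
            have g2 := hmodv ξ hξ y hyΘ habs
            have g3 := hvS a ξ
            have g4 := hv0 a ξ
            calc v a ξ * h a ξ ν ≤ v a ξ * (h a y ν + e) := by gcongr; linarith
              _ = v a ξ * h a y ν + v a ξ * e := by ring
              _ ≤ (1 + e) * v a y * h a y ν + S * e := by gcongr
              _ = _ := by ring
        _ = ENNReal.ofReal (1 + e) * (∫⁻ y in Set.Ioc ξ (ξ + ε), ENNReal.ofReal (h a y ν) *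
              (ENNReal.ofReal (v a y) * (Set.Ioc 0 ε).indicator (fun _ => 1) (y - ξ))) +
              ENNReal.ofReal (ε * (S * e)) := by
            rw [lintegral_add_right _ measurable_const, lintegral_const_mul _ hmeas,
              setLIntegral_const, hvol, mul_comm (ENNReal.ofReal (S * e)),
              ← ENNReal.ofReal_mul hε.le]
        _ ≤ _ := by
            refine add_le_add (mul_le_mul_right (lintegral_mono_set hsub) _) le_rfl
    · have hl : ξ ∈ layer θ₁ θ₂ ε := Or.inr ⟨by linarith, hξ.2⟩
      refine le_add_left ?_
      rw [Set.indicator_of_mem hl, mul_one, ← ENNReal.ofReal_mul hε.le]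
      refine ENNReal.ofReal_le_ofReal ?_
      have g1 := hh.nonneg a ξ hξ ν hν
      gcongr
      · exact hvS a ξ
      · exact hDν ξ hξ
  rw [← lintegral_const_mul _ hF]
  refine (lintegral_mono_ae hpt).trans ?_
  rw [lintegral_add_left ((hI.const_mul _).fun_add measurable_const),
    lintegral_add_left (hI.const_mul _), lintegral_const_mul _ hI, ← hdis, lintegral_const,
    measure_univ, mul_one, lintegral_const_mul _ hlb,
    ← mul_assoc ε (S * D), ENNReal.ofReal_mul (p := ε * (S * D)) (by positivity)]
  refine add_le_add le_rfl (mul_le_mul_right ?_ _)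
  have hsub : (drop a) ⁻¹' (bestMean hK a ⁻¹' layer θ₁ θ₂ ε) ⊆
      ⋃ c, {μ : Fin K → ℝ | μ c ∈ layer θ₁ θ₂ ε} := fun μ hμ =>
    Set.mem_iUnion.2 ⟨(bestArm hK a (drop a μ)).1, hμ⟩
  refine (((lintegral_indicator_const (hbm (measurableSet_layer ε)) 1).trans
    (one_mul _))).le.trans ?_
  rw [marginal, Measure.map_apply (measurable_drop a) (hbm (measurableSet_layer ε))]
  refine (measure_mono hsub).trans ((measure_iUnion_le _).trans ?_)
  rw [tsum_fintype]
  refine (Finset.sum_le_sum fun c _ => measure_layer_le hh hD0 hD hε.le c).trans (le_of_eq ?_)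
  rw [Finset.sum_const, Finset.card_univ, Fintype.card_fin, nsmul_eq_mul,
    ENNReal.ofReal_mul (p := (K : ℝ)) (by positivity), ENNReal.ofReal_natCast]

/-- The parameters for which `a` is worse than the best arm by at most `ε` are controlled by the
density of ties of `a` with the best other arm. -/
theorem lintegral_le_of_below [IsProbabilityMeasure H]
    (hh : HasUnifContCondDensity (Set.Icc θ₁ θ₂) H h) (hH : ∀ᵐ μ ∂H, ∀ a, μ a ∈ Set.Icc θ₁ θ₂)
    (hK : 2 ≤ K) (hS : 0 ≤ S) (hvS : ∀ a x, v a x ≤ S) (hv0 : ∀ a x, 0 < v a x)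
    (hvm : ∀ a, Measurable (v a)) {e ε : ℝ} (he : 0 ≤ e) (hε : 0 < ε) (a : Fin K)
    (hmodh : ∀ x ∈ Set.Icc θ₁ θ₂, ∀ y ∈ Set.Icc θ₁ θ₂, |x - y| ≤ ε →
      ∀ ν, (∀ c, ν c ∈ Set.Icc θ₁ θ₂) → |h a x ν - h a y ν| ≤ e) :
    ∫⁻ μ, ENNReal.ofReal (v (bestArm hK a (drop a μ)).1 (bestMean hK a (drop a μ))) *
        (Set.Ioc 0 ε).indicator (fun _ => 1) (bestMean hK a (drop a μ) - μ a) ∂H ≤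
      ENNReal.ofReal ε * (∫⁻ ν, ENNReal.ofReal
        (v (bestArm hK a ν).1 (bestMean hK a ν) * h a (bestMean hK a ν) ν) ∂(marginal H a) +
          ENNReal.ofReal (S * e)) := by
  have hbm := measurable_bestMean hK a
  have hbv := measurable_bestVar hK hvm a
  have hind : Measurable ((Set.Ioc (0 : ℝ) ε).indicator fun _ => (1 : ℝ≥0∞)) :=
    measurable_const.indicator measurableSet_Ioc
  have hG : Measurable fun p : ({b : Fin K // b ≠ a} → ℝ) × ℝ =>
      ENNReal.ofReal (v (bestArm hK a p.1).1 (bestMean hK a p.1)) *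
      (Set.Ioc 0 ε).indicator (fun _ => 1) (bestMean hK a p.1 - p.2) :=
    (hbv.comp measurable_fst).ennreal_ofReal.mul
      (hind.comp ((hbm.comp measurable_fst).sub measurable_snd))
  have hdis := hh.lintegral_drop a hG
  simp only at hdis
  have hF : Measurable fun ν => ENNReal.ofReal
      (v (bestArm hK a ν).1 (bestMean hK a ν) * h a (bestMean hK a ν) ν) :=
    (hbv.mul (hh.measurable_bestMean hK a)).ennreal_ofReal
  have hint : ∫⁻ u, (Set.Ioc (0 : ℝ) ε).indicator (fun _ => (1 : ℝ≥0∞)) u = ENNReal.ofReal ε := by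
    rw [lintegral_indicator_const measurableSet_Ioc, one_mul, Real.volume_Ioc, sub_zero]
  have hconst : ∫⁻ _, ENNReal.ofReal (S * e) ∂(marginal H a) = ENNReal.ofReal (S * e) := by
    rw [lintegral_const, measure_univ, mul_one]
  rw [hdis, ← hconst, ← lintegral_add_left hF,
    ← lintegral_const_mul _ (hF.fun_add measurable_const)]
  refine lintegral_mono_ae ?_
  filter_upwards [ae_marginal_mem measurableSet_Icc hH a] with ν hν
  set ξ := bestMean hK a ν with hξdef
  set w := v (bestArm hK a ν).1 ξ with hw
  have hξ : ξ ∈ Set.Icc θ₁ θ₂ := bestMean_mem hK hν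
  have hw0 : 0 < w := hv0 _ _
  have hwS : w ≤ S := hvS _ _
  have h0 := hh.nonneg a ξ hξ ν hν
  have hm : Measurable fun y => (Set.Ioc 0 ε).indicator (fun _ => (1 : ℝ≥0∞)) (ξ - y) :=
    hind.comp (measurable_const.sub measurable_id)
  calc ∫⁻ y in Set.Icc θ₁ θ₂, ENNReal.ofReal (h a y ν) * (ENNReal.ofReal w *
        (Set.Ioc 0 ε).indicator (fun _ => 1) (ξ - y))
      ≤ ∫⁻ y in Set.Icc θ₁ θ₂, ENNReal.ofReal (w * h a ξ ν + S * e) *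
        (Set.Ioc 0 ε).indicator (fun _ => 1) (ξ - y) := by
        refine setLIntegral_mono' measurableSet_Icc fun y hy => ?_
        by_cases hu : ξ - y ∈ Set.Ioc 0 ε
        · have hy0 := hh.nonneg a y hy ν hν
          rw [Set.indicator_of_mem hu, mul_one, mul_one, ← ENNReal.ofReal_mul hy0]
          refine ENNReal.ofReal_le_ofReal ?_
          have g1 := (abs_le.1 (hmodh y hy ξ hξ
            (abs_le.2 ⟨by linarith [hu.2], by linarith [hu.1]⟩) ν hν)).2
          calc h a y ν * w ≤ (h a ξ ν + e) * w := by gcongr; linarith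
            _ = w * h a ξ ν + w * e := by ring
            _ ≤ w * h a ξ ν + S * e := by gcongr
        · rw [Set.indicator_of_notMem hu, mul_zero, mul_zero, mul_zero]
    _ ≤ ENNReal.ofReal (w * h a ξ ν + S * e) * ENNReal.ofReal ε := by
        rw [lintegral_const_mul _ hm, ← hint]
        refine mul_le_mul_right ((setLIntegral_le_lintegral _ _).trans (le_of_eq ?_)) _
        exact lintegral_sub_left_eq_self ((Set.Ioc (0 : ℝ) ε).indicator fun _ => (1 : ℝ≥0∞)) ξ
    _ = _ := by
        rw [mul_comm, ENNReal.ofReal_add (by positivity) (by positivity)]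

/-- If some arm is the best one by at most `ε`, then it is the best other arm of the second best
one. -/
theorem sum_above_le_sum_below (hK : 2 ≤ K) (v : Fin K → ℝ → ℝ) (ε : ℝ) (μ : Fin K → ℝ) :
    ∑ a, ENNReal.ofReal (v a (μ a)) *
        (Set.Ioc 0 ε).indicator (fun _ => 1) (μ a - bestMean hK a (drop a μ)) ≤
      ∑ a, ENNReal.ofReal (v (bestArm hK a (drop a μ)).1 (bestMean hK a (drop a μ))) *
        (Set.Ioc 0 ε).indicator (fun _ => 1) (bestMean hK a (drop a μ) - μ a) := by
  by_cases hex : ∃ a, μ a - bestMean hK a (drop a μ) ∈ Set.Ioc 0 ε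
  · obtain ⟨a, ha⟩ := hex
    have hlt : ∀ c, c ≠ a → μ c < μ a := fun c hc =>
      (le_bestMean hK a (drop a μ) ⟨c, hc⟩).trans_lt (by linarith [ha.1])
    have hothers : ∀ c (hc : c ≠ a), bestArm hK c (drop c μ) = ⟨a, hc.symm⟩ := by
      intro c hc
      by_contra hcon
      have h1 := hlt (bestArm hK c (drop c μ)).1 fun h => hcon (Subtype.ext h)
      have h2 := le_bestMean hK c (drop c μ) ⟨a, fun h => hc h.symm⟩
      exact absurd h1 (not_lt.2 h2)
    have hmean : ∀ c, c ≠ a → bestMean hK c (drop c μ) = μ a := fun c hc => by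
      rw [bestMean, hothers c hc]; rfl
    rw [Finset.sum_eq_single a]
    · set b := (bestArm hK a (drop a μ)).1 with hb
      have hba : b ≠ a := (bestArm hK a (drop a μ)).2
      refine le_trans (le_of_eq ?_) (Finset.single_le_sum
        (f := fun a => ENNReal.ofReal (v (bestArm hK a (drop a μ)).1 (bestMean hK a (drop a μ))) *
        (Set.Ioc 0 ε).indicator (fun _ => 1) (bestMean hK a (drop a μ) - μ a))
        (fun _ _ => zero_le) (Finset.mem_univ b))
      rw [hmean b hba, hothers b hba]
      rfl
    · intro c _ hc
      rw [Set.indicator_of_notMem, mul_zero]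
      intro hmem
      rw [hmean c hc] at hmem
      linarith [hmem.1, hlt c hc]
    · simp
  · simp only [not_exists] at hex
    rw [Finset.sum_eq_zero fun a _ => by rw [Set.indicator_of_notMem (hex a), mul_zero]]
    exact zero_le

/-- Weighting the density of ties with the variance of the arm that ties with the best other arm
gives no more than weighting it with the variance of the latter: a near tie of the two best arms is
seen from the best arm on the left and from the second best one on the right, and both times the
variance is that of the best arm. -/
theorem sum_lintegral_le [IsProbabilityMeasure H]
    (hh : HasUnifContCondDensity (Set.Icc θ₁ θ₂) H h) (hD0 : 0 ≤ D)
    (hH : ∀ᵐ μ ∂H, ∀ a, μ a ∈ Set.Icc θ₁ θ₂)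
    (hD : ∀ a, ∀ᵐ ν ∂(marginal H a), ∀ y ∈ Set.Icc θ₁ θ₂, h a y ν ≤ D) (hK : 2 ≤ K)
    {s₀ : ℝ} (hs₀ : 0 < s₀) (hvs₀ : ∀ a x, s₀ ≤ v a x) (hvS : ∀ a x, v a x ≤ S)
    (hvc : ∀ a, Continuous (v a)) :
    ∑ a, ∫⁻ ν, ENNReal.ofReal
        (v a (bestMean hK a ν) * h a (bestMean hK a ν) ν) ∂(marginal H a) ≤
      ∑ a, ∫⁻ ν, ENNReal.ofReal
        (v (bestArm hK a ν).1 (bestMean hK a ν) * h a (bestMean hK a ν) ν) ∂(marginal H a) := by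
  have hS : 0 ≤ S := hs₀.le.trans ((hvs₀ ⟨0, by omega⟩ 0).trans (hvS _ _))
  have hv0 : ∀ a x, 0 < v a x := fun a x => hs₀.trans_le (hvs₀ a x)
  have hvm : ∀ a, Measurable (v a) := fun a => (hvc a).measurable
  set I₁ := fun a => ∫⁻ ν, ENNReal.ofReal
    (v a (bestMean hK a ν) * h a (bestMean hK a ν) ν) ∂(marginal H a) with hI₁
  set I₂ := fun a => ∫⁻ ν, ENNReal.ofReal
    (v (bestArm hK a ν).1 (bestMean hK a ν) * h a (bestMean hK a ν) ν) ∂(marginal H a) with hI₂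
  have hfin : ∑ a, I₂ a ≠ ∞ := by
    refine ENNReal.sum_ne_top.2 fun a _ => ne_top_of_le_ne_top
      (ENNReal.ofReal_ne_top (r := S * D)) ?_
    have hc : ∫⁻ _, ENNReal.ofReal (S * D) ∂(marginal H a) = ENNReal.ofReal (S * D) := by
      rw [lintegral_const, measure_univ, mul_one]
    rw [← hc]
    refine lintegral_mono_ae ?_
    filter_upwards [ae_marginal_mem measurableSet_Icc hH a, hD a] with ν hν hDν
    have hξ := bestMean_mem hK hν
    have := hh.nonneg a _ hξ ν hν
    refine ENNReal.ofReal_le_ofReal ?_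
    gcongr
    · exact hvS _ _
    · exact hDν _ hξ
  set i₂ := (∑ a, I₂ a).toReal with hi₂
  have hi₂0 : 0 ≤ i₂ := ENNReal.toReal_nonneg
  have hI₂eq : ∑ a, I₂ a = ENNReal.ofReal i₂ := (ENNReal.ofReal_toReal hfin).symm
  have key : ∀ e : ℝ, 0 < e → ∑ a, I₁ a ≤ ENNReal.ofReal
      ((1 + e) * (i₂ + K * (S * e)) + K * (S * e) + K * (S * D * (K * (D * (2 * e))))) := by
    intro e he
    obtain ⟨d₁, hd₁, hmodv⟩ := exists_modulus (v := v) (θ₁ := θ₁) (θ₂ := θ₂) hs₀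
      (fun a s _ => hvs₀ a s) (fun a => (hvc a).continuousOn) he
    obtain ⟨d₂, hd₂, hmodh⟩ := hh.unifCont e he
    set ε := min e (min d₁ d₂) with hε
    have hε0 : 0 < ε := lt_min he (lt_min hd₁ hd₂)
    have hεe : ε ≤ e := min_le_left _ _
    have hε1 : ε ≤ d₁ := (min_le_right _ _).trans (min_le_left _ _)
    have hε2 : ε ≤ d₂ := (min_le_right _ _).trans (min_le_right _ _)
    have habove := fun a => mul_lintegral_le_of_above hh hD0 hH hD hK hS hvS hv0 hvm he.le hε0 a
      (fun x hx y hy hxy => hmodv a x hx y hy (hxy.trans hε1))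
      (fun x hx y hy hxy => hmodh a x hx y hy (hxy.trans hε2))
    have hbelow := fun a => lintegral_le_of_below (v := v) hh hH hK hS hvS hv0 hvm he.le hε0 a
      (fun x hx y hy hxy => hmodh a x hx y hy (hxy.trans hε2))
    have hind : Measurable ((Set.Ioc (0 : ℝ) ε).indicator fun _ => (1 : ℝ≥0∞)) :=
      measurable_const.indicator measurableSet_Ioc
    have hbmd : ∀ a, Measurable fun μ : Fin K → ℝ => bestMean hK a (drop a μ) := fun a =>
      (measurable_bestMean hK a).comp (measurable_drop a)
    have hmid : ∑ a, ∫⁻ μ, ENNReal.ofReal (v a (μ a)) *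
          (Set.Ioc 0 ε).indicator (fun _ => 1) (μ a - bestMean hK a (drop a μ)) ∂H ≤
        ENNReal.ofReal ε * (∑ a, I₂ a + K * ENNReal.ofReal (S * e)) := by
      calc _ = ∫⁻ μ, ∑ a, ENNReal.ofReal (v a (μ a)) *
            (Set.Ioc 0 ε).indicator (fun _ => 1) (μ a - bestMean hK a (drop a μ)) ∂H :=
            (lintegral_finsetSum _ fun a _ =>
              ((hvm a).comp (measurable_pi_apply a)).ennreal_ofReal.mul
                (hind.comp ((measurable_pi_apply a).sub (hbmd a)))).symm
        _ ≤ ∫⁻ μ, ∑ a, ENNReal.ofReal (v (bestArm hK a (drop a μ)).1 (bestMean hK a (drop a μ))) *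
            (Set.Ioc 0 ε).indicator (fun _ => 1) (bestMean hK a (drop a μ) - μ a) ∂H :=
            lintegral_mono fun μ => sum_above_le_sum_below hK v ε μ
        _ = ∑ a, ∫⁻ μ, ENNReal.ofReal
              (v (bestArm hK a (drop a μ)).1 (bestMean hK a (drop a μ))) *
            (Set.Ioc 0 ε).indicator (fun _ => 1) (bestMean hK a (drop a μ) - μ a) ∂H :=
            lintegral_finsetSum _ fun a _ =>
              ((measurable_bestVar hK hvm a).comp (measurable_drop a)).ennreal_ofReal.mul
                (hind.comp ((hbmd a).sub (measurable_pi_apply a)))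
        _ ≤ ∑ a, ENNReal.ofReal ε * (I₂ a + ENNReal.ofReal (S * e)) :=
            Finset.sum_le_sum fun a _ => hbelow a
        _ = _ := by
            rw [← Finset.mul_sum, Finset.sum_add_distrib, Finset.sum_const, Finset.card_univ,
              Fintype.card_fin, nsmul_eq_mul]
    have hεne : ENNReal.ofReal ε ≠ 0 := (ENNReal.ofReal_pos.2 hε0).ne'
    rw [← ENNReal.mul_le_mul_iff_right hεne ENNReal.ofReal_ne_top]
    have hKof : (K : ℝ≥0∞) = ENNReal.ofReal K := (ENNReal.ofReal_natCast K).symm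
    calc ENNReal.ofReal ε * ∑ a, I₁ a = ∑ a, ENNReal.ofReal ε * I₁ a := Finset.mul_sum _ _ _
      _ ≤ ∑ a, (ENNReal.ofReal (1 + e) * ∫⁻ μ, ENNReal.ofReal (v a (μ a)) *
          (Set.Ioc 0 ε).indicator (fun _ => 1) (μ a - bestMean hK a (drop a μ)) ∂H +
          ENNReal.ofReal (ε * (S * e)) + ENNReal.ofReal (ε * (S * D * (K * (D * (2 * ε)))))) :=
          Finset.sum_le_sum fun a _ => habove a
      _ = ENNReal.ofReal (1 + e) * ∑ a, ∫⁻ μ, ENNReal.ofReal (v a (μ a)) *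
          (Set.Ioc 0 ε).indicator (fun _ => 1) (μ a - bestMean hK a (drop a μ)) ∂H +
          K * ENNReal.ofReal (ε * (S * e)) +
          K * ENNReal.ofReal (ε * (S * D * (K * (D * (2 * ε))))) := by
          rw [Finset.sum_add_distrib, Finset.sum_add_distrib, ← Finset.mul_sum, Finset.sum_const,
            Finset.sum_const, Finset.card_univ, Fintype.card_fin, nsmul_eq_mul, nsmul_eq_mul]
      _ ≤ ENNReal.ofReal (1 + e) * (ENNReal.ofReal ε * (∑ a, I₂ a + K * ENNReal.ofReal (S * e))) +
          K * ENNReal.ofReal (ε * (S * e)) +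
          K * ENNReal.ofReal (ε * (S * D * (K * (D * (2 * e))))) := by gcongr
      _ = _ := by
          rw [hI₂eq, hKof, ← ENNReal.ofReal_mul (by positivity),
            ← ENNReal.ofReal_mul (by positivity),
            ← ENNReal.ofReal_mul (by positivity), ← ENNReal.ofReal_add (by positivity)
            (by positivity), ← ENNReal.ofReal_mul (by positivity),
            ← ENNReal.ofReal_mul (by positivity), ← ENNReal.ofReal_add (by positivity)
            (by positivity), ← ENNReal.ofReal_add (by positivity) (by positivity),
            ← ENNReal.ofReal_mul (by positivity)]
          congr 1
          ring
  rw [hI₂eq]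
  have hcont : Continuous fun e : ℝ => ENNReal.ofReal
      ((1 + e) * (i₂ + K * (S * e)) + K * (S * e) + K * (S * D * (K * (D * (2 * e))))) := by
    refine ENNReal.continuous_ofReal.comp ?_
    fun_prop
  have hlim := (hcont.tendsto 0).mono_left (nhdsWithin_le_nhds (s := Set.Ioi 0))
  simp only [mul_zero, add_zero, one_mul] at hlim
  refine ge_of_tendsto hlim ?_
  filter_upwards [self_mem_nhdsWithin] with e he using key e he

end Symmetry

/-! ### The Bayes regret -/

section BayesRegret

theorem HasGaussianMGF.congr {θ₁ θ₂ S : ℝ} {v w : ℝ → ℝ} {P : ℝ → Measure ℝ}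
    (hP : HasGaussianMGF θ₁ θ₂ S v P) (hvw : ∀ x ∈ Set.Icc θ₁ θ₂, v x = w x) :
    HasGaussianMGF θ₁ θ₂ S w P where
  isProb := hP.isProb
  integrable_sq := hP.integrable_sq
  mean_eq := hP.mean_eq
  measurable := hP.measurable
  var_eq x hx := (hP.var_eq x hx).trans (hvw x hx)
  lintegral_exp_le x l M h1 h2 hM := hP.lintegral_exp_le x l M h1 h2 fun s hs => by
    rw [hvw s ⟨h1.trans hs.1, hs.2.trans h2⟩]
    exact hM s hs

variable {K : ℕ} {θ₁ θ₂ S D r : ℝ} {v : Fin K → ℝ → ℝ} {P : Fin K → ℝ → Measure ℝ}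
  {H : Measure (Fin K → ℝ)} {h : (a : Fin K) → ℝ → ({b : Fin K // b ≠ a} → ℝ) → ℝ}
  {Q : (Fin K → ℝ) → Measure (Fin K → ℝ)}

/-- The regret is integrable, and its integral splits into the contributions of the arms that may
be recommended. -/
theorem integrable_regret_and_eq [IsProbabilityMeasure H] [Nonempty (Fin K)]
    (hP : ∀ a, HasGaussianMGF θ₁ θ₂ S (v a) (P a)) (hθ : θ₁ ≤ θ₂)
    (hH : ∀ᵐ μ ∂H, ∀ a, μ a ∈ Set.Icc θ₁ θ₂) (hK : 2 ≤ K)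
    (hQ1 : ∀ μ : Fin K → ℝ, (∀ a, μ a ∈ Set.Icc θ₁ θ₂) → IsProbabilityMeasure (Q μ))
    (hQ : ∀ μ : Fin K → ℝ, (∀ a, μ a ∈ Set.Icc θ₁ θ₂) →
      ∀ a, (Q μ).map (fun y => y a) = P a (μ a)) (T : ℕ) :
    Integrable (fun μ => regret r T (Q μ) μ) H ∧
      ENNReal.ofReal (T * ∫ μ, regret r T (Q μ) μ ∂H) =
        ∑ a, ∫⁻ μ, ENNReal.ofReal (T * (bestMean hK a (drop a μ) - μ a)) *
          experimentLaw r T (Q μ) {z | recommend r z.1 z.2 = a} ∂H := by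
  choose R hRm hR using exists_measurable_recommendProb r T hθ hP
  have hbmd : ∀ a, Measurable fun μ : Fin K → ℝ => bestMean hK a (drop a μ) - μ a := fun a =>
    ((measurable_bestMean hK a).comp (measurable_drop a)).sub (measurable_pi_apply a)
  set g := fun μ : Fin K → ℝ =>
    ∑ a, max (bestMean hK a (drop a μ) - μ a) 0 * (R a μ).toReal with hg
  have hgm : Measurable g := Finset.measurable_fun_sum _ fun a _ =>
    ((hbmd a).max measurable_const).mul (hRm a).ennreal_toReal
  have hae : ∀ᵐ μ ∂H, regret r T (Q μ) μ = g μ := by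
    filter_upwards [hH] with μ hμ
    have := hQ1 μ hμ
    rw [regret_eq_sum]
    exact Finset.sum_congr rfl fun a _ => by
      rw [gap_eq_max hK, hR a μ (Q μ) this hμ (hQ μ hμ)]
  have hg0 : ∀ μ, 0 ≤ g μ := fun μ => Finset.sum_nonneg fun a _ =>
    mul_nonneg (le_max_right _ _) ENNReal.toReal_nonneg
  have hgb : ∀ᵐ μ ∂H, ‖g μ‖ ≤ θ₂ - θ₁ := by
    filter_upwards [hH] with μ hμ
    have := hQ1 μ hμ
    rw [Real.norm_eq_abs, abs_of_nonneg (hg0 μ)]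
    calc g μ ≤ ∑ a, (θ₂ - θ₁) * (R a μ).toReal := by
          refine Finset.sum_le_sum fun a _ => mul_le_mul_of_nonneg_right ?_ ENNReal.toReal_nonneg
          rw [← gap_eq_max hK]
          linarith [(hμ (argmax μ)).2, (hμ a).1]
      _ = θ₂ - θ₁ := by
          rw [← Finset.mul_sum]
          have h1 := sum_recommend (r := r) (T := T) (Q μ)
          simp only [fun a => hR a μ (Q μ) this hμ (hQ μ hμ)] at h1
          rw [h1, mul_one]
  have hgi : Integrable g H := Integrable.of_bound hgm.aestronglyMeasurable _ hgb
  refine ⟨hgi.congr (hae.mono fun μ hμ => hμ.symm), ?_⟩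
  rw [integral_congr_ae hae, ← integral_const_mul, ofReal_integral_eq_lintegral_ofReal
    (hgi.const_mul _) (Eventually.of_forall fun μ => mul_nonneg T.cast_nonneg (hg0 μ))]
  have hterm : ∀ μ, ENNReal.ofReal (T * g μ) =
      ∑ a, ENNReal.ofReal (T * (bestMean hK a (drop a μ) - μ a)) *
        ENNReal.ofReal (R a μ).toReal := by
    intro μ
    rw [hg]
    simp only
    rw [Finset.mul_sum, ENNReal.ofReal_sum_of_nonneg fun a _ =>
      mul_nonneg T.cast_nonneg (mul_nonneg (le_max_right _ _) ENNReal.toReal_nonneg)]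
    refine Finset.sum_congr rfl fun a _ => ?_
    rw [← mul_assoc, ENNReal.ofReal_mul' ENNReal.toReal_nonneg]
    congr 1
    rcases le_total 0 (bestMean hK a (drop a μ) - μ a) with h0 | h0
    · rw [max_eq_left h0]
    · rw [max_eq_right h0, mul_zero, ENNReal.ofReal_zero, ENNReal.ofReal_of_nonpos
        (mul_nonpos_of_nonneg_of_nonpos T.cast_nonneg h0)]
  have hterm_meas : ∀ a, Measurable fun μ : Fin K → ℝ =>
      ENNReal.ofReal (T * (bestMean hK a (drop a μ) - μ a)) * ENNReal.ofReal (R a μ).toReal :=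
    fun a => ((hbmd a).const_mul _).ennreal_ofReal.mul (hRm a).ennreal_toReal.ennreal_ofReal
  simp only [hterm]
  rw [lintegral_finsetSum _ fun a _ => hterm_meas a]
  refine Finset.sum_congr rfl fun a _ => lintegral_congr_ae ?_
  filter_upwards [hH] with μ hμ
  have := hQ1 μ hμ
  rw [← hR a μ (Q μ) this hμ (hQ μ hμ), ENNReal.ofReal_toReal (measure_ne_top _ _)]

/-- The sum of integrals in the upper bound has nonnegative bounded integrands, so it is nonnegative
and may be computed with lower Lebesgue integrals. -/
theorem sum_lintegral_bestVar_eq [IsProbabilityMeasure H]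
    (hh : HasUnifContCondDensity (Set.Icc θ₁ θ₂) H h)
    (hH : ∀ᵐ μ ∂H, ∀ a, μ a ∈ Set.Icc θ₁ θ₂)
    (hD : ∀ a, ∀ᵐ ν ∂(marginal H a), ∀ y ∈ Set.Icc θ₁ θ₂, h a y ν ≤ D) (hK : 2 ≤ K)
    (hv0 : ∀ a x, 0 < v a x) (hvS : ∀ a x, v a x ≤ S) (hvm : ∀ a, Measurable (v a))
    {σsq : Fin K → ℝ → ℝ} (hσ : ∀ a, ∀ x ∈ Set.Icc θ₁ θ₂, v a x = σsq a x) :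
    ∑ a, ∫⁻ ν, ENNReal.ofReal
        (v (bestArm hK a ν).1 (bestMean hK a ν) * h a (bestMean hK a ν) ν) ∂(marginal H a) =
      ENNReal.ofReal (bayesFunctional hK σsq H h) ∧ 0 ≤ bayesFunctional hK σsq H h := by
  have hnn : ∀ a, ∀ᵐ ν ∂(marginal H a),
      0 ≤ v (bestArm hK a ν).1 (bestMean hK a ν) * h a (bestMean hK a ν) ν := fun a => by
    filter_upwards [ae_marginal_mem measurableSet_Icc hH a] with ν hν
    exact mul_nonneg (hv0 _ _).le (hh.nonneg a _ (bestMean_mem hK hν) ν hν)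
  have heq : bayesFunctional hK σsq H h = ∑ a, ∫ ν,
      v (bestArm hK a ν).1 (bestMean hK a ν) * h a (bestMean hK a ν) ν ∂(marginal H a) := by
    refine Finset.sum_congr rfl fun a _ => integral_congr_ae ?_
    filter_upwards [ae_marginal_mem measurableSet_Icc hH a] with ν hν
    rw [hσ _ _ (bestMean_mem hK hν)]
    rfl
  have hi0 : ∀ a, 0 ≤ ∫ ν,
      v (bestArm hK a ν).1 (bestMean hK a ν) * h a (bestMean hK a ν) ν ∂(marginal H a) := fun a =>
    integral_nonneg_of_ae (hnn a)
  refine ⟨?_, heq ▸ Finset.sum_nonneg fun a _ => hi0 a⟩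
  rw [heq, ENNReal.ofReal_sum_of_nonneg fun a _ => hi0 a]
  refine Finset.sum_congr rfl fun a _ => ?_
  refine (ofReal_integral_eq_lintegral_ofReal ?_ (hnn a)).symm
  refine Integrable.of_bound (C := S * D) ((measurable_bestVar hK hvm a).mul
    (hh.measurable_bestMean hK a)).aestronglyMeasurable ?_
  filter_upwards [hnn a, ae_marginal_mem measurableSet_Icc hH a, hD a] with ν h0 hν hDν
  have hξ := bestMean_mem hK hν
  rw [Real.norm_eq_abs, abs_of_nonneg h0]
  exact mul_le_mul (hvS _ _) (hDν _ hξ) (hh.nonneg a _ hξ ν hν) ((hv0 a 0).le.trans (hvS a 0))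

/-- Up to an arbitrarily small relative and absolute error, `T` times the Bayes regret is eventually
bounded by the claimed limit. -/
theorem eventually_mul_integral_regret_le [IsProbabilityMeasure H] [Nonempty (Fin K)]
    (hP : ∀ a, HasGaussianMGF θ₁ θ₂ S (v a) (P a)) {s₀ : ℝ} (hs₀ : 0 < s₀)
    (hvs₀ : ∀ a x, s₀ ≤ v a x) (hvS : ∀ a x, v a x ≤ S) (hvc : ∀ a, Continuous (v a))
    {σsq : Fin K → ℝ → ℝ} (hσ : ∀ a, ∀ x ∈ Set.Icc θ₁ θ₂, v a x = σsq a x)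
    (hh : HasUnifContCondDensity (Set.Icc θ₁ θ₂) H h) (hθ : θ₁ < θ₂)
    (hH : ∀ᵐ μ ∂H, ∀ a, μ a ∈ Set.Icc θ₁ θ₂) (hK : 2 ≤ K) (hr0 : 0 < r) (hr1 : r < 1)
    (hQ1 : ∀ μ : Fin K → ℝ, (∀ a, μ a ∈ Set.Icc θ₁ θ₂) → IsProbabilityMeasure (Q μ))
    (hQ : ∀ μ : Fin K → ℝ, (∀ a, μ a ∈ Set.Icc θ₁ θ₂) →
      ∀ a, (Q μ).map (fun y => y a) = P a (μ a)) {e : ℝ} (he0 : 0 < e) (he1 : e < 1) :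
    ∀ᶠ T : ℕ in atTop, T * ∫ μ, regret r T (Q μ) μ ∂H ≤
      2 / (1 - (K - 2) * (r / K)) * ((1 + e) ^ 2 / (1 - e)) *
        (2 * bayesFunctional hK σsq H h + K * (2 * S * e)) + K * e := by
  have hv0 : ∀ a x, 0 < v a x := fun a x => hs₀.trans_le (hvs₀ a x)
  have hvm : ∀ a, Measurable (v a) := fun a => (hvc a).measurable
  have hS : 0 < S := (hv0 (Classical.arbitrary _) 0).trans_le (hvS _ _)
  obtain ⟨D, hD0, hD⟩ := hh.exists_bound hθ hH
  obtain ⟨hJ, hJ0⟩ := sum_lintegral_bestVar_eq hh hH hD hK hv0 hvS hvm hσ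
  have hsym := sum_lintegral_le hh hD0.le hH hD hK hs₀ hvs₀ hvS hvc
  set J := bayesFunctional hK σsq H h
  have hK0 : (2 : ℝ) ≤ K := by exact_mod_cast hK
  have hc0 : 0 < 1 - ((K : ℝ) - 2) * (r / K) := by
    have h1 : ((K : ℝ) - 2) * (r / K) ≤ r := by
      rw [← mul_div_assoc, div_le_iff₀ (by linarith)]
      nlinarith
    linarith
  have h1e : 0 < 1 - e := by linarith
  set c := 2 / (1 - ((K : ℝ) - 2) * (r / K)) * ((1 + e) ^ 2 / (1 - e)) with hc
  have hcpos : 0 < c := by positivity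
  have hKof : (K : ℝ≥0∞) = ENNReal.ofReal K := (ENNReal.ofReal_natCast K).symm
  have harm : ∀ a, ∫⁻ ν, ENNReal.ofReal ((h a (bestMean hK a ν) ν + e) *
        ((1 + e) ^ 2 / (1 - e) * pairVar hK r v a ν)) ∂(marginal H a) ≤
      ENNReal.ofReal c * (∫⁻ ν, ENNReal.ofReal
        (v a (bestMean hK a ν) * h a (bestMean hK a ν) ν) ∂(marginal H a) +
        ∫⁻ ν, ENNReal.ofReal
        (v (bestArm hK a ν).1 (bestMean hK a ν) * h a (bestMean hK a ν) ν) ∂(marginal H a) +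
        ENNReal.ofReal (2 * S * e)) := by
    intro a
    have hconst : ∫⁻ _, ENNReal.ofReal (2 * S * e) ∂(marginal H a) =
        ENNReal.ofReal (2 * S * e) := by
      rw [lintegral_const, measure_univ, mul_one]
    have hm1 : Measurable fun ν => ENNReal.ofReal
        (v a (bestMean hK a ν) * h a (bestMean hK a ν) ν) :=
      (((hvm a).comp (measurable_bestMean hK a)).mul (hh.measurable_bestMean hK a)).ennreal_ofReal
    have hm2 : Measurable fun ν => ENNReal.ofReal
        (v (bestArm hK a ν).1 (bestMean hK a ν) * h a (bestMean hK a ν) ν) :=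
      ((measurable_bestVar hK hvm a).mul (hh.measurable_bestMean hK a)).ennreal_ofReal
    rw [← hconst, ← lintegral_add_left hm1, ← lintegral_add_left (hm1.fun_add hm2),
      ← lintegral_const_mul _ ((hm1.fun_add hm2).fun_add measurable_const)]
    refine lintegral_mono_ae ?_
    filter_upwards [ae_marginal_mem measurableSet_Icc hH a] with ν hν
    have g1 := hh.nonneg a _ (bestMean_mem hK hν) ν hν
    have g2 := hv0 a (bestMean hK a ν)
    have g3 := hv0 (bestArm hK a ν).1 (bestMean hK a ν)
    have g4 := hvS a (bestMean hK a ν)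
    have g5 := hvS (bestArm hK a ν).1 (bestMean hK a ν)
    rw [← ENNReal.ofReal_add (by positivity) (by positivity),
      ← ENNReal.ofReal_add (by positivity) (by positivity), ← ENNReal.ofReal_mul hcpos.le]
    refine ENNReal.ofReal_le_ofReal ?_
    calc _ = c * (v a (bestMean hK a ν) * h a (bestMean hK a ν) ν +
          v (bestArm hK a ν).1 (bestMean hK a ν) * h a (bestMean hK a ν) ν +
          (v a (bestMean hK a ν) + v (bestArm hK a ν).1 (bestMean hK a ν)) * e) := by
          rw [hc, pairVar]
          ring
      _ ≤ _ := by
          gcongr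
          linarith
  filter_upwards [eventually_lintegral_recommend_le hP hS (fun a s _ => hvS a s) hs₀
    (fun a s _ => hvs₀ a s) (fun a => (hvc a).continuousOn) hv0 hvm hh hθ hH hK hr0 hr1 hQ1 hQ
    he0 he1] with T hT
  rw [← ENNReal.ofReal_le_ofReal_iff (by positivity),
    (integrable_regret_and_eq hP hθ.le hH hK hQ1 hQ T).2]
  calc _ ≤ ∑ a, (ENNReal.ofReal c * (∫⁻ ν, ENNReal.ofReal
        (v a (bestMean hK a ν) * h a (bestMean hK a ν) ν) ∂(marginal H a) +
        ∫⁻ ν, ENNReal.ofReal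
        (v (bestArm hK a ν).1 (bestMean hK a ν) * h a (bestMean hK a ν) ν) ∂(marginal H a) +
        ENNReal.ofReal (2 * S * e)) + ENNReal.ofReal e) :=
        Finset.sum_le_sum fun a _ => (hT a).trans (add_le_add (harm a) le_rfl)
    _ ≤ ENNReal.ofReal c * (ENNReal.ofReal J + ENNReal.ofReal J + K * ENNReal.ofReal (2 * S * e)) +
        K * ENNReal.ofReal e := by
        rw [Finset.sum_add_distrib, ← Finset.mul_sum, Finset.sum_add_distrib,
          Finset.sum_add_distrib, Finset.sum_const, Finset.sum_const, Finset.card_univ,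
          Fintype.card_fin, nsmul_eq_mul, nsmul_eq_mul, hJ]
        rw [hJ] at hsym
        gcongr
    _ = _ := by
        rw [hKof, ← ENNReal.ofReal_mul (by positivity), ← ENNReal.ofReal_mul (by positivity),
          ← ENNReal.ofReal_add hJ0 hJ0, ← ENNReal.ofReal_add (by positivity) (by positivity),
          ← ENNReal.ofReal_mul hcpos.le, ← ENNReal.ofReal_add (by positivity) (by positivity)]
        congr 1
        ring

/-- Clamping the parameter extends the variance functions to continuous functions on `ℝ` with
uniform positive bounds. -/
theorem exists_clamp_variance [Nonempty (Fin K)] (hθ : θ₁ < θ₂) {σsq : Fin K → ℝ → ℝ}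
    (hσ_cont : ∀ a, ContinuousOn (σsq a) (Set.Icc θ₁ θ₂))
    (hσ_pos : ∀ a, ∀ x ∈ Set.Icc θ₁ θ₂, 0 < σsq a x) :
    ∃ (v : Fin K → ℝ → ℝ) (s₀ S : ℝ), 0 < s₀ ∧ (∀ a x, s₀ ≤ v a x) ∧ (∀ a x, v a x ≤ S) ∧
      (∀ a, Continuous (v a)) ∧ ∀ a, ∀ x ∈ Set.Icc θ₁ θ₂, v a x = σsq a x := by
  set cl : ℝ → ℝ := fun s => max θ₁ (min θ₂ s) with hcl
  have hclc : Continuous cl := by fun_prop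
  have hclm : ∀ s, cl s ∈ Set.Icc θ₁ θ₂ := fun s =>
    ⟨le_max_left _ _, max_le hθ.le (min_le_left _ _)⟩
  have hcls : ∀ s ∈ Set.Icc θ₁ θ₂, cl s = s := fun s hs => by
    rw [hcl]
    simp only
    rw [min_eq_right hs.2, max_eq_right hs.1]
  obtain ⟨S, hSb⟩ := isCompact_Icc.exists_bound_of_continuousOn
    (f := fun s => ∑ a, (σsq a s + 1 / σsq a s)) (s := Set.Icc θ₁ θ₂)
    (continuousOn_finsetSum _ fun a _ => (hσ_cont a).add
      (continuousOn_const.div (hσ_cont a) fun s hs => (hσ_pos a s hs).ne'))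
  have hb : ∀ a, ∀ s ∈ Set.Icc θ₁ θ₂, σsq a s + 1 / σsq a s ≤ S := fun a s hs =>
    (Finset.single_le_sum (f := fun a => σsq a s + 1 / σsq a s)
      (fun b _ => (add_pos (hσ_pos b s hs) (one_div_pos.2 (hσ_pos b s hs))).le)
      (Finset.mem_univ a)).trans ((le_abs_self _).trans (hSb s hs))
  have hub : ∀ a, ∀ s ∈ Set.Icc θ₁ θ₂, σsq a s ≤ S := fun a s hs => by
    linarith [hb a s hs, one_div_pos.2 (hσ_pos a s hs)]
  have hlb : ∀ a, ∀ s ∈ Set.Icc θ₁ θ₂, 1 / σsq a s ≤ S := fun a s hs => by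
    linarith [hb a s hs, hσ_pos a s hs]
  have hθ1 : θ₁ ∈ Set.Icc θ₁ θ₂ := Set.left_mem_Icc.2 hθ.le
  have hS : 0 < S := (hσ_pos (Classical.arbitrary _) θ₁ hθ1).trans_le (hub _ θ₁ hθ1)
  exact ⟨fun a x => σsq a (cl x), 1 / S, S, one_div_pos.2 hS,
    fun a x => (one_div_le hS (hσ_pos a _ (hclm x))).2 (hlb a _ (hclm x)),
    fun a x => hub a _ (hclm x), fun a => (hσ_cont a).comp_continuous hclc hclm,
    fun a x hx => by simp only [hcls x hx]⟩

theorem limsup_le_of_forall_eventually_le {u : ℕ → ℝ} {B : ℝ → ℝ} {L : ℝ}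
    (hB : Tendsto B (𝓝[>] 0) (𝓝 L))
    (hu : ∀ e, 0 < e → e < 1 → ∀ᶠ T in atTop, u T ≤ B e) :
    limsup (fun T => (u T : EReal)) atTop ≤ (L : EReal) := by
  refine ge_of_tendsto ((continuous_coe_real_ereal.tendsto L).comp hB) ?_
  filter_upwards [Ioo_mem_nhdsGT (zero_lt_one' ℝ)] with e he
  refine limsup_le_of_le (h := ?_)
  filter_upwards [hu e he.1 he.2] with T hT using EReal.coe_le_coe_iff.2 hT

end BayesRegret

end TSEBA

theorem mainTheorem4
    (K : ℕ) (hK : 2 ≤ K) [Nonempty (Fin K)]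
    (θ₁ θ₂ : ℝ) (hθ : θ₁ < θ₂)
    (𝒴 : Set ℝ) (h𝒴 : MeasurableSet 𝒴)
    (σsq : Fin K → ℝ → ℝ)
    (hσ_cont : ∀ a, ContinuousOn (σsq a) (Set.Icc θ₁ θ₂))
    (hσ_pos : ∀ a, ∀ x ∈ Set.Icc θ₁ θ₂, 0 < σsq a x)
    -- the marginal outcome distributions `P a μ_a`
    (P : Fin K → ℝ → Measure ℝ)
    (hP : ∀ a, TSEBA.IsMeanParamFamily (Set.Icc θ₁ θ₂) 𝒴 (σsq a) (P a))
    -- the joint law `Q μ` of the outcomes of the arms in one round, with these marginals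
    (Q : (Fin K → ℝ) → Measure (Fin K → ℝ))
    (hQ : ∀ μ : Fin K → ℝ, (∀ a, μ a ∈ Set.Icc θ₁ θ₂) →
      ∀ a, (Q μ).map (fun y => y a) = P a (μ a))
    -- the prior and its conditional densities
    (H : Measure (Fin K → ℝ)) [IsProbabilityMeasure H]
    (hH : ∀ᵐ μ ∂H, ∀ a, μ a ∈ Set.Icc θ₁ θ₂)
    (h : (a : Fin K) → ℝ → ({b : Fin K // b ≠ a} → ℝ) → ℝ)
    (hh : TSEBA.HasUnifContCondDensity (Set.Icc θ₁ θ₂) H h)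
    (h₂ : (a b : Fin K) → ℝ → ℝ → ({c : Fin K // c ≠ a ∧ c ≠ b} → ℝ) → ℝ)
    (hh₂ : TSEBA.HasUnifContCondDensity₂ (Set.Icc θ₁ θ₂) H h₂)
    -- the split ratio
    (r : ℝ) (hr0 : 0 < r) (hr1 : r < 1)
    (hr : ∀ a b : Fin K, a ≠ b → ∀ x ∈ Set.Icc θ₁ θ₂, ∀ y ∈ Set.Icc θ₁ θ₂,
      r / K ≤ Real.sqrt (σsq a x) / (Real.sqrt (σsq a x) + Real.sqrt (σsq b y))) :
    (∀ T : ℕ, Integrable (fun μ => TSEBA.regret r T (Q μ) μ) H) ∧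
    Filter.limsup
        (fun T : ℕ => (((T : ℝ) * ∫ μ, TSEBA.regret r T (Q μ) μ ∂H : ℝ) : EReal)) Filter.atTop
      ≤ ((4 / (1 - ((K : ℝ) - 2) * r / K) * TSEBA.bayesFunctional hK σsq H h : ℝ) : EReal) := by
  obtain ⟨v, s₀, S, hs₀, hvs₀, hvS, hvc, hv⟩ := TSEBA.exists_clamp_variance hθ hσ_cont hσ_pos
  have hG : ∀ a, TSEBA.HasGaussianMGF θ₁ θ₂ S (v a) (P a) := fun a => by
    obtain ⟨f, hf⟩ := hP a
    exact (hf.hasGaussianMGF h𝒴 hθ (hσ_cont a) (hσ_pos a) fun s hs => hv a s hs ▸ hvS a s).congr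
      fun x hx => (hv a x hx).symm
  -- `Q μ` has total mass one because its marginals do
  have hQ1 : ∀ μ : Fin K → ℝ, (∀ a, μ a ∈ Set.Icc θ₁ θ₂) → IsProbabilityMeasure (Q μ) := by
    intro μ hμ
    let a : Fin K := Classical.arbitrary _
    have h1 := (hG a).isProb (μ a) (hμ a)
    rw [← hQ μ hμ a] at h1
    exact ⟨by simpa [Measure.map_apply (measurable_pi_apply a)] using h1.measure_univ⟩
  refine ⟨fun T => (TSEBA.integrable_regret_and_eq hG hθ.le hH hK hQ1 hQ T).1, ?_⟩
  refine TSEBA.limsup_le_of_forall_eventually_le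
    (B := fun e => 2 / (1 - (K - 2) * (r / K)) * ((1 + e) ^ 2 / (1 - e)) *
      (2 * TSEBA.bayesFunctional hK σsq H h + K * (2 * S * e)) + K * e) ?_
    fun e he0 he1 => TSEBA.eventually_mul_integral_regret_le hG hs₀ hvs₀ hvS hvc hv hh hθ hH hK
      hr0 hr1 hQ1 hQ he0 he1
  have hcont : ContinuousAt (fun e : ℝ => 2 / (1 - (K - 2) * (r / K)) * ((1 + e) ^ 2 / (1 - e)) *
      (2 * TSEBA.bayesFunctional hK σsq H h + K * (2 * S * e)) + K * e) 0 := by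
    have h0 : (1 : ℝ) - 0 ≠ 0 := by norm_num
    fun_prop (disch := assumption)
  convert hcont.tendsto.mono_left nhdsWithin_le_nhds using 2
  rw [← mul_div_assoc]
  ring
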